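/- Let $M$ be a connected smooth surface with a smooth Lorentzian metric $g$ (signature $(1,1)$, a vector $v$ being timelike if $g(v,v)>0$), with Gauss curvature $K$ defined by $d\eta^1=-\eta^1_2\wedge\eta^2$, $d\eta^2=-\eta^1_2\wedge\eta^1$, $d\eta^1_2=-K\,\eta^1\wedge\eta^2$ for local orthonormal coframes, $g=(\eta^1)^2-(\eta^2)^2$. Let $\mathcal F$ be the oriented orthonormal frame bundle of Minkowski space $\mathbb R^{1,2}$ (quadratic form $x_1^2-x_2^2-x_3^2$), with canonical forms $\omega^i$ and connection forms $\omega^i_j$ given by $d\rho=\mathsf e_i\omega^i$, $d\mathsf e_j=\mathsf e_i\omega^i_j$, where $\rho$ is the base point and $(\mathsf e_1,\mathsf e_2,\mathsf e_3)$ the frame. With a local orthonormal coframe on $M$, the isometric embedding system of $g$ is the exterior differential system on the product of (an open subset of) $M$ with $\mathcal F$ generated by $$\omega^3,\quad \omega^1-\eta^1,\quad \omega^2-\eta^2,\quad \omega^1_2-\eta^1_2 .$$ The metric is called elliptic if $K>0$ everywhere, and Darboux integrable if this system is Darboux integrable (complex-valued forms being allowed) in the following sense. Around each point there is a coframe $\theta^i,\hat\sigma^a,\check\sigma^\alpha$,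 where the $\theta^i$ are the four generators above and there are at least two $\hat\sigma^a$ and at least two $\check\sigma^\alpha$, such that the system is algebraically generated by the $\theta^i$ together with 2-forms $\hat\Omega^b\in\Lambda^2\langle\hat\sigma^a\rangle$ and $\check\Omega^\beta\in\Lambda^2\langle\check\sigma^\alpha\rangle$ (at least one of each kind); the systems algebraically generated by $\theta^i,\hat\sigma^a,\check\Omega^\beta$ and by $\theta^i,\check\sigma^\alpha,\hat\Omega^b$ are Pfaffian, i.e. generated differentially by their 1-forms; and $\hat V=\langle\theta^i,\hat\sigma^a\rangle$, $\check V=\langle\theta^i,\check\sigma^\alpha\rangle$ form a Darboux pair: writing $V^\infty$ for the final element of the derived flag of $V$, both $\hat V+\check V^\infty$ and $\check V+\hat V^\infty$ are the whole (complexified) cotangent bundle, $\hat V^\infty\cap\check V^\infty=0$, and $d\omega\in\Lambda^2\hat V+\Lambda^2\check V$ for every section $\omega$ of $\hat V\cap\check V$. **Theorem.** Suppose that $g$ is elliptic and Darboux integrable and that $g$ has a Killing field which is timelike at every point of $M$. Then, up to a constant positive factor, $g$ is locally equivalent to $$g_0=\sin^2u\,(dv)^2-\cos^4u\,(du)^2,\qquad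 0<u<\pi/2,$$ whose Gauss curvature is $\sec^4u$. That is, there is a constant $c>0$ such that around every point of $M$ there are local coordinates $(u,v)$ with $0<u<\pi/2$ in which $$g=c\left(\sin^2u\,(dv)^2-\cos^4u\,(du)^2\right),\qquad K=c^{-1}\sec^4u .$$ -/

import Mathlib

open scoped Manifold ContDiff Topology

noncomputable section

namespace DarbouxEmbedding

/-! ## Differential forms on open subsets of a normed space -/

section Forms

variable {E : Type*} [NormedAddCommGroup E] [NormedSpace ℝ E]

/-- The exterior derivative of a one-form `ξ`: `dξ (u, v) = (D_u ξ) v - (D_v ξ) u`. -/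
def extD {A : Type*} [NormedAddCommGroup A] [NormedSpace ℝ A]
    (ξ : E → E →L[ℝ] A) (x u v : E) : A :=
  fderiv ℝ ξ x u v - fderiv ℝ ξ x v u

/-- The wedge product of two covectors, as an alternating bilinear function. -/
def wedge {A : Type*} [NormedCommRing A] [NormedAlgebra ℝ A]
    (α β : E →L[ℝ] A) (u v : E) : A :=
  α u * β v - α v * β u

/-- The degree-two part of the algebraic ideal generated by the covectors in `V` and the
two-covectors in `S`, at one point. -/
def idealTwo (V : Submodule ℂ (E →L[ℝ] ℂ)) (S : Set (E → E → ℂ)) : Submodule ℂ (E → E → ℂ) :=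
  Submodule.span ℂ (S ∪ {w | ∃ α ∈ V, ∃ β : E →L[ℝ] ℂ, w = wedge α β})

/-- `Λ² V`: the two-covectors which are sums of products of two elements of `V`. -/
def lambdaTwo (V : Submodule ℂ (E →L[ℝ] ℂ)) : Submodule ℂ (E → E → ℂ) :=
  Submodule.span ℂ {w | ∃ α ∈ V, ∃ β ∈ V, w = wedge α β}

/-- `ξ` is, near `x`, a smooth section of the field `V` of subspaces of the complexified
cotangent spaces. -/
def IsSectionNear (V : E → Submodule ℂ (E →L[ℝ] ℂ)) (ξ : E → E →L[ℝ] ℂ) (x : E) : Prop :=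
  ∀ᶠ y in 𝓝 x, ContDiffAt ℝ ∞ ξ y ∧ ξ y ∈ V y

lemma extD_add {ξ₁ ξ₂ : E → E →L[ℝ] ℂ} {x : E} (h₁ : DifferentiableAt ℝ ξ₁ x)
    (h₂ : DifferentiableAt ℝ ξ₂ x) : extD (ξ₁ + ξ₂) x = extD ξ₁ x + extD ξ₂ x := by
  funext u v
  simp only [extD, fderiv_add h₁ h₂, Pi.add_apply, add_apply]
  ring

lemma extD_smul (c : ℂ) {ξ : E → E →L[ℝ] ℂ} {x : E} (h : DifferentiableAt ℝ ξ x) :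
    extD (c • ξ) x = c • extD ξ x := by
  funext u v
  simp only [extD, fderiv_const_smul h, Pi.smul_apply, smul_apply, smul_sub]

/-- The derived system of `V`: the values at `x` of the smooth sections `ξ` of `V` near `x`
with `dξ ≡ 0 mod V`. -/
def derivedSystem (V : E → Submodule ℂ (E →L[ℝ] ℂ)) (x : E) : Submodule ℂ (E →L[ℝ] ℂ) where
  carrier := {α | ∃ ξ : E → E →L[ℝ] ℂ, IsSectionNear V ξ x ∧
    (∀ᶠ y in 𝓝 x, extD ξ y ∈ idealTwo (V y) ∅) ∧ ξ x = α}
  zero_mem' := by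
    refine ⟨0, ?_, ?_, rfl⟩
    · exact Filter.Eventually.of_forall fun y => ⟨contDiffAt_const, (V y).zero_mem⟩
    · refine Filter.Eventually.of_forall fun y => ?_
      have : extD (0 : E → E →L[ℝ] ℂ) y = 0 := by
        funext u v
        simp [extD]
      rw [this]
      exact Submodule.zero_mem _
  add_mem' := by
    rintro _ _ ⟨ξ₁, s₁, d₁, rfl⟩ ⟨ξ₂, s₂, d₂, rfl⟩
    refine ⟨ξ₁ + ξ₂, ?_, ?_, rfl⟩
    · filter_upwards [s₁, s₂] with y h₁ h₂
      exact ⟨h₁.1.add h₂.1, (V y).add_mem h₁.2 h₂.2⟩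
    · filter_upwards [s₁, s₂, d₁, d₂] with y h₁ h₂ e₁ e₂
      rw [extD_add (h₁.1.differentiableAt (by simp)) (h₂.1.differentiableAt (by simp))]
      exact Submodule.add_mem _ e₁ e₂
  smul_mem' := by
    rintro c _ ⟨ξ, s, d, rfl⟩
    refine ⟨c • ξ, ?_, ?_, rfl⟩
    · filter_upwards [s] with y h
      exact ⟨h.1.const_smul c, (V y).smul_mem c h.2⟩
    · filter_upwards [s, d] with y h e
      rw [extD_smul c (h.1.differentiableAt (by simp))]
      exact Submodule.smul_mem _ c e

/-- `V^∞`: the final element of the derived flag `V ⊇ V' ⊇ V'' ⊇ ⋯`. -/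
def derivedLimit (V : E → Submodule ℂ (E →L[ℝ] ℂ)) (x : E) : Submodule ℂ (E →L[ℝ] ℂ) :=
  ⨅ n : ℕ, (derivedSystem^[n] V) x

/-! ## Decomposable systems and Darboux pairs -/

/-- The span at `y` of a family of one-forms. -/
def spanAt {ι : Type*} (θ : ι → E → E →L[ℝ] ℂ) (y : E) : Submodule ℂ (E →L[ℝ] ℂ) :=
  Submodule.span ℂ (Set.range fun i => θ i y)

/-- The pair of Pfaffian systems `V₁`, `V₂` is a Darboux pair on `N`. -/
structure IsDarbouxPair (V₁ V₂ : E → Submodule ℂ (E →L[ℝ] ℂ)) (N : Set E) : Prop where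
  sup_limit : ∀ y ∈ N, V₁ y ⊔ derivedLimit V₂ y = ⊤
  limit_sup : ∀ y ∈ N, V₂ y ⊔ derivedLimit V₁ y = ⊤
  inf_limit : ∀ y ∈ N, derivedLimit V₁ y ⊓ derivedLimit V₂ y = ⊥
  extD_mem : ∀ y ∈ N, ∀ ξ : E → E →L[ℝ] ℂ, IsSectionNear (fun z => V₁ z ⊓ V₂ z) ξ y →
    extD ξ y ∈ lambdaTwo (V₁ y) ⊔ lambdaTwo (V₂ y)

/-- On `N`, the exterior differential system generated differentially by the one-forms `θ` is
decomposable of type `[p, q]`: together with `σ₁`, `σ₂` the `θ` form a coframe, and the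
system is generated algebraically by `θ`, by two-forms `Ω₁` made of the `σ₁` and by two-forms
`Ω₂` made of the `σ₂`. All forms are complex-valued. -/
structure IsDecomposition {r p q s t : ℕ} (θ : Fin r → E → E →L[ℝ] ℂ)
    (σ₁ : Fin p → E → E →L[ℝ] ℂ) (σ₂ : Fin q → E → E →L[ℝ] ℂ)
    (Ω₁ : Fin s → E → E → E → ℂ) (Ω₂ : Fin t → E → E → E → ℂ) (N : Set E) : Prop where
  two_le_p : 2 ≤ p
  two_le_q : 2 ≤ q
  one_le_s : 1 ≤ s
  one_le_t : 1 ≤ t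
  smooth_σ₁ : ∀ a, ContDiffOn ℝ ∞ (σ₁ a) N
  smooth_σ₂ : ∀ a, ContDiffOn ℝ ∞ (σ₂ a) N
  smooth_Ω₁ : ∀ b u v, ContDiffOn ℝ ∞ (fun y => Ω₁ b y u v) N
  smooth_Ω₂ : ∀ b u v, ContDiffOn ℝ ∞ (fun y => Ω₂ b y u v) N
  indep : ∀ y ∈ N, LinearIndependent ℂ
    (Sum.elim (fun i => θ i y) (Sum.elim (fun a => σ₁ a y) (fun a => σ₂ a y)))
  span : ∀ y ∈ N, spanAt θ y ⊔ spanAt σ₁ y ⊔ spanAt σ₂ y = ⊤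
  mem_Ω₁ : ∀ b, ∀ y ∈ N, Ω₁ b y ∈ lambdaTwo (spanAt σ₁ y)
  mem_Ω₂ : ∀ b, ∀ y ∈ N, Ω₂ b y ∈ lambdaTwo (spanAt σ₂ y)
  generates : ∀ y ∈ N, idealTwo (spanAt θ y) (Set.range fun i => extD (θ i) y) =
    idealTwo (spanAt θ y) ((Set.range fun b => Ω₁ b y) ∪ (Set.range fun b => Ω₂ b y))

/-- The system generated algebraically by the one-forms `θ`, `σ` and the two-forms `Ω` is
Pfaffian on `N`: it is the system generated differentially by `θ` and `σ`. -/
def IsPfaffian {r p t : ℕ} (θ : Fin r → E → E →L[ℝ] ℂ) (σ : Fin p → E → E →L[ℝ] ℂ)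
    (Ω : Fin t → E → E → E → ℂ) (N : Set E) : Prop :=
  ∀ y ∈ N, idealTwo (spanAt θ y ⊔ spanAt σ y)
      ((Set.range fun i => extD (θ i) y) ∪ (Set.range fun a => extD (σ a) y)) =
    idealTwo (spanAt θ y ⊔ spanAt σ y) (Set.range fun b => Ω b y)

/-- The exterior differential system generated by the one-forms `θ` is Darboux integrable
near `x`: it is decomposable there, its singular systems are Pfaffian, and they form a
Darboux pair. -/
def IsDarbouxIntegrableNear {r : ℕ} (θ : Fin r → E → E →L[ℝ] ℂ) (x : E) : Prop :=
  ∃ (N : Set E) (p q s t : ℕ) (σ₁ : Fin p → E → E →L[ℝ] ℂ) (σ₂ : Fin q → E → E →L[ℝ] ℂ)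
    (Ω₁ : Fin s → E → E → E → ℂ) (Ω₂ : Fin t → E → E → E → ℂ),
    IsOpen N ∧ x ∈ N ∧ IsDecomposition θ σ₁ σ₂ Ω₁ Ω₂ N ∧
    IsPfaffian θ σ₁ Ω₂ N ∧ IsPfaffian θ σ₂ Ω₁ N ∧
    IsDarbouxPair (fun y => spanAt θ y ⊔ spanAt σ₁ y) (fun y => spanAt θ y ⊔ spanAt σ₂ y) N

end Forms

/-! ## Metrics in two coordinates -/

/-- The coordinate plane of a surface. -/
abbrev Plane : Type := EuclideanSpace ℝ (Fin 2)

/-- On `U`, the one-forms `η₁`, `η₂` are an orthonormal coframe of the Lorentzian metric `G`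
(with `η₁` dual to the timelike unit vector) and `η₁₂` is its connection form. -/
structure IsOrthonormalCoframe (G : Plane → Plane → Plane → ℝ) (U : Set Plane)
    (η₁ η₂ η₁₂ : Plane → Plane →L[ℝ] ℝ) : Prop where
  isOpen : IsOpen U
  smooth₁ : ContDiffOn ℝ ∞ η₁ U
  smooth₂ : ContDiffOn ℝ ∞ η₂ U
  smooth₁₂ : ContDiffOn ℝ ∞ η₁₂ U
  metric_eq : ∀ y ∈ U, ∀ a b, G y a b = η₁ y a * η₁ y b - η₂ y a * η₂ y b
  extD₁ : ∀ y ∈ U, ∀ a b, extD η₁ y a b = -wedge (η₁₂ y) (η₂ y) a b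
  extD₂ : ∀ y ∈ U, ∀ a b, extD η₂ y a b = -wedge (η₁₂ y) (η₁ y) a b

/-- The Lorentzian metric `G` has Gauss curvature `κ` at `y`, that is `dη₁₂ = -κ η₁ ∧ η₂` at `y`
in an orthonormal coframe. The sign agrees with that of the sectional curvature
`R(X, Y, Y, X) / (G(X, X) G(Y, Y) - G(X, Y)²)`. -/
def HasCoordCurvatureAt (G : Plane → Plane → Plane → ℝ) (y : Plane) (κ : ℝ) : Prop :=
  ∃ (U : Set Plane) (η₁ η₂ η₁₂ : Plane → Plane →L[ℝ] ℝ),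
    IsOrthonormalCoframe G U η₁ η₂ η₁₂ ∧ y ∈ U ∧
    ∀ a b, extD η₁₂ y a b = -κ * wedge (η₁ y) (η₂ y) a b

/-- The metric `sin² u dv² - cos⁴ u du²` in the coordinates `u = y 0`, `v = y 1`. -/
def normalForm (y a b : Plane) : ℝ :=
  Real.sin (y 0) ^ 2 * (a 1 * b 1) - Real.cos (y 0) ^ 4 * (a 0 * b 0)

/-! ## Lorentzian surfaces -/

section Surface

variable (M : Type*) [TopologicalSpace M] [ChartedSpace Plane M] [IsManifold (𝓡 2) ∞ M]

/-- A smooth Lorentzian metric on a smooth surface: a smooth field of symmetric bilinear forms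
of signature `(1, 1)` on the tangent planes. -/
structure LorentzianMetric where
  val : ∀ p : M, TangentSpace (𝓡 2) p →L[ℝ] TangentSpace (𝓡 2) p →L[ℝ] ℝ
  symm : ∀ p v w, val p v w = val p w v
  exists_pos : ∀ p, ∃ v, 0 < val p v v
  exists_neg : ∀ p, ∃ v, val p v v < 0
  contMDiff : ContMDiff (𝓡 2) ((𝓡 2).prod 𝓘(ℝ, Plane →L[ℝ] Plane →L[ℝ] ℝ)) ∞
    (fun p => Bundle.TotalSpace.mk' (Plane →L[ℝ] Plane →L[ℝ] ℝ)
      (E := fun p : M => TangentSpace (𝓡 2) p →L[ℝ] TangentSpace (𝓡 2) p →L[ℝ] ℝ) p (val p))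

variable {M}

namespace LorentzianMetric

/-- The metric in the coordinates given by the chart `φ`. -/
def coord (g : LorentzianMetric M) (φ : OpenPartialHomeomorph M Plane) (y a b : Plane) : ℝ :=
  g.val (φ.symm y) (mfderiv 𝓘(ℝ, Plane) (𝓡 2) φ.symm y a) (mfderiv 𝓘(ℝ, Plane) (𝓡 2) φ.symm y b)

/-- The metric `g` has Gauss curvature `κ` at `p`. -/
def HasGaussCurvatureAt (g : LorentzianMetric M) (p : M) (κ : ℝ) : Prop :=
  ∃ φ ∈ IsManifold.maximalAtlas (𝓡 2) ∞ M, p ∈ φ.source ∧ HasCoordCurvatureAt (g.coord φ) (φ p) κ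

/-- The isometric embedding system of `g` is elliptic: the Gauss curvature is positive. -/
def IsElliptic (g : LorentzianMetric M) : Prop :=
  ∀ p : M, ∃ κ : ℝ, 0 < κ ∧ g.HasGaussCurvatureAt p κ

end LorentzianMetric

/-- The vector field `X` in the coordinates given by the chart `φ`. -/
def coordField (X : ∀ p : M, TangentSpace (𝓡 2) p) (φ : OpenPartialHomeomorph M Plane)
    (y : Plane) : Plane :=
  mfderiv (𝓡 2) 𝓘(ℝ, Plane) φ (φ.symm y) (X (φ.symm y))

/-- `X` is a Killing field of `g`: it is smooth, and the Lie derivative `L_X g`, written in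
any chart, vanishes. -/
def IsKilling (g : LorentzianMetric M) (X : ∀ p : M, TangentSpace (𝓡 2) p) : Prop :=
  ContMDiff (𝓡 2) (𝓡 2).tangent ∞ (fun p => (⟨p, X p⟩ : TangentBundle (𝓡 2) M)) ∧
  ∀ φ ∈ IsManifold.maximalAtlas (𝓡 2) ∞ M, ∀ y ∈ φ.target, ∀ a b : Plane,
    fderiv ℝ (fun z => g.coord φ z a b) y (coordField X φ y)
      + g.coord φ y (fderiv ℝ (coordField X φ) y a) b
      + g.coord φ y a (fderiv ℝ (coordField X φ) y b) = 0

end Surface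

/-! ## The frame bundle of Minkowski space and the isometric embedding system -/

/-- The functional `⟨x, ·⟩` of the inner product of signature `(1, 2)` on `ℝ^{1,2}`. -/
def minkowski (x : Fin 3 → ℝ) : (Fin 3 → ℝ) →L[ℝ] ℝ :=
  x 0 • ContinuousLinearMap.proj 0 - x 1 • ContinuousLinearMap.proj 1
    - x 2 • ContinuousLinearMap.proj 2

/-- The squares `⟨e_i, e_i⟩` of the members of an orthonormal frame. -/
def frameSign : Fin 3 → ℝ := ![1, -1, -1]

/-- A point of `ℝ^{1,2}` with three vectors. -/
abbrev PointFrame : Type := (Fin 3 → ℝ) × (Fin 3 → Fin 3 → ℝ)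

/-- The oriented orthonormal frame bundle of `ℝ^{1,2}`. -/
def minkowskiFrames : Set PointFrame :=
  {f | (∀ i j, minkowski (f.2 i) (f.2 j) = if i = j then frameSign i else 0) ∧
    Matrix.det (Matrix.of f.2) = 1}

/-- Local coordinates on the (six-dimensional) frame bundle. -/
abbrev FrameCoord : Type := EuclideanSpace ℝ (Fin 6)

/-- `Ψ` is a smooth local parametrization of the frame bundle of `ℝ^{1,2}`. -/
structure IsFrameParametrization (W : Set FrameCoord) (Ψ : FrameCoord → PointFrame) : Prop where
  isOpen : IsOpen W
  smooth : ContDiffOn ℝ ∞ Ψ W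
  mapsTo : Set.MapsTo Ψ W minkowskiFrames
  injective_fderiv : ∀ w ∈ W, Function.Injective (fderiv ℝ Ψ w)

/-- The canonical form `ω^i` in the parametrization `Ψ`, given by `dρ = e_i ω^i`. -/
def canonicalForm (Ψ : FrameCoord → PointFrame) (i : Fin 3) (w : FrameCoord) :
    FrameCoord →L[ℝ] ℝ :=
  frameSign i • (minkowski ((Ψ w).2 i)).comp (fderiv ℝ (fun z => (Ψ z).1) w)

/-- The connection form `ω^i_j` in the parametrization `Ψ`, given by `de_j = e_i ω^i_j`. -/
def connectionForm (Ψ : FrameCoord → PointFrame) (i j : Fin 3) (w : FrameCoord) :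
    FrameCoord →L[ℝ] ℝ :=
  frameSign i • (minkowski ((Ψ w).2 i)).comp (fderiv ℝ (fun z => (Ψ z).2 j) w)

/-- The pull-back of a form `α` on the first and a form `β` on the second factor, combined to the
complex-valued form `β - α` on the product. -/
def diffForm (α : Plane → Plane →L[ℝ] ℝ) (β : FrameCoord → FrameCoord →L[ℝ] ℝ)
    (z : Plane × FrameCoord) : Plane × FrameCoord →L[ℝ] ℂ :=
  Complex.ofRealCLM.comp
    ((β z.2).comp (ContinuousLinearMap.snd ℝ Plane FrameCoord)
      - (α z.1).comp (ContinuousLinearMap.fst ℝ Plane FrameCoord))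

/-- The generators `ω³, ω¹ - η¹, ω² - η², ω¹₂ - η¹₂` of the isometric embedding system, on the
product of the surface and the frame bundle of `ℝ^{1,2}`. -/
def embeddingSystem (η₁ η₂ η₁₂ : Plane → Plane →L[ℝ] ℝ) (Ψ : FrameCoord → PointFrame) :
    Fin 4 → Plane × FrameCoord → Plane × FrameCoord →L[ℝ] ℂ :=
  ![diffForm 0 (canonicalForm Ψ 2), diffForm η₁ (canonicalForm Ψ 0),
    diffForm η₂ (canonicalForm Ψ 1), diffForm η₁₂ (connectionForm Ψ 0 1)]

/-- The metric `g` is Darboux integrable with respect to embedding into `ℝ^{1,2}`: around each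
point of the product of the surface and the frame bundle of `ℝ^{1,2}`, the isometric embedding
system, written in a local orthonormal coframe and local coordinates, is Darboux integrable. -/
def IsDarbouxIntegrable {M : Type*} [TopologicalSpace M] [ChartedSpace Plane M]
    [IsManifold (𝓡 2) ∞ M] (g : LorentzianMetric M) : Prop :=
  ∀ p : M, ∀ f ∈ minkowskiFrames,
    ∃ φ ∈ IsManifold.maximalAtlas (𝓡 2) ∞ M, p ∈ φ.source ∧
    ∃ (U : Set Plane) (η₁ η₂ η₁₂ : Plane → Plane →L[ℝ] ℝ),
      U ⊆ φ.target ∧ φ p ∈ U ∧ IsOrthonormalCoframe (g.coord φ) U η₁ η₂ η₁₂ ∧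
    ∃ (W : Set FrameCoord) (Ψ : FrameCoord → PointFrame) (w : FrameCoord),
      IsFrameParametrization W Ψ ∧ w ∈ W ∧ Ψ w = f ∧
      IsDarbouxIntegrableNear (embeddingSystem η₁ η₂ η₁₂ Ψ) (φ p, w)

end DarbouxEmbedding

end

set_option linter.unusedSimpArgs false
set_option linter.unusedSectionVars false

noncomputable section

namespace DarbouxEmbedding

/-! ## Calculus of one-forms -/

section FormCalculus

variable {E : Type*} [NormedAddCommGroup E] [NormedSpace ℝ E]

/-! The argument turns Darboux integrability into one ordinary differential equation and solves it
with two first integrals.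

A Killing field X has components x₁, x₂ in an orthonormal coframe, and its covariant derivative is
skew, hence given by one function `lam`. Put Q = x₁² - x₂² = g(X, X) and μ = x₁η₂ - x₂η₁, the
contraction of the area form with X. Then μ is closed, dQ = 2 lam μ and d lam = K μ. Since d² = 0,
it follows that dK = R μ and dR = B μ: every invariant depends on one variable only. As X is
timelike, a boost makes it F times the first frame vector, with F² = Q and μ equal to F times the
second covector (`exists_boost`). On the eight-dimensional product with the frame bundle this gives
structure equations in k = √K, p, q and h, with dk = 2kp η₂, dp = q η₂ and connection form h η₁
(`IsAdaptedFrame`).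

Modulo the Pfaffian forms θ, for c = ±i, (π₁ - ckη₂) ∧ (π₂ + ckη₁) = -(dθ₃ + ck dθ₀). These two
decomposable forms single out two rank-six systems. By linear algebra the systems of any
decomposition coincide with them (`decomposition_eq_singular`), the same way throughout a
neighbourhood.

Let f₀, …, f₇ be the members of `flagCoframe`. The derived flag of the system with c = i is bounded
above by the spans of the first 6, 5 and 3 of them. The final system V^∞ must complement the
opposite system, which forces it to contain elements f₁ + c₀f₀ and f₂ + d₀f₀. That their exterior
derivatives vanish modulo f₀, f₁, f₂ is a polynomial system whose only solutions satisfy ph = k²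
(`eq_of_flag_equations`). With p = RF/(4K) and h = lam/F this reads lam R = 4K².

Under this equation K/lam⁴ and Q + lam²/K have zero differential (`fderiv_invariants`). Let c₀ and
d₀ be their values near a point. The metric is (ν² - μ²)/Q with ν = x₁η₁ - x₂η₂, and ν/Q is closed;
sin²u = Q/d₀ and dv = ν/(Q√(c₀d₀)) bring it to c₀d₀² times the normal form
(`exists_normal_coordinates`).

The factor c₀d₀² is the function `metricScale` of Q, lam² and K, which do not depend on chart or
coframe (`HasInvariantsAt.unique`). It is therefore locally constant on M, and constant by
connectedness. -/

lemma extD_congr {A : Type*} [NormedAddCommGroup A] [NormedSpace ℝ A]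
    {ξ ξ' : E → E →L[ℝ] A} {x : E} (h : ξ =ᶠ[𝓝 x] ξ') : extD ξ x = extD ξ' x := by
  funext u v
  simp only [extD, h.fderiv_eq]

section Algebra

variable {A : Type*} [NormedField A] [NormedAlgebra ℝ A]

lemma extD_fun_smul {f : E → A} {ξ : E → E →L[ℝ] A} {x : E} (hf : DifferentiableAt ℝ f x)
    (hξ : DifferentiableAt ℝ ξ x) (u v : E) :
    extD (fun y => f y • ξ y) x u v
      = fderiv ℝ f x u * ξ x v - fderiv ℝ f x v * ξ x u + f x * extD ξ x u v := by
  have h : fderiv ℝ (fun y => f y • ξ y) x = _ := (hf.hasFDerivAt.smul hξ.hasFDerivAt).fderiv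
  simp only [extD]
  rw [h]
  simp
  ring

lemma extD_fun_add {ξ ξ' : E → E →L[ℝ] A} {x : E} (h : DifferentiableAt ℝ ξ x)
    (h' : DifferentiableAt ℝ ξ' x) (u v : E) :
    extD (fun y => ξ y + ξ' y) x u v = extD ξ x u v + extD ξ' x u v := by
  simp only [extD]
  rw [fderiv_fun_add h h']
  simp
  ring

lemma extD_fun_sub {ξ ξ' : E → E →L[ℝ] A} {x : E} (h : DifferentiableAt ℝ ξ x)
    (h' : DifferentiableAt ℝ ξ' x) (u v : E) :
    extD (fun y => ξ y - ξ' y) x u v = extD ξ x u v - extD ξ' x u v := by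
  simp only [extD]
  rw [fderiv_fun_sub h h']
  simp
  ring

lemma extD_fun_sum {ι : Type*} (s : Finset ι) {ξ : ι → E → E →L[ℝ] A} {x : E}
    (h : ∀ i ∈ s, DifferentiableAt ℝ (ξ i) x) (u v : E) :
    extD (fun y => ∑ i ∈ s, ξ i y) x u v = ∑ i ∈ s, extD (ξ i) x u v := by
  simp only [extD]
  rw [fderiv_fun_sum h]
  simp [Finset.sum_sub_distrib]

end Algebra

/-- A differential is closed. -/
lemma extD_fderiv {A : Type*} [NormedAddCommGroup A] [NormedSpace ℝ A] {f : E → A} {x : E}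
    (hf : ContDiffAt ℝ 2 f x) (u v : E) : extD (fderiv ℝ f) x u v = 0 := by
  have := (hf.isSymmSndFDerivAt (by simp)) u v
  simp [extD, this]

/-- The complex-linear extension of a covector, at the complex tangent vector `Z.1 + i Z.2`. -/
def evC (α : E →L[ℝ] ℂ) (Z : E × E) : ℂ := α Z.1 + Complex.I * α Z.2

/-- The complex-bilinear extension of a two-covector. -/
def evTwo (w : E → E → ℂ) (Z Z' : E × E) : ℂ :=
  w Z.1 Z'.1 - w Z.2 Z'.2 + Complex.I * (w Z.1 Z'.2 + w Z.2 Z'.1)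

lemma evC_add (α β : E →L[ℝ] ℂ) (Z : E × E) : evC (α + β) Z = evC α Z + evC β Z := by
  simp [evC]; ring

lemma evC_sub (α β : E →L[ℝ] ℂ) (Z : E × E) : evC (α - β) Z = evC α Z - evC β Z := by
  simp [evC]; ring

lemma evC_smul (c : ℂ) (α : E →L[ℝ] ℂ) (Z : E × E) : evC (c • α) Z = c * evC α Z := by
  simp [evC]; ring

lemma evC_zero (Z : E × E) : evC (0 : E →L[ℝ] ℂ) Z = 0 := by simp [evC]

lemma evC_sum {ι : Type*} (s : Finset ι) (α : ι → E →L[ℝ] ℂ) (Z : E × E) :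
    evC (∑ i ∈ s, α i) Z = ∑ i ∈ s, evC (α i) Z := by
  simp [evC, Finset.sum_add_distrib, Finset.mul_sum]

lemma evTwo_add (w w' : E → E → ℂ) (Z Z' : E × E) :
    evTwo (w + w') Z Z' = evTwo w Z Z' + evTwo w' Z Z' := by
  simp [evTwo]; ring

lemma evTwo_sub (w w' : E → E → ℂ) (Z Z' : E × E) :
    evTwo (w - w') Z Z' = evTwo w Z Z' - evTwo w' Z Z' := by
  simp [evTwo]; ring

lemma evTwo_neg (w : E → E → ℂ) (Z Z' : E × E) : evTwo (-w) Z Z' = -evTwo w Z Z' := by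
  simp [evTwo]; ring

lemma evTwo_smul (c : ℂ) (w : E → E → ℂ) (Z Z' : E × E) :
    evTwo (c • w) Z Z' = c * evTwo w Z Z' := by
  simp [evTwo]; ring

/-- This identity lets all later computations be done with numbers: a wedge product becomes a 2×2
determinant of values at complex vectors. -/
lemma evTwo_wedge (α β : E →L[ℝ] ℂ) (Z Z' : E × E) :
    evTwo (wedge α β) Z Z' = evC α Z * evC β Z' - evC α Z' * evC β Z := by
  simp only [evTwo, wedge, evC]
  linear_combination (α Z.2 * β Z'.2 - α Z'.2 * β Z.2) * Complex.I_sq.symm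

lemma evC_eq_zero_of_mem_span {S : Set (E →L[ℝ] ℂ)} {α : E →L[ℝ] ℂ} {Z : E × E}
    (hα : α ∈ Submodule.span ℂ S) (hZ : ∀ β ∈ S, evC β Z = 0) : evC α Z = 0 := by
  induction hα using Submodule.span_induction with
  | mem x h => exact hZ x h
  | zero => exact evC_zero Z
  | add x y _ _ hx hy => rw [evC_add, hx, hy, add_zero]
  | smul c x _ hx => rw [evC_smul, hx, mul_zero]

/-- Elements of the algebraic ideal generated by `V` vanish on vectors annihilated by `V`, up to
the additional two-forms. -/
lemma evTwo_eq_zero_of_mem_idealTwo {V : Submodule ℂ (E →L[ℝ] ℂ)} {S : Set (E → E → ℂ)}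
    {w : E → E → ℂ} (hw : w ∈ idealTwo V S) {Z Z' : E × E} (hZ : ∀ α ∈ V, evC α Z = 0)
    (hZ' : ∀ α ∈ V, evC α Z' = 0) (hS : ∀ Ω ∈ S, evTwo Ω Z Z' = 0) : evTwo w Z Z' = 0 := by
  induction hw using Submodule.span_induction with
  | mem x h =>
    rcases h with h | ⟨α, hα, β, rfl⟩
    · exact hS x h
    · rw [evTwo_wedge, hZ α hα, hZ' α hα]; ring
  | zero => simp [evTwo]
  | add x y _ _ hx hy =>
    rw [evTwo_add, hx, hy, add_zero]
  | smul c x _ hx =>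
    rw [evTwo_smul, hx, mul_zero]

/-- Complex tangent vectors with prescribed values on independent covectors. -/
lemma exists_evC_eq {ι : Type*} [Fintype ι] {ζ : ι → E →L[ℝ] ℂ}
    (h : LinearIndependent ℂ ζ) (c : ι → ℂ) : ∃ Z : E × E, ∀ i, evC (ζ i) Z = c i := by
  classical
  let R : Submodule ℂ (ι → ℂ) :=
    { carrier := {c | ∃ Z : E × E, ∀ i, evC (ζ i) Z = c i}
      zero_mem' := ⟨0, fun i => by simp [evC]⟩
      add_mem' := by
        rintro a b ⟨Z, hZ⟩ ⟨Y, hY⟩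
        refine ⟨Z + Y, fun i => ?_⟩
        rw [Pi.add_apply, ← hZ, ← hY]
        simp [evC]; ring
      smul_mem' := by
        rintro r a ⟨Z, hZ⟩
        -- Multiplication by r on E × E, read as the complexification E + iE.
        refine ⟨(r.re • Z.1 - r.im • Z.2, r.im • Z.1 + r.re • Z.2), fun i => ?_⟩
        rw [Pi.smul_apply, ← hZ]
        simp only [evC, map_sub, map_smul, map_add, Complex.real_smul, smul_eq_mul]
        conv_rhs => rw [← Complex.re_add_im r]
        linear_combination (r.im * ζ i Z.2) * Complex.I_sq.symm }
  suffices R = ⊤ by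
    have : c ∈ R := this ▸ Submodule.mem_top
    exact this
  by_contra hR
  -- A proper subspace lies in the kernel of a nonzero functional. Its coefficients, tested on real
  -- vectors, form a linear relation among the ζ i.
  obtain ⟨f, hf, hfR⟩ := Submodule.exists_le_ker_of_lt_top R (lt_top_iff_ne_top.mpr hR)
  refine hf ?_
  have key : ∀ u : E, ∑ i, f (Pi.single i 1) * ζ i u = 0 := by
    intro u
    have h1 : (fun i => ζ i u) ∈ R := ⟨(u, 0), fun i => by simp [evC]⟩
    have h2 := hfR h1
    rw [LinearMap.mem_ker, LinearMap.pi_apply_eq_sum_univ] at h2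
    rw [← h2]
    exact Finset.sum_congr rfl fun i _ => by rw [smul_eq_mul, mul_comm]; congr 2; funext j; simp [Pi.single_apply, eq_comm]
  have h3 := Fintype.linearIndependent_iff.mp h (fun i => f (Pi.single i 1)) (by
    ext u
    simpa using key u)
  refine LinearMap.pi_ext' fun i => LinearMap.ext_ring ?_
  simpa using h3 i

lemma evTwo_extD_fun_smul {f : E → ℂ} {ξ : E → E →L[ℝ] ℂ} {x : E} (hf : DifferentiableAt ℝ f x)
    (hξ : DifferentiableAt ℝ ξ x) (Z Z' : E × E) :
    evTwo (extD (fun y => f y • ξ y) x) Z Z' = evC (fderiv ℝ f x) Z * evC (ξ x) Z'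
      - evC (fderiv ℝ f x) Z' * evC (ξ x) Z + f x * evTwo (extD ξ x) Z Z' := by
  have : extD (fun y => f y • ξ y) x = wedge (fderiv ℝ f x) (ξ x) + f x • extD ξ x := by
    funext u v
    rw [extD_fun_smul hf hξ]
    rfl
  rw [this, evTwo_add, evTwo_wedge, evTwo_smul]

lemma evTwo_extD_fun_add {ξ ξ' : E → E →L[ℝ] ℂ} {x : E} (h : DifferentiableAt ℝ ξ x)
    (h' : DifferentiableAt ℝ ξ' x) (Z Z' : E × E) :
    evTwo (extD (fun y => ξ y + ξ' y) x) Z Z'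
      = evTwo (extD ξ x) Z Z' + evTwo (extD ξ' x) Z Z' := by
  rw [← evTwo_add]
  congr 1
  funext u v
  exact extD_fun_add h h' u v

end FormCalculus

/-! ### Smooth coefficients in a moving coframe, and a pointwise necessary condition for derived
systems -/

section Coefficients

variable {E : Type*} [NormedAddCommGroup E] [NormedSpace ℝ E]

/-- The coefficients of a form in a coframe are as smooth as the form and the coframe. -/
lemma exists_coeff {ι : Type*} [Fintype ι] {Θ : ι → E → E →L[ℝ] ℂ} {ξ : E → E →L[ℝ] ℂ} {x : E}
    {m : WithTop ℕ∞} (hΘ : ∀ i, ContDiffAt ℝ m (Θ i) x) (hξ : ContDiffAt ℝ m ξ x)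
    (hind : LinearIndependent ℂ fun i => Θ i x)
    (hspan : Submodule.span ℂ (Set.range fun i => Θ i x) = ⊤) :
    ∃ f : E → ι → ℂ, ContDiffAt ℝ m f x ∧
      ∀ᶠ y in 𝓝 x, ξ y = ∑ i, f y i • Θ i y ∧ LinearIndependent ℂ fun i => Θ i y := by
  let T : (E →L[ℝ] ℂ) → ι → (ι → ℂ) →L[ℂ] (E →L[ℝ] ℂ) := fun α i =>
    ContinuousLinearMap.smulRightL ℂ (ι → ℂ) (E →L[ℝ] ℂ) (ContinuousLinearMap.proj i) α
  -- P y sends coefficients to the combination of the coframe at y. It is bijective at x, and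
  -- inversion is smooth at an invertible operator, so the coefficients of ξ are P⁻¹ξ.
  let P : E → (ι → ℂ) →L[ℂ] (E →L[ℝ] ℂ) := fun y => ∑ i, T (Θ i y) i
  have hPapp : ∀ y c, P y c = ∑ i, c i • Θ i y := by
    intro y c
    simp [P, T]
  have hTlin : ∀ i, ContDiff ℝ m (fun α => T α i) := fun i => by
    have h : ContDiff ℂ m (ContinuousLinearMap.smulRightL ℂ (ι → ℂ) (E →L[ℝ] ℂ)
      (ContinuousLinearMap.proj i)) := ContinuousLinearMap.contDiff _
    exact h.restrict_scalars ℝ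
  have hP : ContDiffAt ℝ m P x :=
    ContDiffAt.sum fun i _ => (hTlin i).contDiffAt.comp x (hΘ i)
  have hbij : Function.Bijective (P x) := by
    constructor
    · rw [← ContinuousLinearMap.coe_coe, injective_iff_map_eq_zero]
      intro c hc
      funext i
      exact Fintype.linearIndependent_iff.mp hind c ((hPapp x c).symm.trans hc) i
    · intro α
      have : α ∈ Submodule.span ℂ (Set.range fun i => Θ i x) := hspan ▸ Submodule.mem_top
      obtain ⟨c, hc⟩ := (Submodule.mem_span_range_iff_exists_fun ℂ).mp this
      exact ⟨c, (hPapp x c).trans hc⟩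
  let e : (ι → ℂ) ≃L[ℂ] (E →L[ℝ] ℂ) :=
    (LinearEquiv.ofBijective (P x).toLinearMap hbij).toContinuousLinearEquiv
  have he : (e : (ι → ℂ) →L[ℂ] (E →L[ℝ] ℂ)) = P x := by ext; rfl
  have hinv : ContDiffAt ℝ m (fun y => (P y).inverse) x := by
    have h1 := (contDiffAt_map_inverse (n := m) e).restrict_scalars ℝ
    rw [he] at h1
    exact h1.comp x hP
  refine ⟨fun y => (P y).inverse (ξ y), ?_, ?_⟩
  · have hb : ContDiff ℝ m (fun q : ((E →L[ℝ] ℂ) →L[ℂ] (ι → ℂ)) × (E →L[ℝ] ℂ) => q.1 q.2) :=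
      have h : ContDiff ℂ m (fun q : ((E →L[ℝ] ℂ) →L[ℂ] (ι → ℂ)) × (E →L[ℝ] ℂ) => q.1 q.2) :=
        contDiff_fst.clm_apply contDiff_snd
      h.restrict_scalars ℝ
    exact hb.contDiffAt.comp x (hinv.prodMk hξ)
  -- `inverse` is zero at operators that are not invertible, so the expansion is claimed only near
  -- x, where P y remains invertible.
  · have hopen : ∀ᶠ y in 𝓝 x, P y ∈ Set.range ((↑) : ((ι → ℂ) ≃L[ℂ] (E →L[ℝ] ℂ)) → _) := by
      refine hP.continuousAt.eventually ?_
      rw [← he]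
      exact ContinuousLinearEquiv.nhds e
    filter_upwards [hopen] with y hy
    obtain ⟨e', he'⟩ := hy
    constructor
    · rw [← hPapp, ← he']
      simp
    · rw [Fintype.linearIndependent_iff]
      intro c hc i
      rw [← hPapp, ← he'] at hc
      have : c = 0 := e'.injective (by simpa using hc)
      simp [this]

/-- The pointwise condition satisfied by the derived system of a system spanned by part of a
coframe. -/
lemma exists_coeff_of_mem_derivedSystem {ι : Type*} [Fintype ι]
    {Θ : ι → E → E →L[ℝ] ℂ} (S : Set ι) {x : E} {α : E →L[ℝ] ℂ}
    (hΘ : ∀ i, ContDiffAt ℝ ∞ (Θ i) x) (hind : LinearIndependent ℂ fun i => Θ i x)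
    (hspan : Submodule.span ℂ (Set.range fun i => Θ i x) = ⊤)
    (hα : α ∈ derivedSystem (fun y => Submodule.span ℂ ((fun i => Θ i y) '' S)) x) :
    ∃ c : ι → ℂ, (∀ i ∉ S, c i = 0) ∧ α = ∑ i, c i • Θ i x ∧
      ∀ Z Z' : E × E, (∀ i ∈ S, evC (Θ i x) Z = 0) → (∀ i ∈ S, evC (Θ i x) Z' = 0) →
        ∑ i, c i * evTwo (extD (Θ i) x) Z Z' = 0 := by
  classical
  obtain ⟨ξ, hsec, hd, rfl⟩ := hα
  obtain ⟨f, hf, hfx⟩ := exists_coeff hΘ hsec.self_of_nhds.1 hind hspan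
  -- Dual vectors show that the coefficients outside S vanish on a whole neighbourhood, not only at
  -- x; hence their differentials vanish at x too.
  have hS : ∀ᶠ y in 𝓝 x, ∀ i ∉ S, f y i = 0 := by
    filter_upwards [hfx, hsec] with y hy hys i hi
    obtain ⟨Z, hZ⟩ := exists_evC_eq hy.2 (Pi.single i 1)
    have h1 : evC (ξ y) Z = 0 := evC_eq_zero_of_mem_span hys.2 (by
      rintro _ ⟨j, hj, rfl⟩
      have hne : j ≠ i := fun h => hi (h ▸ hj)
      simp [hZ, hne])
    rw [hy.1, evC_sum] at h1
    simpa [evC_smul, hZ, Pi.single_apply] using h1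
  refine ⟨f x, hS.self_of_nhds, hfx.self_of_nhds.1, fun Z Z' hZ hZ' => ?_⟩
  have hAd : ∀ i, DifferentiableAt ℝ (Θ i) x := fun i => (hΘ i).differentiableAt (by simp)
  have hfd : ∀ i, DifferentiableAt ℝ (fun y => f y i) x := fun i =>
    (contDiffAt_pi.mp hf i).differentiableAt (by simp)
  have hfz : ∀ i ∉ S, fderiv ℝ (fun y => f y i) x = 0 := by
    intro i hi
    have : (fun y => f y i) =ᶠ[𝓝 x] fun _ => 0 := hS.mono fun y hy => hy i hi
    rw [this.fderiv_eq]
    simp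
  have hann : ∀ Y : E × E, (∀ i ∈ S, evC (Θ i x) Y = 0) →
      ∀ β ∈ Submodule.span ℂ ((fun i => Θ i x) '' S), evC β Y = 0 := by
    intro Y hY β hβ
    refine evC_eq_zero_of_mem_span hβ ?_
    rintro _ ⟨j, hj, rfl⟩
    exact hY j hj
  have h0 : evTwo (extD ξ x) Z Z' = 0 :=
    evTwo_eq_zero_of_mem_idealTwo hd.self_of_nhds (hann Z hZ) (hann Z' hZ') (by simp)
  have h1 : extD ξ x = ∑ i, (wedge (fderiv ℝ (fun y => f y i) x) (Θ i x)
      + f x i • extD (Θ i) x) := by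
    rw [extD_congr (hfx.mono fun y hy => hy.1)]
    funext u v
    rw [extD_fun_sum (ξ := fun i y => f y i • Θ i y) _ fun i _ => (hfd i).smul (hAd i)]
    simp only [Finset.sum_apply, Pi.add_apply, Pi.smul_apply, smul_eq_mul]
    refine Finset.sum_congr rfl fun i _ => ?_
    rw [extD_fun_smul (hfd i) (hAd i), wedge]
  have hsum : ∀ w : ι → E → E → ℂ, evTwo (∑ i, w i) Z Z' = ∑ i, evTwo (w i) Z Z' := by
    intro w
    simp only [evTwo, Finset.sum_apply, Finset.sum_add_distrib, Finset.sum_sub_distrib, mul_add,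
      Finset.mul_sum]
  rw [h1, hsum] at h0
  rw [← h0]
  refine Finset.sum_congr rfl fun i _ => ?_
  rw [evTwo_add, evTwo_wedge, evTwo_smul]
  -- The terms df_i ∧ Θ_i drop out in both cases: Θ_i kills the two vectors if i lies in S, and df_i
  -- = 0 otherwise.
  by_cases hi : i ∈ S
  · rw [hZ i hi, hZ' i hi]; ring
  · rw [hfz i hi, evC_zero, evC_zero]; ring

/-- Derived systems are monotone. -/
lemma derivedSystem_mono {V W : E → Submodule ℂ (E →L[ℝ] ℂ)} {x : E}
    (h : ∀ᶠ y in 𝓝 x, V y ≤ W y) : derivedSystem V x ≤ derivedSystem W x := by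
  rintro _ ⟨ξ, hs, hd, rfl⟩
  refine ⟨ξ, ?_, ?_, rfl⟩
  · filter_upwards [hs, h] with y h1 h2
    exact ⟨h1.1, h2 h1.2⟩
  · filter_upwards [hd, h] with y h1 h2
    refine Submodule.span_mono ?_ h1
    rintro w (hw | ⟨α, hα, β, rfl⟩)
    · exact absurd hw (by simp)
    · exact Or.inr ⟨α, h2 hα, β, rfl⟩

end Coefficients

end DarbouxEmbedding

end

noncomputable section

namespace DarbouxEmbedding

/-! ## The derived flag of the singular systems -/

section AdaptedFrames

variable {E : Type*} [NormedAddCommGroup E] [NormedSpace ℝ E]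

/-- The structure equations of the isometric embedding system of a metric of curvature `k²` with
a timelike Killing field, in a coframe `η₁`, `η₂` with `η₁` proportional to the Killing covector
field, so that all invariants of the metric are functions of one variable, with differentials
proportional to `η₂`. -/
structure IsAdaptedFrame (N : Set E) (θ : Fin 4 → E → E →L[ℝ] ℂ) (η₁ η₂ π₁ π₂ : E → E →L[ℝ] ℂ)
    (k p q h : E → ℂ) : Prop where
  isOpen : IsOpen N
  smooth_θ : ∀ i, ContDiffOn ℝ ∞ (θ i) N
  smooth_η₁ : ContDiffOn ℝ ∞ η₁ N
  smooth_η₂ : ContDiffOn ℝ ∞ η₂ N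
  smooth_π₁ : ContDiffOn ℝ ∞ π₁ N
  smooth_π₂ : ContDiffOn ℝ ∞ π₂ N
  smooth_k : ContDiffOn ℝ ∞ k N
  smooth_p : ContDiffOn ℝ ∞ p N
  smooth_q : ContDiffOn ℝ ∞ q N
  smooth_h : ContDiffOn ℝ ∞ h N
  k_ne_zero : ∀ y ∈ N, k y ≠ 0
  indep : ∀ y ∈ N, LinearIndependent ℂ
    ![θ 0 y, θ 1 y, θ 2 y, θ 3 y, η₁ y, η₂ y, π₁ y, π₂ y]
  finrank_eq : Module.finrank ℂ (E →L[ℝ] ℂ) = 8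
  extD_θ₀ : ∀ y ∈ N, extD (θ 0) y
    = -wedge (π₁ y) (η₁ y + θ 1 y) - wedge (π₂ y) (η₂ y + θ 2 y)
  extD_θ₁ : ∀ y ∈ N, extD (θ 1) y
    = -wedge (h y • η₁ y) (θ 2 y) - wedge (θ 3 y) (η₂ y + θ 2 y) - wedge (π₁ y) (θ 0 y)
  extD_θ₂ : ∀ y ∈ N, extD (θ 2) y
    = -wedge (h y • η₁ y) (θ 1 y) - wedge (θ 3 y) (η₁ y + θ 1 y) + wedge (π₂ y) (θ 0 y)
  extD_θ₃ : ∀ y ∈ N, extD (θ 3) y = -wedge (π₁ y) (π₂ y) + (k y ^ 2) • wedge (η₁ y) (η₂ y)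
  extD_η₁ : ∀ y ∈ N, extD η₁ y = -(h y • wedge (η₁ y) (η₂ y))
  extD_η₂ : ∀ y ∈ N, extD η₂ y = 0
  extD_π₁ : ∀ y ∈ N, extD π₁ y = -wedge (π₂ y) (h y • η₁ y + θ 3 y)
  extD_π₂ : ∀ y ∈ N, extD π₂ y = -wedge (π₁ y) (h y • η₁ y + θ 3 y)
  fderiv_k : ∀ y ∈ N, fderiv ℝ k y = (2 * k y * p y) • η₂ y
  fderiv_p : ∀ y ∈ N, fderiv ℝ p y = q y • η₂ y

/-- A coframe such that the derived flag of the singular system is contained in the flag of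
systems generated by the first six, five, and three of its members. -/
def flagCoframe (θ : Fin 4 → E → E →L[ℝ] ℂ) (η₁ η₂ π₁ π₂ : E → E →L[ℝ] ℂ)
    (k p q h : E → ℂ) : Fin 8 → E → E →L[ℝ] ℂ :=
  ![fun y => θ 3 y + ((Complex.I * k y) • θ 0 y + p y • θ 1 y),
    fun y => π₁ y + ((-Complex.I * k y) • η₂ y
      + (-Complex.I * ((k y ^ 2 - p y * h y) / (2 * k y))) • θ 2 y),
    fun y => π₂ y + ((Complex.I * k y) • η₁ y + ((Complex.I * (p y / k y)) • θ 3 y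
      + (Complex.I * ((k y ^ 2 + 3 * p y ^ 2 - q y) / (2 * k y))) • θ 1 y)),
    θ 1, θ 2, θ 0,
    fun y => π₁ y + (Complex.I * k y) • η₂ y,
    fun y => π₂ y + (-Complex.I * k y) • η₁ y]

lemma contDiffAt_div_complex {f g : E → ℂ} {x : E} {m : WithTop ℕ∞} (hf : ContDiffAt ℝ m f x)
    (hg : ContDiffAt ℝ m g x) (h0 : g x ≠ 0) : ContDiffAt ℝ m (fun y => f y / g y) x := by
  simp only [div_eq_mul_inv]
  exact hf.mul (hg.inv h0)

namespace IsAdaptedFrame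

variable {N : Set E} {θ : Fin 4 → E → E →L[ℝ] ℂ} {η₁ η₂ π₁ π₂ : E → E →L[ℝ] ℂ}
  {k p q h : E → ℂ} {y : E}

lemma contDiffAt_of_contDiffOn {A : Type*} [NormedAddCommGroup A] [NormedSpace ℝ A]
    (F : IsAdaptedFrame N θ η₁ η₂ π₁ π₂ k p q h) (hy : y ∈ N) {f : E → A}
    (hf : ContDiffOn ℝ ∞ f N) : ContDiffAt ℝ ∞ f y :=
  hf.contDiffAt (F.isOpen.mem_nhds hy)

lemma differentiableAt_of_contDiffOn {A : Type*} [NormedAddCommGroup A] [NormedSpace ℝ A]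
    (F : IsAdaptedFrame N θ η₁ η₂ π₁ π₂ k p q h) (hy : y ∈ N) {f : E → A}
    (hf : ContDiffOn ℝ ∞ f N) : DifferentiableAt ℝ f y :=
  (F.contDiffAt_of_contDiffOn hy hf).differentiableAt (by simp)

lemma contDiffAt_flagCoframe (F : IsAdaptedFrame N θ η₁ η₂ π₁ π₂ k p q h) (hy : y ∈ N)
    (i : Fin 8) : ContDiffAt ℝ ∞ (flagCoframe θ η₁ η₂ π₁ π₂ k p q h i) y := by
  have hθ := fun i => F.contDiffAt_of_contDiffOn hy (F.smooth_θ i)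
  have h1 := F.contDiffAt_of_contDiffOn hy F.smooth_η₁
  have h2 := F.contDiffAt_of_contDiffOn hy F.smooth_η₂
  have h3 := F.contDiffAt_of_contDiffOn hy F.smooth_π₁
  have h4 := F.contDiffAt_of_contDiffOn hy F.smooth_π₂
  have hk := F.contDiffAt_of_contDiffOn hy F.smooth_k
  have hp := F.contDiffAt_of_contDiffOn hy F.smooth_p
  have hq := F.contDiffAt_of_contDiffOn hy F.smooth_q
  have hh := F.contDiffAt_of_contDiffOn hy F.smooth_h
  have hk0 := F.k_ne_zero y hy
  have hk2 : (2 : ℂ) * k y ≠ 0 := mul_ne_zero two_ne_zero hk0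
  have e1 := (contDiffAt_const (𝕜 := ℝ) (n := ∞) (x := y) (c := Complex.I)).mul hk
  have e2 := (contDiffAt_const (𝕜 := ℝ) (n := ∞) (x := y) (c := -Complex.I)).mul hk
  have e3 := (contDiffAt_const (𝕜 := ℝ) (n := ∞) (x := y) (c := -Complex.I)).mul
    (contDiffAt_div_complex ((hk.pow 2).sub (hp.mul hh)) (contDiffAt_const.mul hk) hk2)
  have e4 := (contDiffAt_const (𝕜 := ℝ) (n := ∞) (x := y) (c := Complex.I)).mul (contDiffAt_div_complex hp hk hk0)
  have e5 := (contDiffAt_const (𝕜 := ℝ) (n := ∞) (x := y) (c := Complex.I)).mul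
    (contDiffAt_div_complex (((hk.pow 2).add ((contDiffAt_const (c := (3 : ℂ))).mul (hp.pow 2))).sub hq)
      (contDiffAt_const.mul hk) hk2)
  fin_cases i
  · exact (hθ 3).add ((e1.smul (hθ 0)).add (hp.smul (hθ 1)))
  · exact h3.add ((e2.smul h2).add (e3.smul (hθ 2)))
  · exact h4.add ((e1.smul h1).add ((e4.smul (hθ 3)).add (e5.smul (hθ 1))))
  · exact hθ 1
  · exact hθ 2
  · exact hθ 0
  · exact h3.add (e1.smul h2)
  · exact h4.add (e2.smul h1)

/-- The complex tangent vectors with prescribed values on the flag coframe. -/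
lemma exists_evC_flagCoframe (F : IsAdaptedFrame N θ η₁ η₂ π₁ π₂ k p q h) (hy : y ∈ N)
    (g : Fin 8 → ℂ) : ∃ Z : E × E,
      (∀ i, evC (flagCoframe θ η₁ η₂ π₁ π₂ k p q h i y) Z = g i) ∧
      evC (θ 0 y) Z = g 5 ∧ evC (θ 1 y) Z = g 3 ∧ evC (θ 2 y) Z = g 4 ∧
      evC (θ 3 y) Z = g 0 - Complex.I * k y * g 5 - p y * g 3 ∧
      evC (η₁ y) Z = -Complex.I / (2 * k y) * (g 2 - Complex.I * (p y / k y) *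
        (g 0 - Complex.I * k y * g 5 - p y * g 3)
        - Complex.I * ((k y ^ 2 + 3 * p y ^ 2 - q y) / (2 * k y)) * g 3 - g 7) ∧
      evC (η₂ y) Z = -Complex.I / (2 * k y) * (g 6 - (g 1
        + Complex.I * ((k y ^ 2 - p y * h y) / (2 * k y)) * g 4)) ∧
      evC (π₁ y) Z = (g 6 + (g 1 + Complex.I * ((k y ^ 2 - p y * h y) / (2 * k y)) * g 4)) / 2 ∧
      evC (π₂ y) Z = (g 7 + (g 2 - Complex.I * (p y / k y) *
        (g 0 - Complex.I * k y * g 5 - p y * g 3)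
        - Complex.I * ((k y ^ 2 + 3 * p y ^ 2 - q y) / (2 * k y)) * g 3)) / 2 := by
  obtain ⟨Z, hZ⟩ := exists_evC_eq (F.indep y hy) ![g 5, g 3, g 4,
    g 0 - Complex.I * k y * g 5 - p y * g 3,
    -Complex.I / (2 * k y) * (g 2 - Complex.I * (p y / k y) *
        (g 0 - Complex.I * k y * g 5 - p y * g 3)
        - Complex.I * ((k y ^ 2 + 3 * p y ^ 2 - q y) / (2 * k y)) * g 3 - g 7),
    -Complex.I / (2 * k y) * (g 6 - (g 1
        + Complex.I * ((k y ^ 2 - p y * h y) / (2 * k y)) * g 4)),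
    (g 6 + (g 1 + Complex.I * ((k y ^ 2 - p y * h y) / (2 * k y)) * g 4)) / 2,
    (g 7 + (g 2 - Complex.I * (p y / k y) *
        (g 0 - Complex.I * k y * g 5 - p y * g 3)
        - Complex.I * ((k y ^ 2 + 3 * p y ^ 2 - q y) / (2 * k y)) * g 3)) / 2]
  have h0 := hZ 0
  have h1 := hZ 1
  have h2 := hZ 2
  have h3 := hZ 3
  have h4 := hZ 4
  have h5 := hZ 5
  have h6 := hZ 6
  have h7 := hZ 7
  simp only [Matrix.cons_val] at h0 h1 h2 h3 h4 h5 h6 h7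
  -- The pairs π₁ ± ikη₂ and π₂ ± ikη₁ are inverted by half sums and half differences; this identity
  -- undoes the factor ik.
  have hI : ∀ w : ℂ, Complex.I * k y * (-Complex.I / (2 * k y) * w) = w / 2 := by
    intro w
    have hk := F.k_ne_zero y hy
    field_simp
    linear_combination -w * Complex.I_sq
  refine ⟨Z, fun i => ?_, h0, h1, h2, h3, h4, h5, h6, h7⟩
  fin_cases i
  · change evC (θ 3 y + ((Complex.I * k y) • θ 0 y + p y • θ 1 y)) Z = g 0
    rw [evC_add, evC_add, evC_smul, evC_smul, h0, h1, h3]; ring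
  · change evC (π₁ y + ((-Complex.I * k y) • η₂ y
      + (-Complex.I * ((k y ^ 2 - p y * h y) / (2 * k y))) • θ 2 y)) Z = g 1
    rw [evC_add, evC_add, evC_smul, evC_smul, h6, h5, h2, neg_mul, neg_mul, neg_mul, hI]; ring
  · change evC (π₂ y + ((Complex.I * k y) • η₁ y + ((Complex.I * (p y / k y)) • θ 3 y
      + (Complex.I * ((k y ^ 2 + 3 * p y ^ 2 - q y) / (2 * k y))) • θ 1 y))) Z = g 2
    rw [evC_add, evC_add, evC_add, evC_smul, evC_smul, evC_smul, h7, h4, h3, h1, hI]; ring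
  · exact h1
  · exact h2
  · exact h0
  · change evC (π₁ y + (Complex.I * k y) • η₂ y) Z = g 6
    rw [evC_add, evC_smul, h6, h5, hI]; ring
  · change evC (π₂ y + (-Complex.I * k y) • η₁ y) Z = g 7
    rw [evC_add, evC_smul, h7, h4, neg_mul, neg_mul, hI]; ring

lemma linearIndependent_flagCoframe (F : IsAdaptedFrame N θ η₁ η₂ π₁ π₂ k p q h) (hy : y ∈ N) :
    LinearIndependent ℂ fun i => flagCoframe θ η₁ η₂ π₁ π₂ k p q h i y := by
  rw [Fintype.linearIndependent_iff]
  intro c hc i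
  obtain ⟨Z, hZ, -⟩ := F.exists_evC_flagCoframe hy (Pi.single i 1)
  have := congrArg (fun α => evC α Z) hc
  simpa [evC_sum, evC_smul, hZ, Pi.single_apply, evC_zero] using this

lemma span_flagCoframe (F : IsAdaptedFrame N θ η₁ η₂ π₁ π₂ k p q h) (hy : y ∈ N) :
    Submodule.span ℂ (Set.range fun i => flagCoframe θ η₁ η₂ π₁ π₂ k p q h i y) = ⊤ :=
  (F.linearIndependent_flagCoframe hy).span_eq_top_of_card_eq_finrank (by simp [F.finrank_eq])

/-- The coefficients ik and p have differentials 2ikp η₂ and q η₂, so everything is explicit. -/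
lemma evTwo_extD_flagCoframe_zero (F : IsAdaptedFrame N θ η₁ η₂ π₁ π₂ k p q h) (hy : y ∈ N)
    (Z Z' : E × E) : evTwo (extD (flagCoframe θ η₁ η₂ π₁ π₂ k p q h 0) y) Z Z'
      = evTwo (extD (θ 3) y) Z Z'
        + (2 * Complex.I * k y * p y * (evC (η₂ y) Z * evC (θ 0 y) Z'
            - evC (η₂ y) Z' * evC (θ 0 y) Z)
          + Complex.I * k y * evTwo (extD (θ 0) y) Z Z'
        + (q y * (evC (η₂ y) Z * evC (θ 1 y) Z' - evC (η₂ y) Z' * evC (θ 1 y) Z)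
          + p y * evTwo (extD (θ 1) y) Z Z')) := by
  have hθ := fun i => F.differentiableAt_of_contDiffOn hy (F.smooth_θ i)
  have sk := (F.contDiffAt_of_contDiffOn hy F.smooth_k).of_le (m := 1) (by simp)
  have hk := sk.differentiableAt one_ne_zero
  have sp := (F.contDiffAt_of_contDiffOn hy F.smooth_p).of_le (m := 1) (by simp)
  have hp := sp.differentiableAt one_ne_zero
  change evTwo (extD (fun y => θ 3 y + ((Complex.I * k y) • θ 0 y + p y • θ 1 y)) y) Z Z' = _
  have hIk : DifferentiableAt ℝ (fun y => Complex.I * k y) y := hk.const_mul _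
  rw [evTwo_extD_fun_add (hθ 3) ((hIk.fun_smul (hθ 0)).fun_add (hp.fun_smul (hθ 1))),
    evTwo_extD_fun_add (hIk.fun_smul (hθ 0)) (hp.fun_smul (hθ 1)),
    evTwo_extD_fun_smul hIk (hθ 0), evTwo_extD_fun_smul hp (hθ 1),
    fderiv_const_mul hk, F.fderiv_k y hy, F.fderiv_p y hy]
  simp only [evC_smul]
  ring

/-- The differential of the coefficient of θ₂ would involve dh, which the structure equations do not
provide. It may stay an unspecified α, because this derivative is evaluated below only on pairs of
vectors on which θ₂ vanishes. -/
lemma evTwo_extD_flagCoframe_one (F : IsAdaptedFrame N θ η₁ η₂ π₁ π₂ k p q h) (hy : y ∈ N) :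
    ∃ α : E →L[ℝ] ℂ, ∀ Z Z' : E × E,
      evTwo (extD (flagCoframe θ η₁ η₂ π₁ π₂ k p q h 1) y) Z Z'
        = evTwo (extD π₁ y) Z Z' - Complex.I * k y * evTwo (extD η₂ y) Z Z'
          + (evC α Z * evC (θ 2 y) Z' - evC α Z' * evC (θ 2 y) Z)
          - Complex.I * ((k y ^ 2 - p y * h y) / (2 * k y)) * evTwo (extD (θ 2) y) Z Z' := by
  have hθ := fun i => F.differentiableAt_of_contDiffOn hy (F.smooth_θ i)
  have h2 := F.differentiableAt_of_contDiffOn hy F.smooth_η₂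
  have h3 := F.differentiableAt_of_contDiffOn hy F.smooth_π₁
  have sk := (F.contDiffAt_of_contDiffOn hy F.smooth_k).of_le (m := 1) (by simp)
  have hk := sk.differentiableAt one_ne_zero
  have sp := (F.contDiffAt_of_contDiffOn hy F.smooth_p).of_le (m := 1) (by simp)
  have hp := sp.differentiableAt one_ne_zero
  have sh := (F.contDiffAt_of_contDiffOn hy F.smooth_h).of_le (m := 1) (by simp)
  have hh := sh.differentiableAt one_ne_zero
  have hk0 := F.k_ne_zero y hy
  have hk2 : (2 : ℂ) * k y ≠ 0 := mul_ne_zero two_ne_zero hk0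
  have hIk : DifferentiableAt ℝ (fun y => -Complex.I * k y) y := hk.const_mul _
  have hb : DifferentiableAt ℝ
      (fun y => -Complex.I * ((k y ^ 2 - p y * h y) / (2 * k y))) y :=
    (contDiffAt_const.mul (contDiffAt_div_complex ((sk.pow 2).sub (sp.mul sh))
      (contDiffAt_const.mul sk) hk2)).differentiableAt one_ne_zero
  refine ⟨fderiv ℝ (fun y => -Complex.I * ((k y ^ 2 - p y * h y) / (2 * k y))) y,
    fun Z Z' => ?_⟩
  change evTwo (extD (fun y => π₁ y + ((-Complex.I * k y) • η₂ y
      + (-Complex.I * ((k y ^ 2 - p y * h y) / (2 * k y))) • θ 2 y)) y) Z Z' = _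
  rw [evTwo_extD_fun_add h3 ((hIk.fun_smul h2).fun_add (hb.fun_smul (hθ 2))),
    evTwo_extD_fun_add (hIk.fun_smul h2) (hb.fun_smul (hθ 2)),
    evTwo_extD_fun_smul hIk h2, evTwo_extD_fun_smul hb (hθ 2), fderiv_const_mul hk,
    F.fderiv_k y hy]
  simp only [evC_smul]
  ring

/-- The coefficient of θ₁ would bring in dq and may stay implicit, since θ₁ vanishes on all pairs on
which this derivative is used. The coefficient of θ₃ needs its true differential: θ₃ takes the value
-ik on the vector dual to f₅ = θ₀. -/
lemma evTwo_extD_flagCoframe_two (F : IsAdaptedFrame N θ η₁ η₂ π₁ π₂ k p q h) (hy : y ∈ N) :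
    ∃ α : E →L[ℝ] ℂ, ∀ Z Z' : E × E,
      evTwo (extD (flagCoframe θ η₁ η₂ π₁ π₂ k p q h 2) y) Z Z'
        = evTwo (extD π₂ y) Z Z' + (2 * Complex.I * k y * p y * (evC (η₂ y) Z * evC (η₁ y) Z'
            - evC (η₂ y) Z' * evC (η₁ y) Z) + Complex.I * k y * evTwo (extD η₁ y) Z Z')
          + (Complex.I * (q y / k y - 2 * p y ^ 2 / k y) * (evC (η₂ y) Z * evC (θ 3 y) Z'
            - evC (η₂ y) Z' * evC (θ 3 y) Z)
          + Complex.I * (p y / k y) * evTwo (extD (θ 3) y) Z Z')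
          + (evC α Z * evC (θ 1 y) Z' - evC α Z' * evC (θ 1 y) Z)
          + Complex.I * ((k y ^ 2 + 3 * p y ^ 2 - q y) / (2 * k y))
            * evTwo (extD (θ 1) y) Z Z' := by
  have hθ := fun i => F.differentiableAt_of_contDiffOn hy (F.smooth_θ i)
  have h1 := F.differentiableAt_of_contDiffOn hy F.smooth_η₁
  have h4 := F.differentiableAt_of_contDiffOn hy F.smooth_π₂
  have sk := (F.contDiffAt_of_contDiffOn hy F.smooth_k).of_le (m := 1) (by simp)
  have hk := sk.differentiableAt one_ne_zero
  have sp := (F.contDiffAt_of_contDiffOn hy F.smooth_p).of_le (m := 1) (by simp)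
  have hp := sp.differentiableAt one_ne_zero
  have sq := (F.contDiffAt_of_contDiffOn hy F.smooth_q).of_le (m := 1) (by simp)
  have hq := sq.differentiableAt one_ne_zero
  have hk0 := F.k_ne_zero y hy
  have hk2 : (2 : ℂ) * k y ≠ 0 := mul_ne_zero two_ne_zero hk0
  have hIk : DifferentiableAt ℝ (fun y => Complex.I * k y) y := hk.const_mul _
  have hr : DifferentiableAt ℝ (fun y => p y / k y) y :=
    (contDiffAt_div_complex sp sk hk0).differentiableAt one_ne_zero
  have hs : DifferentiableAt ℝ (fun y => Complex.I * (p y / k y)) y := hr.const_mul _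
  have hs' : fderiv ℝ (fun y => Complex.I * (p y / k y)) y
      = (Complex.I * (q y / k y - 2 * p y ^ 2 / k y)) • η₂ y := by
    -- The differential of p/k is obtained by differentiating p = (p/k)·k and cancelling k.
    have e1 : p =ᶠ[𝓝 y] fun y => p y / k y * k y := by
      filter_upwards [F.isOpen.mem_nhds hy] with z hz
      rw [div_mul_cancel₀ _ (F.k_ne_zero z hz)]
    have e2 := e1.fderiv_eq.symm.trans (F.fderiv_p y hy)
    rw [fderiv_fun_mul hr hk, F.fderiv_k y hy] at e2
    rw [fderiv_const_mul hr]
    ext u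
    have e3 := congrArg (fun α : E →L[ℝ] ℂ => α u) e2
    simp only [add_apply, smul_apply, smul_eq_mul] at e3 ⊢
    rw [mul_assoc]
    congr 1
    have e4 : k y * fderiv ℝ (fun y => p y / k y) y u
        = k y * ((q y / k y - 2 * p y ^ 2 / k y) * η₂ y u) := by
      field_simp at e3 ⊢
      linear_combination e3
    exact mul_left_cancel₀ hk0 e4
  have ha : DifferentiableAt ℝ
      (fun y => Complex.I * ((k y ^ 2 + 3 * p y ^ 2 - q y) / (2 * k y))) y :=
    (contDiffAt_const.mul (contDiffAt_div_complex
      (((sk.pow 2).add (contDiffAt_const.mul (sp.pow 2))).sub sq)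
      (contDiffAt_const.mul sk) hk2)).differentiableAt one_ne_zero
  refine ⟨fderiv ℝ (fun y => Complex.I * ((k y ^ 2 + 3 * p y ^ 2 - q y) / (2 * k y))) y,
    fun Z Z' => ?_⟩
  change evTwo (extD (fun y => π₂ y + ((Complex.I * k y) • η₁ y
      + ((Complex.I * (p y / k y)) • θ 3 y
      + (Complex.I * ((k y ^ 2 + 3 * p y ^ 2 - q y) / (2 * k y))) • θ 1 y))) y) Z Z' = _
  have d1 := hIk.fun_smul h1
  have d2 := hs.fun_smul (hθ 3)
  have d3 := ha.fun_smul (hθ 1)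
  rw [evTwo_extD_fun_add h4 (d1.fun_add (d2.fun_add d3)), evTwo_extD_fun_add d1 (d2.fun_add d3),
    evTwo_extD_fun_add d2 d3, evTwo_extD_fun_smul hIk h1,
    evTwo_extD_fun_smul hs (hθ 3), evTwo_extD_fun_smul ha (hθ 1),
    fderiv_const_mul hk, F.fderiv_k y hy, hs']
  simp only [evC_smul]
  ring

end IsAdaptedFrame

end AdaptedFrames

end DarbouxEmbedding

end


noncomputable section

namespace DarbouxEmbedding

/-! ### Exterior derivatives of the flag coframe on pairs of dual vectors -/

section AdaptedFrames

variable {E : Type*} [NormedAddCommGroup E] [NormedSpace ℝ E]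

namespace IsAdaptedFrame

variable {N : Set E} {θ : Fin 4 → E → E →L[ℝ] ℂ} {η₁ η₂ π₁ π₂ : E → E →L[ℝ] ℂ}
  {k p q h : E → ℂ} {y : E}

/-- The exterior derivatives of the members of the flag coframe, on a pair of complex tangent
vectors which are given by their values on the flag coframe. -/
lemma evTwo_extD_values (F : IsAdaptedFrame N θ η₁ η₂ π₁ π₂ k p q h) (hy : y ∈ N)
    (Z Z' : E × E) :
    evTwo (extD (θ 0) y) Z Z' =
      -(evC (π₁ y) Z * (evC (η₁ y) Z' + evC (θ 1 y) Z')
        - evC (π₁ y) Z' * (evC (η₁ y) Z + evC (θ 1 y) Z))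
      - (evC (π₂ y) Z * (evC (η₂ y) Z' + evC (θ 2 y) Z')
        - evC (π₂ y) Z' * (evC (η₂ y) Z + evC (θ 2 y) Z)) ∧
    evTwo (extD (θ 1) y) Z Z' =
      -(h y * (evC (η₁ y) Z * evC (θ 2 y) Z' - evC (η₁ y) Z' * evC (θ 2 y) Z))
      - (evC (θ 3 y) Z * (evC (η₂ y) Z' + evC (θ 2 y) Z')
        - evC (θ 3 y) Z' * (evC (η₂ y) Z + evC (θ 2 y) Z))
      - (evC (π₁ y) Z * evC (θ 0 y) Z' - evC (π₁ y) Z' * evC (θ 0 y) Z) ∧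
    evTwo (extD (θ 2) y) Z Z' =
      -(h y * (evC (η₁ y) Z * evC (θ 1 y) Z' - evC (η₁ y) Z' * evC (θ 1 y) Z))
      - (evC (θ 3 y) Z * (evC (η₁ y) Z' + evC (θ 1 y) Z')
        - evC (θ 3 y) Z' * (evC (η₁ y) Z + evC (θ 1 y) Z))
      + (evC (π₂ y) Z * evC (θ 0 y) Z' - evC (π₂ y) Z' * evC (θ 0 y) Z) ∧
    evTwo (extD (θ 3) y) Z Z' =
      -(evC (π₁ y) Z * evC (π₂ y) Z' - evC (π₁ y) Z' * evC (π₂ y) Z)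
      + k y ^ 2 * (evC (η₁ y) Z * evC (η₂ y) Z' - evC (η₁ y) Z' * evC (η₂ y) Z) ∧
    evTwo (extD η₁ y) Z Z' =
      -(h y * (evC (η₁ y) Z * evC (η₂ y) Z' - evC (η₁ y) Z' * evC (η₂ y) Z)) ∧
    evTwo (extD η₂ y) Z Z' = 0 ∧
    evTwo (extD π₁ y) Z Z' =
      -(evC (π₂ y) Z * (h y * evC (η₁ y) Z' + evC (θ 3 y) Z')
        - evC (π₂ y) Z' * (h y * evC (η₁ y) Z + evC (θ 3 y) Z)) ∧
    evTwo (extD π₂ y) Z Z' =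
      -(evC (π₁ y) Z * (h y * evC (η₁ y) Z' + evC (θ 3 y) Z')
        - evC (π₁ y) Z' * (h y * evC (η₁ y) Z + evC (θ 3 y) Z)) := by
  rw [F.extD_θ₀ y hy, F.extD_θ₁ y hy, F.extD_θ₂ y hy, F.extD_θ₃ y hy, F.extD_η₁ y hy,
    F.extD_η₂ y hy, F.extD_π₁ y hy, F.extD_π₂ y hy]
  simp only [evTwo_sub, evTwo_add, evTwo_neg, evTwo_smul, evTwo_wedge, evC_add, evC_smul]
  refine ⟨trivial, by ring, by ring, trivial, trivial, by simp [evTwo], trivial, trivial⟩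

/-- Vanishing and non-vanishing coefficients for the first derived system. -/
lemma flag_values_six_seven (F : IsAdaptedFrame N θ η₁ η₂ π₁ π₂ k p q h) (hy : y ∈ N) :
    ∃ Z Z' : E × E, (∀ i, evC (flagCoframe θ η₁ η₂ π₁ π₂ k p q h i y) Z
        = (Pi.single 6 1 : Fin 8 → ℂ) i) ∧
      (∀ i, evC (flagCoframe θ η₁ η₂ π₁ π₂ k p q h i y) Z' = (Pi.single 7 1 : Fin 8 → ℂ) i) ∧
      evTwo (extD (flagCoframe θ η₁ η₂ π₁ π₂ k p q h 0) y) Z Z' = 0 ∧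
      evTwo (extD (flagCoframe θ η₁ η₂ π₁ π₂ k p q h 1) y) Z Z' = 0 ∧
      evTwo (extD (flagCoframe θ η₁ η₂ π₁ π₂ k p q h 2) y) Z Z' = 0 ∧
      evTwo (extD (flagCoframe θ η₁ η₂ π₁ π₂ k p q h 3) y) Z Z' = 0 ∧
      evTwo (extD (flagCoframe θ η₁ η₂ π₁ π₂ k p q h 4) y) Z Z' = 0 ∧
      evTwo (extD (flagCoframe θ η₁ η₂ π₁ π₂ k p q h 5) y) Z Z' = -Complex.I / (2 * k y) := by
  -- The vectors dual to f₆ and f₇ span the common kernel of f₀, …, f₅, so the derivative of a form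
  -- in the first derived system must vanish on this pair.
  obtain ⟨Z, hZ, a0, a1, a2, a3, a4, a5, a6, a7⟩ := F.exists_evC_flagCoframe hy (Pi.single 6 1)
  obtain ⟨Y, hY, b0, b1, b2, b3, b4, b5, b6, b7⟩ := F.exists_evC_flagCoframe hy (Pi.single 7 1)
  simp [-one_div] at a0 a1 a2 a3 a4 a5 a6 a7 b0 b1 b2 b3 b4 b5 b6 b7
  have hk := F.k_ne_zero y hy
  have hI := Complex.I_sq
  -- The powers of i that may remain after denominators are cleared are reduced by these identities.
  have hI5 : Complex.I ^ 5 = Complex.I := by linear_combination Complex.I * Complex.I_pow_four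
  have hI6 : Complex.I ^ 6 = -1 := by linear_combination hI + Complex.I ^ 2 * Complex.I_pow_four
  obtain ⟨α, hα⟩ := F.evTwo_extD_flagCoframe_one hy
  obtain ⟨β, hβ⟩ := F.evTwo_extD_flagCoframe_two hy
  obtain ⟨d0, d1, d2, d3, d4, d5, d6, d7⟩ := F.evTwo_extD_values hy Z Y
  refine ⟨Z, Y, hZ, hY, ?_, ?_, ?_, ?_, ?_, ?_⟩
  · rw [F.evTwo_extD_flagCoframe_zero hy]
    simp only [d0, d1, d2, d3, d4, d5, d6, d7]
    simp only [a0, a1, a2, a3, a4, a5, a6, a7, b0, b1, b2, b3, b4, b5, b6, b7]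
    field_simp
    try ring_nf
    try simp only [hI, Complex.I_pow_three, Complex.I_pow_four, hI5, hI6]
    try ring
  · rw [hα]
    simp only [d0, d1, d2, d3, d4, d5, d6, d7]
    simp only [a0, a1, a2, a3, a4, a5, a6, a7, b0, b1, b2, b3, b4, b5, b6, b7]
    field_simp
    try ring_nf
    try simp only [hI, Complex.I_pow_three, Complex.I_pow_four, hI5, hI6]
    try ring
  · rw [hβ]
    simp only [d0, d1, d2, d3, d4, d5, d6, d7]
    simp only [a0, a1, a2, a3, a4, a5, a6, a7, b0, b1, b2, b3, b4, b5, b6, b7]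
    field_simp
    try ring_nf
    try simp only [hI, Complex.I_pow_three, Complex.I_pow_four, hI5, hI6]
    try ring
  · change evTwo (extD (θ 1) y) Z Y = _
    simp only [d0, d1, d2, d3, d4, d5, d6, d7]
    simp only [a0, a1, a2, a3, a4, a5, a6, a7, b0, b1, b2, b3, b4, b5, b6, b7]
    field_simp
    try ring_nf
    try simp only [hI, Complex.I_pow_three, Complex.I_pow_four, hI5, hI6]
    try ring
  · change evTwo (extD (θ 2) y) Z Y = _
    simp only [d0, d1, d2, d3, d4, d5, d6, d7]
    simp only [a0, a1, a2, a3, a4, a5, a6, a7, b0, b1, b2, b3, b4, b5, b6, b7]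
    field_simp
    try ring_nf
    try simp only [hI, Complex.I_pow_three, Complex.I_pow_four, hI5, hI6]
    try ring
  · change evTwo (extD (θ 0) y) Z Y = _
    simp only [d0, d1, d2, d3, d4, d5, d6, d7]
    simp only [a0, a1, a2, a3, a4, a5, a6, a7, b0, b1, b2, b3, b4, b5, b6, b7]
    field_simp
    try ring_nf
    try simp only [hI, Complex.I_pow_three, Complex.I_pow_four, hI5, hI6]
    try ring

/-- Coefficients for the second derived system. -/
lemma flag_values_five_six (F : IsAdaptedFrame N θ η₁ η₂ π₁ π₂ k p q h) (hy : y ∈ N) :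
    ∃ Z Z' : E × E, (∀ i, evC (flagCoframe θ η₁ η₂ π₁ π₂ k p q h i y) Z
        = (Pi.single 5 1 : Fin 8 → ℂ) i) ∧
      (∀ i, evC (flagCoframe θ η₁ η₂ π₁ π₂ k p q h i y) Z' = (Pi.single 6 1 : Fin 8 → ℂ) i) ∧
      evTwo (extD (flagCoframe θ η₁ η₂ π₁ π₂ k p q h 0) y) Z Z' = 0 ∧
      evTwo (extD (flagCoframe θ η₁ η₂ π₁ π₂ k p q h 1) y) Z Z' = 0 ∧
      evTwo (extD (flagCoframe θ η₁ η₂ π₁ π₂ k p q h 2) y) Z Z' = 0 ∧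
      evTwo (extD (flagCoframe θ η₁ η₂ π₁ π₂ k p q h 3) y) Z Z' = 1 ∧
      evTwo (extD (flagCoframe θ η₁ η₂ π₁ π₂ k p q h 4) y) Z Z' = 0 := by
  obtain ⟨Z, hZ, a0, a1, a2, a3, a4, a5, a6, a7⟩ := F.exists_evC_flagCoframe hy (Pi.single 5 1)
  obtain ⟨Y, hY, b0, b1, b2, b3, b4, b5, b6, b7⟩ := F.exists_evC_flagCoframe hy (Pi.single 6 1)
  simp [-one_div] at a0 a1 a2 a3 a4 a5 a6 a7 b0 b1 b2 b3 b4 b5 b6 b7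
  have hk := F.k_ne_zero y hy
  have hI := Complex.I_sq
  have hI5 : Complex.I ^ 5 = Complex.I := by linear_combination Complex.I * Complex.I_pow_four
  have hI6 : Complex.I ^ 6 = -1 := by linear_combination hI + Complex.I ^ 2 * Complex.I_pow_four
  obtain ⟨α, hα⟩ := F.evTwo_extD_flagCoframe_one hy
  obtain ⟨β, hβ⟩ := F.evTwo_extD_flagCoframe_two hy
  obtain ⟨d0, d1, d2, d3, d4, d5, d6, d7⟩ := F.evTwo_extD_values hy Z Y
  refine ⟨Z, Y, hZ, hY, ?_, ?_, ?_, ?_, ?_⟩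
  · rw [F.evTwo_extD_flagCoframe_zero hy]
    simp only [d0, d1, d2, d3, d4, d5, d6, d7]
    simp only [a0, a1, a2, a3, a4, a5, a6, a7, b0, b1, b2, b3, b4, b5, b6, b7]
    field_simp
    try ring_nf
    try simp only [hI, Complex.I_pow_three, Complex.I_pow_four, hI5, hI6]
    try ring
  · rw [hα]
    simp only [d0, d1, d2, d3, d4, d5, d6, d7]
    simp only [a0, a1, a2, a3, a4, a5, a6, a7, b0, b1, b2, b3, b4, b5, b6, b7]
    field_simp
    try ring_nf
    try simp only [hI, Complex.I_pow_three, Complex.I_pow_four, hI5, hI6]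
    try ring
  · rw [hβ]
    simp only [d0, d1, d2, d3, d4, d5, d6, d7]
    simp only [a0, a1, a2, a3, a4, a5, a6, a7, b0, b1, b2, b3, b4, b5, b6, b7]
    field_simp
    try ring_nf
    try simp only [hI, Complex.I_pow_three, Complex.I_pow_four, hI5, hI6]
    try ring
  · change evTwo (extD (θ 1) y) Z Y = _
    simp only [d0, d1, d2, d3, d4, d5, d6, d7]
    simp only [a0, a1, a2, a3, a4, a5, a6, a7, b0, b1, b2, b3, b4, b5, b6, b7]
    field_simp
    try ring_nf
    try simp only [hI, Complex.I_pow_three, Complex.I_pow_four, hI5, hI6]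
    try ring
  · change evTwo (extD (θ 2) y) Z Y = _
    simp only [d0, d1, d2, d3, d4, d5, d6, d7]
    simp only [a0, a1, a2, a3, a4, a5, a6, a7, b0, b1, b2, b3, b4, b5, b6, b7]
    field_simp
    try ring_nf
    try simp only [hI, Complex.I_pow_three, Complex.I_pow_four, hI5, hI6]
    try ring

/-- Coefficients for the second derived system. -/
lemma flag_values_five_seven (F : IsAdaptedFrame N θ η₁ η₂ π₁ π₂ k p q h) (hy : y ∈ N) :
    ∃ Z Z' : E × E, (∀ i, evC (flagCoframe θ η₁ η₂ π₁ π₂ k p q h i y) Z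
        = (Pi.single 5 1 : Fin 8 → ℂ) i) ∧
      (∀ i, evC (flagCoframe θ η₁ η₂ π₁ π₂ k p q h i y) Z' = (Pi.single 7 1 : Fin 8 → ℂ) i) ∧
      evTwo (extD (flagCoframe θ η₁ η₂ π₁ π₂ k p q h 0) y) Z Z' = 0 ∧
      evTwo (extD (flagCoframe θ η₁ η₂ π₁ π₂ k p q h 1) y) Z Z' = 0 ∧
      evTwo (extD (flagCoframe θ η₁ η₂ π₁ π₂ k p q h 2) y) Z Z' = 0 ∧
      evTwo (extD (flagCoframe θ η₁ η₂ π₁ π₂ k p q h 3) y) Z Z' = 0 ∧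
      evTwo (extD (flagCoframe θ η₁ η₂ π₁ π₂ k p q h 4) y) Z Z' = -1 := by
  obtain ⟨Z, hZ, a0, a1, a2, a3, a4, a5, a6, a7⟩ := F.exists_evC_flagCoframe hy (Pi.single 5 1)
  obtain ⟨Y, hY, b0, b1, b2, b3, b4, b5, b6, b7⟩ := F.exists_evC_flagCoframe hy (Pi.single 7 1)
  simp [-one_div] at a0 a1 a2 a3 a4 a5 a6 a7 b0 b1 b2 b3 b4 b5 b6 b7
  have hk := F.k_ne_zero y hy
  have hI := Complex.I_sq
  have hI5 : Complex.I ^ 5 = Complex.I := by linear_combination Complex.I * Complex.I_pow_four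
  have hI6 : Complex.I ^ 6 = -1 := by linear_combination hI + Complex.I ^ 2 * Complex.I_pow_four
  obtain ⟨α, hα⟩ := F.evTwo_extD_flagCoframe_one hy
  obtain ⟨β, hβ⟩ := F.evTwo_extD_flagCoframe_two hy
  obtain ⟨d0, d1, d2, d3, d4, d5, d6, d7⟩ := F.evTwo_extD_values hy Z Y
  refine ⟨Z, Y, hZ, hY, ?_, ?_, ?_, ?_, ?_⟩
  · rw [F.evTwo_extD_flagCoframe_zero hy]
    simp only [d0, d1, d2, d3, d4, d5, d6, d7]
    simp only [a0, a1, a2, a3, a4, a5, a6, a7, b0, b1, b2, b3, b4, b5, b6, b7]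
    field_simp
    try ring_nf
    try simp only [hI, Complex.I_pow_three, Complex.I_pow_four, hI5, hI6]
    try ring
  · rw [hα]
    simp only [d0, d1, d2, d3, d4, d5, d6, d7]
    simp only [a0, a1, a2, a3, a4, a5, a6, a7, b0, b1, b2, b3, b4, b5, b6, b7]
    field_simp
    try ring_nf
    try simp only [hI, Complex.I_pow_three, Complex.I_pow_four, hI5, hI6]
    try ring
  · rw [hβ]
    simp only [d0, d1, d2, d3, d4, d5, d6, d7]
    simp only [a0, a1, a2, a3, a4, a5, a6, a7, b0, b1, b2, b3, b4, b5, b6, b7]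
    field_simp
    try ring_nf
    try simp only [hI, Complex.I_pow_three, Complex.I_pow_four, hI5, hI6]
    try ring
  · change evTwo (extD (θ 1) y) Z Y = _
    simp only [d0, d1, d2, d3, d4, d5, d6, d7]
    simp only [a0, a1, a2, a3, a4, a5, a6, a7, b0, b1, b2, b3, b4, b5, b6, b7]
    field_simp
    try ring_nf
    try simp only [hI, Complex.I_pow_three, Complex.I_pow_four, hI5, hI6]
    try ring
  · change evTwo (extD (θ 2) y) Z Y = _
    simp only [d0, d1, d2, d3, d4, d5, d6, d7]
    simp only [a0, a1, a2, a3, a4, a5, a6, a7, b0, b1, b2, b3, b4, b5, b6, b7]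
    field_simp
    try ring_nf
    try simp only [hI, Complex.I_pow_three, Complex.I_pow_four, hI5, hI6]
    try ring

/-- Coefficients for the third derived system. -/
lemma flag_values_three_seven (F : IsAdaptedFrame N θ η₁ η₂ π₁ π₂ k p q h) (hy : y ∈ N) :
    ∃ Z Z' : E × E, (∀ i, evC (flagCoframe θ η₁ η₂ π₁ π₂ k p q h i y) Z
        = (Pi.single 3 1 : Fin 8 → ℂ) i) ∧
      (∀ i, evC (flagCoframe θ η₁ η₂ π₁ π₂ k p q h i y) Z' = (Pi.single 7 1 : Fin 8 → ℂ) i) ∧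
      evTwo (extD (flagCoframe θ η₁ η₂ π₁ π₂ k p q h 0) y) Z Z' = 0 ∧
      evTwo (extD (flagCoframe θ η₁ η₂ π₁ π₂ k p q h 1) y) Z Z' = -1 / (2 * k y) * (((k y ^ 2 - p y * h y) / (2 * k y)) * p y
        + (((k y ^ 2 + 3 * p y ^ 2 - q y) / (2 * k y)) - ((k y ^ 2 - p y * h y) / (2 * k y))) * h y) := by
  obtain ⟨Z, hZ, a0, a1, a2, a3, a4, a5, a6, a7⟩ := F.exists_evC_flagCoframe hy (Pi.single 3 1)
  obtain ⟨Y, hY, b0, b1, b2, b3, b4, b5, b6, b7⟩ := F.exists_evC_flagCoframe hy (Pi.single 7 1)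
  simp [-one_div] at a0 a1 a2 a3 a4 a5 a6 a7 b0 b1 b2 b3 b4 b5 b6 b7
  have hk := F.k_ne_zero y hy
  have hI := Complex.I_sq
  have hI5 : Complex.I ^ 5 = Complex.I := by linear_combination Complex.I * Complex.I_pow_four
  have hI6 : Complex.I ^ 6 = -1 := by linear_combination hI + Complex.I ^ 2 * Complex.I_pow_four
  obtain ⟨α, hα⟩ := F.evTwo_extD_flagCoframe_one hy
  obtain ⟨β, hβ⟩ := F.evTwo_extD_flagCoframe_two hy
  obtain ⟨d0, d1, d2, d3, d4, d5, d6, d7⟩ := F.evTwo_extD_values hy Z Y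
  refine ⟨Z, Y, hZ, hY, ?_, ?_⟩
  · rw [F.evTwo_extD_flagCoframe_zero hy]
    simp only [d0, d1, d2, d3, d4, d5, d6, d7]
    simp only [a0, a1, a2, a3, a4, a5, a6, a7, b0, b1, b2, b3, b4, b5, b6, b7]
    field_simp
    try ring_nf
    try simp only [hI, Complex.I_pow_three, Complex.I_pow_four, hI5, hI6]
    try ring
  · rw [hα]
    simp only [d0, d1, d2, d3, d4, d5, d6, d7]
    simp only [a0, a1, a2, a3, a4, a5, a6, a7, b0, b1, b2, b3, b4, b5, b6, b7]
    field_simp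
    try ring_nf
    try simp only [hI, Complex.I_pow_three, Complex.I_pow_four, hI5, hI6]
    try ring

/-- Coefficients for the third derived system. -/
lemma flag_values_five_three (F : IsAdaptedFrame N θ η₁ η₂ π₁ π₂ k p q h) (hy : y ∈ N) :
    ∃ Z Z' : E × E, (∀ i, evC (flagCoframe θ η₁ η₂ π₁ π₂ k p q h i y) Z
        = (Pi.single 5 1 : Fin 8 → ℂ) i) ∧
      (∀ i, evC (flagCoframe θ η₁ η₂ π₁ π₂ k p q h i y) Z' = (Pi.single 3 1 : Fin 8 → ℂ) i) ∧
      evTwo (extD (flagCoframe θ η₁ η₂ π₁ π₂ k p q h 0) y) Z Z' = 0 ∧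
      evTwo (extD (flagCoframe θ η₁ η₂ π₁ π₂ k p q h 1) y) Z Z' = -1 / (2 * k y) * (k y ^ 2 * ((k y ^ 2 + 3 * p y ^ 2 - q y) / (2 * k y))
        + p y * h y * ((k y ^ 2 - p y * h y) / (2 * k y)) - 2 * k y ^ 2 * ((k y ^ 2 - p y * h y) / (2 * k y))
        + ((k y ^ 2 - p y * h y) / (2 * k y)) * p y ^ 2) := by
  obtain ⟨Z, hZ, a0, a1, a2, a3, a4, a5, a6, a7⟩ := F.exists_evC_flagCoframe hy (Pi.single 5 1)
  obtain ⟨Y, hY, b0, b1, b2, b3, b4, b5, b6, b7⟩ := F.exists_evC_flagCoframe hy (Pi.single 3 1)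
  simp [-one_div] at a0 a1 a2 a3 a4 a5 a6 a7 b0 b1 b2 b3 b4 b5 b6 b7
  have hk := F.k_ne_zero y hy
  have hI := Complex.I_sq
  have hI5 : Complex.I ^ 5 = Complex.I := by linear_combination Complex.I * Complex.I_pow_four
  have hI6 : Complex.I ^ 6 = -1 := by linear_combination hI + Complex.I ^ 2 * Complex.I_pow_four
  obtain ⟨α, hα⟩ := F.evTwo_extD_flagCoframe_one hy
  obtain ⟨β, hβ⟩ := F.evTwo_extD_flagCoframe_two hy
  obtain ⟨d0, d1, d2, d3, d4, d5, d6, d7⟩ := F.evTwo_extD_values hy Z Y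
  refine ⟨Z, Y, hZ, hY, ?_, ?_⟩
  · rw [F.evTwo_extD_flagCoframe_zero hy]
    simp only [d0, d1, d2, d3, d4, d5, d6, d7]
    simp only [a0, a1, a2, a3, a4, a5, a6, a7, b0, b1, b2, b3, b4, b5, b6, b7]
    field_simp
    try ring_nf
    try simp only [hI, Complex.I_pow_three, Complex.I_pow_four, hI5, hI6]
    try ring
  · rw [hα]
    simp only [d0, d1, d2, d3, d4, d5, d6, d7]
    simp only [a0, a1, a2, a3, a4, a5, a6, a7, b0, b1, b2, b3, b4, b5, b6, b7]
    field_simp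
    try ring_nf
    try simp only [hI, Complex.I_pow_three, Complex.I_pow_four, hI5, hI6]
    try ring

/-- Coefficients for the third derived system. -/
lemma flag_values_four_seven (F : IsAdaptedFrame N θ η₁ η₂ π₁ π₂ k p q h) (hy : y ∈ N) :
    ∃ Z Z' : E × E, (∀ i, evC (flagCoframe θ η₁ η₂ π₁ π₂ k p q h i y) Z
        = (Pi.single 4 1 : Fin 8 → ℂ) i) ∧
      (∀ i, evC (flagCoframe θ η₁ η₂ π₁ π₂ k p q h i y) Z' = (Pi.single 7 1 : Fin 8 → ℂ) i) ∧
      evTwo (extD (flagCoframe θ η₁ η₂ π₁ π₂ k p q h 0) y) Z Z' = Complex.I / (2 * k y) * (k y ^ 2 + p y * h y) ∧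
      evTwo (extD (flagCoframe θ η₁ η₂ π₁ π₂ k p q h 2) y) Z Z' = -1 / (2 * k y) * (-p y * ((k y ^ 2 - p y * h y) / (2 * k y))
        + (((k y ^ 2 + 3 * p y ^ 2 - q y) / (2 * k y)) - ((k y ^ 2 - p y * h y) / (2 * k y))) * h y) := by
  obtain ⟨Z, hZ, a0, a1, a2, a3, a4, a5, a6, a7⟩ := F.exists_evC_flagCoframe hy (Pi.single 4 1)
  obtain ⟨Y, hY, b0, b1, b2, b3, b4, b5, b6, b7⟩ := F.exists_evC_flagCoframe hy (Pi.single 7 1)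
  simp [-one_div] at a0 a1 a2 a3 a4 a5 a6 a7 b0 b1 b2 b3 b4 b5 b6 b7
  have hk := F.k_ne_zero y hy
  have hI := Complex.I_sq
  have hI5 : Complex.I ^ 5 = Complex.I := by linear_combination Complex.I * Complex.I_pow_four
  have hI6 : Complex.I ^ 6 = -1 := by linear_combination hI + Complex.I ^ 2 * Complex.I_pow_four
  obtain ⟨α, hα⟩ := F.evTwo_extD_flagCoframe_one hy
  obtain ⟨β, hβ⟩ := F.evTwo_extD_flagCoframe_two hy
  obtain ⟨d0, d1, d2, d3, d4, d5, d6, d7⟩ := F.evTwo_extD_values hy Z Y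
  refine ⟨Z, Y, hZ, hY, ?_, ?_⟩
  · rw [F.evTwo_extD_flagCoframe_zero hy]
    simp only [d0, d1, d2, d3, d4, d5, d6, d7]
    simp only [a0, a1, a2, a3, a4, a5, a6, a7, b0, b1, b2, b3, b4, b5, b6, b7]
    field_simp
    try ring_nf
    try simp only [hI, Complex.I_pow_three, Complex.I_pow_four, hI5, hI6]
    try ring
  · rw [hβ]
    simp only [d0, d1, d2, d3, d4, d5, d6, d7]
    simp only [a0, a1, a2, a3, a4, a5, a6, a7, b0, b1, b2, b3, b4, b5, b6, b7]
    field_simp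
    try ring_nf
    try simp only [hI, Complex.I_pow_three, Complex.I_pow_four, hI5, hI6]
    try ring

/-- Coefficients for the third derived system. -/
lemma flag_values_five_four (F : IsAdaptedFrame N θ η₁ η₂ π₁ π₂ k p q h) (hy : y ∈ N) :
    ∃ Z Z' : E × E, (∀ i, evC (flagCoframe θ η₁ η₂ π₁ π₂ k p q h i y) Z
        = (Pi.single 5 1 : Fin 8 → ℂ) i) ∧
      (∀ i, evC (flagCoframe θ η₁ η₂ π₁ π₂ k p q h i y) Z' = (Pi.single 4 1 : Fin 8 → ℂ) i) ∧
      evTwo (extD (flagCoframe θ η₁ η₂ π₁ π₂ k p q h 0) y) Z Z' = Complex.I / (2 * k y) * (3 * k y ^ 2 * p y - p y ^ 2 * h y) ∧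
      evTwo (extD (flagCoframe θ η₁ η₂ π₁ π₂ k p q h 2) y) Z Z' = -1 / (2 * k y) * (-k y ^ 2 * ((k y ^ 2 - p y * h y) / (2 * k y))
        - (q y - 2 * p y ^ 2) * ((k y ^ 2 - p y * h y) / (2 * k y))
        - p y * h y * (((k y ^ 2 + 3 * p y ^ 2 - q y) / (2 * k y)) - ((k y ^ 2 - p y * h y) / (2 * k y))) + 2 * k y ^ 2 * ((k y ^ 2 + 3 * p y ^ 2 - q y) / (2 * k y))) := by
  obtain ⟨Z, hZ, a0, a1, a2, a3, a4, a5, a6, a7⟩ := F.exists_evC_flagCoframe hy (Pi.single 5 1)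
  obtain ⟨Y, hY, b0, b1, b2, b3, b4, b5, b6, b7⟩ := F.exists_evC_flagCoframe hy (Pi.single 4 1)
  simp [-one_div] at a0 a1 a2 a3 a4 a5 a6 a7 b0 b1 b2 b3 b4 b5 b6 b7
  have hk := F.k_ne_zero y hy
  have hI := Complex.I_sq
  have hI5 : Complex.I ^ 5 = Complex.I := by linear_combination Complex.I * Complex.I_pow_four
  have hI6 : Complex.I ^ 6 = -1 := by linear_combination hI + Complex.I ^ 2 * Complex.I_pow_four
  obtain ⟨α, hα⟩ := F.evTwo_extD_flagCoframe_one hy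
  obtain ⟨β, hβ⟩ := F.evTwo_extD_flagCoframe_two hy
  obtain ⟨d0, d1, d2, d3, d4, d5, d6, d7⟩ := F.evTwo_extD_values hy Z Y
  refine ⟨Z, Y, hZ, hY, ?_, ?_⟩
  · rw [F.evTwo_extD_flagCoframe_zero hy]
    simp only [d0, d1, d2, d3, d4, d5, d6, d7]
    simp only [a0, a1, a2, a3, a4, a5, a6, a7, b0, b1, b2, b3, b4, b5, b6, b7]
    field_simp
    try ring_nf
    try simp only [hI, Complex.I_pow_three, Complex.I_pow_four, hI5, hI6]
    try ring
  · rw [hβ]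
    simp only [d0, d1, d2, d3, d4, d5, d6, d7]
    simp only [a0, a1, a2, a3, a4, a5, a6, a7, b0, b1, b2, b3, b4, b5, b6, b7]
    field_simp
    try ring_nf
    try simp only [hI, Complex.I_pow_three, Complex.I_pow_four, hI5, hI6]
    try ring

end IsAdaptedFrame

end AdaptedFrames

end DarbouxEmbedding

end

noncomputable section

namespace DarbouxEmbedding

/-! ### Upper bounds for the derived flag, and the resulting algebraic equation -/

section AdaptedFrames

variable {E : Type*} [NormedAddCommGroup E] [NormedSpace ℝ E]

namespace IsAdaptedFrame

variable {N : Set E} {θ : Fin 4 → E → E →L[ℝ] ℂ} {η₁ η₂ π₁ π₂ : E → E →L[ℝ] ℂ}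
  {k p q h : E → ℂ} {y : E}

/-- The coefficients of an element of the derived system of a member of the flag. -/
lemma exists_coeff_of_mem_derivedSystem (F : IsAdaptedFrame N θ η₁ η₂ π₁ π₂ k p q h)
    (hy : y ∈ N) (n : Fin 8) {α : E →L[ℝ] ℂ}
    (hα : α ∈ derivedSystem (fun y => Submodule.span ℂ
      ((fun i => flagCoframe θ η₁ η₂ π₁ π₂ k p q h i y) '' {i | i < n})) y) :
    ∃ c : Fin 8 → ℂ, (∀ i, n ≤ i → c i = 0) ∧
      α = ∑ i, c i • flagCoframe θ η₁ η₂ π₁ π₂ k p q h i y ∧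
      ∀ (Z Z' : E × E) (a b : Fin 8), n ≤ a → n ≤ b →
        (∀ i, evC (flagCoframe θ η₁ η₂ π₁ π₂ k p q h i y) Z = (Pi.single a 1 : Fin 8 → ℂ) i) →
        (∀ i, evC (flagCoframe θ η₁ η₂ π₁ π₂ k p q h i y) Z' = (Pi.single b 1 : Fin 8 → ℂ) i) →
        ∑ i, c i * evTwo (extD (flagCoframe θ η₁ η₂ π₁ π₂ k p q h i) y) Z Z' = 0 := by
  obtain ⟨c, h1, h2, h3⟩ := DarbouxEmbedding.exists_coeff_of_mem_derivedSystem {i | i < n}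
    (F.contDiffAt_flagCoframe hy) (F.linearIndependent_flagCoframe hy) (F.span_flagCoframe hy) hα
  refine ⟨c, fun i hi => h1 i (by simpa using hi), h2, fun Z Z' a b ha hb hZ hZ' => ?_⟩
  refine h3 Z Z' (fun i hi => ?_) (fun i hi => ?_)
  · rw [hZ, Pi.single_apply, if_neg]
    rintro rfl
    exact absurd ha (by simpa using hi)
  · rw [hZ', Pi.single_apply, if_neg]
    rintro rfl
    exact absurd hb (by simpa using hi)

lemma sum_mem_span_flagCoframe {n : Fin 8} {c : Fin 8 → ℂ} (hc : ∀ i, n ≤ i → c i = 0) :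
    ∑ i, c i • flagCoframe θ η₁ η₂ π₁ π₂ k p q h i y ∈ Submodule.span ℂ
      ((fun i => flagCoframe θ η₁ η₂ π₁ π₂ k p q h i y) '' {i | i < n}) := by
  refine Submodule.sum_mem _ fun i _ => ?_
  by_cases hi : i < n
  · exact Submodule.smul_mem _ _ (Submodule.subset_span ⟨i, hi, rfl⟩)
  · rw [hc i (not_lt.mp hi)]
    convert Submodule.zero_mem _ using 1
    ext u
    simp

/-- On the vectors dual to f₆, f₇ only the derivative of f₅ = θ₀ among the six is nonzero, with
value -i/(2k). Hence no form in the derived system can contain f₅. -/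
lemma derivedSystem_span_six_le (F : IsAdaptedFrame N θ η₁ η₂ π₁ π₂ k p q h) (hy : y ∈ N) :
    derivedSystem (fun y => Submodule.span ℂ
      ((fun i => flagCoframe θ η₁ η₂ π₁ π₂ k p q h i y) '' {i | i < 6})) y ≤
    Submodule.span ℂ ((fun i => flagCoframe θ η₁ η₂ π₁ π₂ k p q h i y) '' {i | i < 5}) := by
  intro α hα
  obtain ⟨c, h1, rfl, h3⟩ := F.exists_coeff_of_mem_derivedSystem hy 6 hα
  obtain ⟨Z, Y, hZ, hY, v0, v1, v2, v3, v4, v5⟩ := F.flag_values_six_seven hy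
  have h4 := h3 Z Y 6 7 (by decide) (by decide) hZ hY
  have hk := F.k_ne_zero y hy
  have c6 := h1 6 (by decide)
  have c7 := h1 7 (by decide)
  rw [Fin.sum_univ_eight, v0, v1, v2, v3, v4, v5, c6, c7] at h4
  have c5 : c 5 = 0 := by
    have : c 5 * (-Complex.I / (2 * k y)) = 0 := by linear_combination h4
    rcases mul_eq_zero.mp this with h | h
    · exact h
    · simp [hk] at h
  refine sum_mem_span_flagCoframe fun i hi => ?_
  obtain rfl | rfl | rfl : i = 5 ∨ i = 6 ∨ i = 7 := by omega
  exacts [c5, c6, c7]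

/-- The pair dual to f₅, f₆ detects only dθ₁ and the pair dual to f₅, f₇ only dθ₂, with values 1 and
-1. The correction terms in f₀, f₁, f₂ make their derivatives vanish on both pairs. -/
lemma derivedSystem_span_five_le (F : IsAdaptedFrame N θ η₁ η₂ π₁ π₂ k p q h) (hy : y ∈ N) :
    derivedSystem (fun y => Submodule.span ℂ
      ((fun i => flagCoframe θ η₁ η₂ π₁ π₂ k p q h i y) '' {i | i < 5})) y ≤
    Submodule.span ℂ ((fun i => flagCoframe θ η₁ η₂ π₁ π₂ k p q h i y) '' {i | i < 3}) := by
  intro α hα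
  obtain ⟨c, h1, rfl, h3⟩ := F.exists_coeff_of_mem_derivedSystem hy 5 hα
  have c5 := h1 5 (by decide)
  have c6 := h1 6 (by decide)
  have c7 := h1 7 (by decide)
  have c3 : c 3 = 0 := by
    obtain ⟨Z, Y, hZ, hY, v0, v1, v2, v3, v4⟩ := F.flag_values_five_six hy
    have h4 := h3 Z Y 5 6 (by decide) (by decide) hZ hY
    rw [Fin.sum_univ_eight, v0, v1, v2, v3, v4, c5, c6, c7] at h4
    linear_combination h4
  have c4 : c 4 = 0 := by
    obtain ⟨Z, Y, hZ, hY, v0, v1, v2, v3, v4⟩ := F.flag_values_five_seven hy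
    have h4 := h3 Z Y 5 7 (by decide) (by decide) hZ hY
    rw [Fin.sum_univ_eight, v0, v1, v2, v3, v4, c5, c6, c7] at h4
    linear_combination -h4
  refine sum_mem_span_flagCoframe fun i hi => ?_
  obtain rfl | rfl | rfl | rfl | rfl : i = 3 ∨ i = 4 ∨ i = 5 ∨ i = 6 ∨ i = 7 := by omega
  exacts [c3, c4, c5, c6, c7]

/-- Here b measures the failure of the conclusion, since 2kb = k² - ph. If b ≠ 0, then `e1` and `e2`
force p = -h and a = 2b, whence q = h² - k². Eliminating the unknown c from `e3` and `e4` then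
leaves k³b² = 0, a contradiction. -/
lemma eq_of_flag_equations {k p q h a b c : ℂ} (hk : k ≠ 0) (ha : k ^ 2 + 3 * p ^ 2 - q = 2 * k * a)
    (hb : k ^ 2 - p * h = 2 * k * b) (e1 : b * p + (a - b) * h = 0)
    (e2 : k ^ 2 * a + p * h * b - 2 * k ^ 2 * b + b * p ^ 2 = 0)
    (e3 : -p * b + (a - b) * h + c * (k ^ 2 + p * h) = 0)
    (e4 : -k ^ 2 * b - (q - 2 * p ^ 2) * b - p * h * (a - b) + 2 * k ^ 2 * a
      + c * (3 * k ^ 2 * p - p ^ 2 * h) = 0) : p * h = k ^ 2 := by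
  by_contra hne
  have hb0 : b ≠ 0 := by
    rintro rfl
    exact hne (by linear_combination -hb)
  have hph : p = -h := by
    -- Elimination of a: k²·e1 - h·e2 equals b(p + h)(k² - ph).
    have : 2 * k * b ^ 2 * (p + h) = 0 := by
      linear_combination k ^ 2 * e1 - h * e2 - b * (p + h) * hb
    have h2 : p + h = 0 := by
      rcases mul_eq_zero.mp this with h' | h'
      · simp [hk, hb0] at h'
      · exact h'
    linear_combination h2
  subst hph
  have hab : a = 2 * b := by
    by_cases hh : h = 0
    · subst hh
      have : k ^ 2 * (a - 2 * b) = 0 := by linear_combination e2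
      rcases mul_eq_zero.mp this with h' | h'
      · simp [hk] at h'
      · linear_combination h'
    · have : h * (a - 2 * b) = 0 := by linear_combination e1
      rcases mul_eq_zero.mp this with h' | h'
      · exact absurd h' hh
      · linear_combination h'
  subst hab
  have hq : q = h ^ 2 - k ^ 2 := by linear_combination -ha + 2 * hb
  subst hq
  -- With p = -h, the coefficients of c in `e3` and `e4` are k² - h² and -h(3k² + h²); the
  -- combination cancels them.
  have : k ^ 3 * b ^ 2 = 0 := by
    linear_combination (1 / 8 : ℂ) * ((k ^ 2 - h ^ 2) * e4 + h * (3 * k ^ 2 + h ^ 2) * e3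
      - 4 * k ^ 2 * b * hb)
  simp [hk, hb0] at this

/-- Darboux integrability, in the form of the transversality of the derived flag of one singular
system to the other singular system, determines the geometry of the metric. -/
theorem mul_eq_sq_of_transversal (F : IsAdaptedFrame N θ η₁ η₂ π₁ π₂ k p q h) {x : E} (hx : x ∈ N)
    {V : E → Submodule ℂ (E →L[ℝ] ℂ)} {T : Submodule ℂ (E →L[ℝ] ℂ)}
    (hV : ∀ᶠ y in 𝓝 x, V y ≤ Submodule.span ℂ
      ((fun i => flagCoframe θ η₁ η₂ π₁ π₂ k p q h i y) '' {i | i < 6}))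
    (hT : ∀ α ∈ T, ∀ Z : E × E, (∀ i, evC (θ i x) Z = 0) →
      evC (π₁ x + (Complex.I * k x) • η₂ x) Z = 0 →
      evC (π₂ x + (-Complex.I * k x) • η₁ x) Z = 0 → evC α Z = 0)
    (hVT : T ⊔ derivedLimit V x = ⊤) : p x * h x = k x ^ 2 := by
  have hN : ∀ᶠ y in 𝓝 x, y ∈ N := F.isOpen.mem_nhds hx
  have h1 : ∀ᶠ y in 𝓝 x, derivedSystem V y ≤ Submodule.span ℂ
      ((fun i => flagCoframe θ η₁ η₂ π₁ π₂ k p q h i y) '' {i | i < 5}) := by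
    filter_upwards [hV.eventually_nhds, hN] with y hy hyN
    exact (derivedSystem_mono hy).trans (F.derivedSystem_span_six_le hyN)
  have h2 : ∀ᶠ y in 𝓝 x, derivedSystem (derivedSystem V) y ≤ Submodule.span ℂ
      ((fun i => flagCoframe θ η₁ η₂ π₁ π₂ k p q h i y) '' {i | i < 3}) := by
    filter_upwards [h1.eventually_nhds, hN] with y hy hyN
    exact (derivedSystem_mono hy).trans (F.derivedSystem_span_five_le hyN)
  -- The second derived system lies in the span of f₀, f₁, f₂, so the limit, contained in the third,
  -- lies in the derived system of that span.
  have h3 : derivedLimit V x ≤ derivedSystem (fun y => Submodule.span ℂ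
      ((fun i => flagCoframe θ η₁ η₂ π₁ π₂ k p q h i y) '' {i | i < 3})) x :=
    (iInf_le (fun n : ℕ => (derivedSystem^[n] V) x) 3).trans (derivedSystem_mono h2)
  -- The vectors dual to f₁ and f₂ annihilate T. Since T and V^∞ together span everything, V^∞
  -- contains elements with arbitrary prescribed values on these two vectors.
  obtain ⟨Z1, hZ1, a0, a1, a2, a3, -⟩ := F.exists_evC_flagCoframe hx (Pi.single 1 1)
  obtain ⟨Z2, hZ2, b0, b1, b2, b3, -⟩ := F.exists_evC_flagCoframe hx (Pi.single 2 1)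
  have hT1 : ∀ α ∈ T, evC α Z1 = 0 := fun α hα => hT α hα Z1
    (by
      intro i
      fin_cases i
      · simpa using a0
      · simpa using a1
      · simpa using a2
      · simpa using a3)
    (by simpa [flagCoframe] using hZ1 6) (by simpa [flagCoframe] using hZ1 7)
  have hT2 : ∀ α ∈ T, evC α Z2 = 0 := fun α hα => hT α hα Z2
    (by
      intro i
      fin_cases i
      · simpa using b0
      · simpa using b1
      · simpa using b2
      · simpa using b3)
    (by simpa [flagCoframe] using hZ2 6) (by simpa [flagCoframe] using hZ2 7)
  have key : ∀ β : E →L[ℝ] ℂ, ∃ c : Fin 8 → ℂ, (∀ i, 3 ≤ i → c i = 0) ∧ c 1 = evC β Z1 ∧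
      c 2 = evC β Z2 ∧ ∀ (Z Z' : E × E) (a b : Fin 8), 3 ≤ a → 3 ≤ b →
        (∀ i, evC (flagCoframe θ η₁ η₂ π₁ π₂ k p q h i x) Z = (Pi.single a 1 : Fin 8 → ℂ) i) →
        (∀ i, evC (flagCoframe θ η₁ η₂ π₁ π₂ k p q h i x) Z' = (Pi.single b 1 : Fin 8 → ℂ) i) →
        ∑ i, c i * evTwo (extD (flagCoframe θ η₁ η₂ π₁ π₂ k p q h i) x) Z Z' = 0 := by
    intro β
    have hβ : β ∈ T ⊔ derivedLimit V x := hVT ▸ Submodule.mem_top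
    obtain ⟨t, ht, α, hα, rfl⟩ := Submodule.mem_sup.mp hβ
    obtain ⟨c, g1, rfl, g3⟩ := F.exists_coeff_of_mem_derivedSystem hx 3 (h3 hα)
    refine ⟨c, g1, ?_, ?_, g3⟩
    · rw [evC_add, hT1 t ht, evC_sum]
      simp [evC_smul, hZ1, Pi.single_apply]
    · rw [evC_add, hT2 t ht, evC_sum]
      simp [evC_smul, hZ2, Pi.single_apply]
  have hk := F.k_ne_zero x hx
  have h2k : (2 : ℂ) * k x ≠ 0 := mul_ne_zero two_ne_zero hk
  have red : ∀ c : Fin 8 → ℂ, (∀ i, 3 ≤ i → c i = 0) → ∀ g : Fin 8 → ℂ,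
      ∑ i, c i * g i = 0 → c 0 * g 0 + c 1 * g 1 + c 2 * g 2 = 0 := by
    intro c hc g hg
    rw [Fin.sum_univ_eight, hc 3 (by decide), hc 4 (by decide), hc 5 (by decide),
      hc 6 (by decide), hc 7 (by decide)] at hg
    linear_combination hg
  -- These are elements c₀f₀ + f₁ and d₀f₀ + f₂ of V^∞; only the f₀-coefficients are unknown.
  obtain ⟨c, c3, c1, c2, hc⟩ := key (flagCoframe θ η₁ η₂ π₁ π₂ k p q h 1 x)
  obtain ⟨d, d3, d1, d2, hd⟩ := key (flagCoframe θ η₁ η₂ π₁ π₂ k p q h 2 x)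
  simp only [hZ1, hZ2] at c1 c2 d1 d2
  simp at c1 c2 d1 d2
  have e1 : ((k x ^ 2 - p x * h x) / (2 * k x)) * p x
      + (((k x ^ 2 + 3 * p x ^ 2 - q x) / (2 * k x))
        - ((k x ^ 2 - p x * h x) / (2 * k x))) * h x = 0 := by
    obtain ⟨Z, Y, hZ, hY, v0, v1⟩ := F.flag_values_three_seven hx
    have := red c c3 _ (hc Z Y 3 7 (by decide) (by decide) hZ hY)
    rw [v0, v1, c1, c2] at this
    have h' : -1 / (2 * k x) ≠ 0 := div_ne_zero (by simp) h2k
    refine (mul_eq_zero.mp ?_).resolve_left h'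
    linear_combination this
  -- As on the pair dual to f₃, f₇, the derivative of f₀ vanishes here, so c₀ does not enter the
  -- first two equations.
  obtain ⟨U, U', hU, hU', u0, u1⟩ := F.flag_values_five_three hx
  have e2 := red c c3 _ (hc U U' 5 3 (by decide) (by decide) hU hU')
  rw [u0, u1, c1, c2, mul_zero, zero_add, one_mul, zero_mul, add_zero] at e2
  replace e2 := (mul_eq_zero.mp e2).resolve_left (div_ne_zero (by simp) h2k)
  obtain ⟨Z, Y, hZ, hY, v0, v2⟩ := F.flag_values_four_seven hx
  have r3 := red d d3 _ (hd Z Y 4 7 (by decide) (by decide) hZ hY)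
  obtain ⟨Z', Y', hZ', hY', w0, w2⟩ := F.flag_values_five_four hx
  have r4 := red d d3 _ (hd Z' Y' 5 4 (by decide) (by decide) hZ' hY')
  rw [v0, v2, d1, d2] at r3
  rw [w0, w2, d1, d2] at r4
  -- On the last two pairs df₀ carries the factor i/(2k) and df₂ the factor -1/(2k). Dividing by the
  -- latter turns d₀ into -i d₀, the constant c of the algebraic lemma.
  refine eq_of_flag_equations (c := -Complex.I * d 0) hk
    (a := (k x ^ 2 + 3 * p x ^ 2 - q x) / (2 * k x)) (b := (k x ^ 2 - p x * h x) / (2 * k x))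
    (mul_div_cancel₀ _ h2k).symm (mul_div_cancel₀ _ h2k).symm e1 e2 ?_ ?_
  · have h' : -1 / (2 * k x) ≠ 0 := div_ne_zero (by simp) h2k
    refine (mul_eq_zero.mp ?_).resolve_left h'
    linear_combination r3
  · have h' : -1 / (2 * k x) ≠ 0 := div_ne_zero (by simp) h2k
    refine (mul_eq_zero.mp ?_).resolve_left h'
    linear_combination r4

end IsAdaptedFrame

end AdaptedFrames

end DarbouxEmbedding

end

noncomputable section

namespace DarbouxEmbedding

/-! ## The singular systems of a decomposition -/

section Singular

variable {E : Type*} [NormedAddCommGroup E] [NormedSpace ℝ E]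

/-- The expansion of a covector in a coframe. -/
lemma evC_eq_sum_dual {ι : Type*} [Fintype ι] [DecidableEq ι] {Θ : ι → E →L[ℝ] ℂ}
    (hspan : Submodule.span ℂ (Set.range Θ) = ⊤) {D : ι → E × E}
    (hD : ∀ j i, evC (Θ i) (D j) = if i = j then 1 else 0) (α : E →L[ℝ] ℂ) (Z : E × E) :
    evC α Z = ∑ j, evC α (D j) * evC (Θ j) Z := by
  have hα : α ∈ Submodule.span ℂ (Set.range Θ) := hspan ▸ Submodule.mem_top
  obtain ⟨c, rfl⟩ := (Submodule.mem_span_range_iff_exists_fun ℂ).mp hα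
  simp [evC_sum, evC_smul, hD]

lemma exists_dual {ι : Type*} [Fintype ι] [DecidableEq ι] {Θ : ι → E →L[ℝ] ℂ}
    (hind : LinearIndependent ℂ Θ) :
    ∃ D : ι → E × E, ∀ j i, evC (Θ i) (D j) = if i = j then 1 else 0 := by
  choose D hD using fun j : ι => exists_evC_eq hind (fun i => if i = j then 1 else 0)
  exact ⟨D, hD⟩

/-- If the forms `s` vanish on the vectors annihilated by `θ`, `σ` and the forms `t` vanish on those
annihilated by `θ`, `τ`, then `σ` vanishes on the vectors annihilated by `θ`, `s`. -/
lemma evC_eq_zero_of_vanishing {n : ℕ} {θ : Fin n → E →L[ℝ] ℂ} {σ τ s t : Fin 2 → E →L[ℝ] ℂ}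
    (hind : LinearIndependent ℂ (Sum.elim θ (Sum.elim σ τ)))
    (hspan : Submodule.span ℂ (Set.range (Sum.elim θ (Sum.elim σ τ))) = ⊤)
    (hspan' : Submodule.span ℂ (Set.range (Sum.elim θ (Sum.elim s t))) = ⊤)
    (hs : ∀ Z, (∀ i, evC (θ i) Z = 0) → (∀ a, evC (σ a) Z = 0) → ∀ j, evC (s j) Z = 0)
    (ht : ∀ Z, (∀ i, evC (θ i) Z = 0) → (∀ a, evC (τ a) Z = 0) → ∀ j, evC (t j) Z = 0)
    (Z : E × E) (hθZ : ∀ i, evC (θ i) Z = 0) (hsZ : ∀ j, evC (s j) Z = 0) (a : Fin 2) :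
    evC (σ a) Z = 0 := by
  obtain ⟨D, hD⟩ := exists_dual hind
  have hS : ∀ b i, evC (θ i) (D (Sum.inr (Sum.inl b))) = 0 := fun b i => by
    simpa using hD (Sum.inr (Sum.inl b)) (Sum.inl i)
  have hSτ : ∀ b i, evC (τ i) (D (Sum.inr (Sum.inl b))) = 0 := fun b i => by
    simpa using hD (Sum.inr (Sum.inl b)) (Sum.inr (Sum.inr i))
  have hT : ∀ b i, evC (θ i) (D (Sum.inr (Sum.inr b))) = 0 := fun b i => by
    simpa using hD (Sum.inr (Sum.inr b)) (Sum.inl i)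
  have hTσ : ∀ b i, evC (σ i) (D (Sum.inr (Sum.inr b))) = 0 := fun b i => by
    simpa using hD (Sum.inr (Sum.inr b)) (Sum.inr (Sum.inl i))
  -- The sum is α evaluated on the σ-component of Z, that is Z minus its τ-component. It vanishes
  -- for t because this component is killed by θ and τ, and for s because both Z and its τ-component
  -- are killed by s. So the component is zero.
  have key : ∀ α : E →L[ℝ] ℂ,
      ∑ b, evC α (D (Sum.inr (Sum.inl b))) * evC (σ b) Z = 0 := by
    intro α
    have hα : α ∈ Submodule.span ℂ (Set.range (Sum.elim θ (Sum.elim s t))) :=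
      hspan' ▸ Submodule.mem_top
    induction hα using Submodule.span_induction with
    | mem β h =>
      obtain ⟨i | j | j, rfl⟩ := h
      · simp [hS]
      · have := evC_eq_sum_dual hspan hD (s j) Z
        rw [hsZ j, Fintype.sum_sum_type, Fintype.sum_sum_type] at this
        simp only [Sum.elim_inl, Sum.elim_inr, hθZ, mul_zero, Finset.sum_const_zero,
          zero_add, hs _ (hT _) (hTσ _) j, zero_mul, add_zero] at this
        exact this.symm
      · simp [ht _ (hS _) (hSτ _) j]
    | zero => simp [evC_zero]
    | add β γ _ _ h1 h2 => simp only [evC_add, add_mul, Finset.sum_add_distrib, h1, h2, add_zero]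
    | smul c β _ h1 => simp only [evC_smul, mul_assoc, ← Finset.mul_sum, h1, mul_zero]
  have := key (σ a)
  have hσ : ∀ b, evC (σ a) (D (Sum.inr (Sum.inl b))) = if a = b then 1 else 0 := fun b => by
    simpa using hD (Sum.inr (Sum.inl b)) (Sum.inr (Sum.inl a))
  simpa [hσ] using this

/-- If `s₀ ∧ s₁` vanishes on pairs of vectors of two complementary planes, then both `s₀` and `s₁`
vanish on one of the planes. -/
lemma vanishing_or_vanishing {n : ℕ} {θ : Fin n → E →L[ℝ] ℂ} {σ τ s t : Fin 2 → E →L[ℝ] ℂ}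
    (hind : LinearIndependent ℂ (Sum.elim θ (Sum.elim σ τ)))
    (hspan : Submodule.span ℂ (Set.range (Sum.elim θ (Sum.elim σ τ))) = ⊤)
    (hind' : LinearIndependent ℂ (Sum.elim θ (Sum.elim s t)))
    (h : ∀ Z Z', (∀ i, evC (θ i) Z = 0) → (∀ i, evC (θ i) Z' = 0) → (∀ a, evC (τ a) Z = 0) →
      (∀ a, evC (σ a) Z' = 0) → evC (s 0) Z * evC (s 1) Z' = evC (s 0) Z' * evC (s 1) Z) :
    (∀ Z, (∀ i, evC (θ i) Z = 0) → (∀ a, evC (σ a) Z = 0) → ∀ j, evC (s j) Z = 0) ∨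
    (∀ Z, (∀ i, evC (θ i) Z = 0) → (∀ a, evC (τ a) Z = 0) → ∀ j, evC (s j) Z = 0) := by
  by_contra hcon
  rw [not_or] at hcon
  obtain ⟨h1, h2⟩ := hcon
  push Not at h1 h2
  obtain ⟨T, hTθ, hTσ, j, hj⟩ := h1
  obtain ⟨S, hSθ, hSτ, l, hl⟩ := h2
  -- α is a nontrivial combination of s₀ and s₁. It vanishes on one plane by the hypothesis paired
  -- with T. On the other, s(Z) and s(T) are both proportional to the nonzero s(S), so it vanishes
  -- there as well. Hence α would vanish on the whole kernel of θ, against the independence of s.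
  set α : E →L[ℝ] ℂ := evC (s 1) T • s 0 - evC (s 0) T • s 1 with hα
  have hαZ : ∀ Z, evC α Z = evC (s 1) T * evC (s 0) Z - evC (s 0) T * evC (s 1) Z := by
    intro Z
    rw [hα, evC_sub, evC_smul, evC_smul]
  have hαS : ∀ Z, (∀ i, evC (θ i) Z = 0) → (∀ a, evC (τ a) Z = 0) → evC α Z = 0 := by
    intro Z hZ hZ'
    rw [hαZ]
    linear_combination h Z T hZ hTθ hZ' hTσ
  have hαT : ∀ Z, (∀ i, evC (θ i) Z = 0) → (∀ a, evC (σ a) Z = 0) → evC α Z = 0 := by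
    intro Z hZ hZ'
    rw [hαZ]
    have e1 := h S T hSθ hTθ hSτ hTσ
    have e2 := h S Z hSθ hZ hSτ hZ'
    have hl' : evC (s 0) S ≠ 0 ∨ evC (s 1) S ≠ 0 := by
      fin_cases l
      · exact Or.inl hl
      · exact Or.inr hl
    rcases hl' with hl' | hl'
    · refine (mul_eq_zero.mp ?_).resolve_left hl'
      linear_combination evC (s 0) Z * e1 - evC (s 0) T * e2
    · refine (mul_eq_zero.mp ?_).resolve_left hl'
      linear_combination evC (s 1) Z * e1 - evC (s 1) T * e2
  obtain ⟨D, hD⟩ := exists_dual hind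
  have hzero : ∀ Z, (∀ i, evC (θ i) Z = 0) → evC α Z = 0 := by
    intro Z hZ
    rw [evC_eq_sum_dual hspan hD α Z, Fintype.sum_sum_type, Fintype.sum_sum_type]
    have e1 : ∀ b, evC α (D (Sum.inr (Sum.inl b))) = 0 := fun b => hαS _
      (fun i => by simpa using hD (Sum.inr (Sum.inl b)) (Sum.inl i))
      (fun i => by simpa using hD (Sum.inr (Sum.inl b)) (Sum.inr (Sum.inr i)))
    have e2 : ∀ b, evC α (D (Sum.inr (Sum.inr b))) = 0 := fun b => hαT _
      (fun i => by simpa using hD (Sum.inr (Sum.inr b)) (Sum.inl i))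
      (fun i => by simpa using hD (Sum.inr (Sum.inr b)) (Sum.inr (Sum.inl i)))
    simp [e1, e2, hZ]
  obtain ⟨D', hD'⟩ := exists_dual hind'
  have f1 := hzero (D' (Sum.inr (Sum.inl 0))) fun i => by
    simpa using hD' (Sum.inr (Sum.inl 0)) (Sum.inl i)
  have f2 := hzero (D' (Sum.inr (Sum.inl 1))) fun i => by
    simpa using hD' (Sum.inr (Sum.inl 1)) (Sum.inl i)
  have g1 : ∀ b c, evC (s b) (D' (Sum.inr (Sum.inl c))) = if b = c then 1 else 0 := fun b c => by
    simpa using hD' (Sum.inr (Sum.inl c)) (Sum.inr (Sum.inl b))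
  rw [hαZ, g1, g1] at f1 f2
  fin_cases j
  · apply hj; simpa using f2
  · apply hj; simpa using f1

lemma evTwo_eq_zero_of_mem_lambdaTwo {V : Submodule ℂ (E →L[ℝ] ℂ)} {w : E → E → ℂ}
    (hw : w ∈ lambdaTwo V) {Z Z' : E × E}
    (h : (∀ α ∈ V, evC α Z = 0) ∨ ∀ α ∈ V, evC α Z' = 0) : evTwo w Z Z' = 0 := by
  induction hw using Submodule.span_induction with
  | mem x hx =>
    obtain ⟨α, hα, β, hβ, rfl⟩ := hx
    rw [evTwo_wedge]
    rcases h with h | h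
    · rw [h α hα, h β hβ]; ring
    · rw [h α hα, h β hβ]; ring
  | zero => simp [evTwo]
  | add x y _ _ hx hy => rw [evTwo_add, hx, hy, add_zero]
  | smul c x _ hx => rw [evTwo_smul, hx, mul_zero]

/-- In a decomposition, the generating two-forms vanish on pairs of vectors of the two
complementary planes. -/
lemma IsDecomposition.evTwo_extD_eq_zero {r p q s t : ℕ} {θ : Fin r → E → E →L[ℝ] ℂ}
    {σ₁ : Fin p → E → E →L[ℝ] ℂ} {σ₂ : Fin q → E → E →L[ℝ] ℂ}
    {Ω₁ : Fin s → E → E → E → ℂ} {Ω₂ : Fin t → E → E → E → ℂ} {N : Set E}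
    (H : IsDecomposition θ σ₁ σ₂ Ω₁ Ω₂ N) {y : E} (hy : y ∈ N) (i : Fin r) {Z Z' : E × E}
    (hZ : ∀ i, evC (θ i y) Z = 0) (hZ' : ∀ i, evC (θ i y) Z' = 0)
    (hσ : ∀ a, evC (σ₂ a y) Z = 0) (hσ' : ∀ a, evC (σ₁ a y) Z' = 0) :
    evTwo (extD (θ i) y) Z Z' = 0 := by
  have h1 : extD (θ i) y ∈ idealTwo (spanAt θ y) (Set.range fun i => extD (θ i) y) :=
    Submodule.subset_span (Or.inl ⟨i, rfl⟩)
  rw [H.generates y hy] at h1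
  have hspan : ∀ {m : ℕ} {ξ : Fin m → E → E →L[ℝ] ℂ} {Y : E × E}, (∀ i, evC (ξ i y) Y = 0) →
      ∀ α ∈ spanAt ξ y, evC α Y = 0 := by
    intro m ξ Y hY α hα
    refine evC_eq_zero_of_mem_span hα ?_
    rintro _ ⟨i, rfl⟩
    exact hY i
  refine evTwo_eq_zero_of_mem_idealTwo h1 (hspan hZ) (hspan hZ') ?_
  rintro _ (⟨b, rfl⟩ | ⟨b, rfl⟩)
  · exact evTwo_eq_zero_of_mem_lambdaTwo (H.mem_Ω₁ b y hy) (Or.inr (hspan hσ'))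
  · exact evTwo_eq_zero_of_mem_lambdaTwo (H.mem_Ω₂ b y hy) (Or.inl (hspan hσ))

end Singular

/-! ### The two decomposable members of the pencil of two-forms -/

section Singular

variable {E : Type*} [NormedAddCommGroup E] [NormedSpace ℝ E]

/-- The members of the two singular systems which complement the Pfaffian forms. -/
def singularForms (η₁ η₂ π₁ π₂ : E → E →L[ℝ] ℂ) (k : E → ℂ) (c : ℂ) :
    Fin 2 → E → E →L[ℝ] ℂ :=
  ![fun y => π₁ y + (-c * k y) • η₂ y, fun y => π₂ y + (c * k y) • η₁ y]

namespace IsAdaptedFrame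

variable {N : Set E} {θ : Fin 4 → E → E →L[ℝ] ℂ} {η₁ η₂ π₁ π₂ : E → E →L[ℝ] ℂ}
  {k p q h : E → ℂ} {y : E}

lemma contDiffAt_singularForms (F : IsAdaptedFrame N θ η₁ η₂ π₁ π₂ k p q h) (hy : y ∈ N) (c : ℂ)
    (i : Fin 2) : ContDiffAt ℝ ∞ (singularForms η₁ η₂ π₁ π₂ k c i) y := by
  have h1 := F.contDiffAt_of_contDiffOn hy F.smooth_η₁
  have h2 := F.contDiffAt_of_contDiffOn hy F.smooth_η₂
  have h3 := F.contDiffAt_of_contDiffOn hy F.smooth_π₁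
  have h4 := F.contDiffAt_of_contDiffOn hy F.smooth_π₂
  have hk := F.contDiffAt_of_contDiffOn hy F.smooth_k
  fin_cases i
  · exact h3.add ((contDiffAt_const.mul hk).smul h2)
  · exact h4.add ((contDiffAt_const.mul hk).smul h1)

/-- Since c and k are nonzero, half sums and differences of the four forms recover η₁, η₂, π₁, π₂.
All values on the family can thus be prescribed, which yields dual vectors and independence. -/
lemma linearIndependent_singular (F : IsAdaptedFrame N θ η₁ η₂ π₁ π₂ k p q h) (hy : y ∈ N) {c : ℂ}
    (hc : c ≠ 0) : LinearIndependent ℂ (Sum.elim (fun i => θ i y) (Sum.elim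
      (fun i => singularForms η₁ η₂ π₁ π₂ k c i y)
      (fun i => singularForms η₁ η₂ π₁ π₂ k (-c) i y))) := by
  have hk := F.k_ne_zero y hy
  have H : ∀ g : (Fin 4 ⊕ (Fin 2 ⊕ Fin 2)) → ℂ, ∃ Z : E × E, ∀ j, evC ((Sum.elim (fun i => θ i y)
      (Sum.elim (fun i => singularForms η₁ η₂ π₁ π₂ k c i y)
      (fun i => singularForms η₁ η₂ π₁ π₂ k (-c) i y))) j) Z = g j := by
    intro g
    obtain ⟨Z, hZ⟩ := exists_evC_eq (F.indep y hy) ![g (.inl 0), g (.inl 1), g (.inl 2), g (.inl 3),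
      (g (.inr (.inl 1)) - g (.inr (.inr 1))) / (2 * c * k y),
      (g (.inr (.inr 0)) - g (.inr (.inl 0))) / (2 * c * k y),
      (g (.inr (.inr 0)) + g (.inr (.inl 0))) / 2, (g (.inr (.inl 1)) + g (.inr (.inr 1))) / 2]
    have h0 := hZ 0
    have h1 := hZ 1
    have h2 := hZ 2
    have h3 := hZ 3
    have h4 := hZ 4
    have h5 := hZ 5
    have h6 := hZ 6
    have h7 := hZ 7
    simp only [Matrix.cons_val] at h0 h1 h2 h3 h4 h5 h6 h7
    refine ⟨Z, ?_⟩
    rintro (i | i | i)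
    · fin_cases i
      exacts [h0, h1, h2, h3]
    · fin_cases i
      · change evC (π₁ y + (-c * k y) • η₂ y) Z = _
        rw [evC_add, evC_smul, h6, h5]
        field_simp
        simp
        ring
      · change evC (π₂ y + (c * k y) • η₁ y) Z = _
        rw [evC_add, evC_smul, h7, h4]
        field_simp
        simp
        ring
    · fin_cases i
      · change evC (π₁ y + (-(-c) * k y) • η₂ y) Z = _
        rw [evC_add, evC_smul, h6, h5]
        field_simp
        simp
        ring
      · change evC (π₂ y + (-c * k y) • η₁ y) Z = _
        rw [evC_add, evC_smul, h7, h4]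
        field_simp
        simp
        ring
  classical
  rw [Fintype.linearIndependent_iff]
  intro a ha i
  obtain ⟨Z, hZ⟩ := H (Pi.single i 1)
  have := congrArg (fun α => evC α Z) ha
  simp only [evC_sum, evC_smul, hZ, evC_zero] at this
  simpa [Pi.single_apply] using this

/-- On vectors annihilated by the Pfaffian forms, the two-forms of the singular systems are
combinations of the derivatives of the Pfaffian forms. -/
lemma evTwo_singular (F : IsAdaptedFrame N θ η₁ η₂ π₁ π₂ k p q h) (hy : y ∈ N) {c : ℂ}
    (hc : c ^ 2 = -1) {Z Z' : E × E} (hZ : ∀ i, evC (θ i y) Z = 0)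
    (hZ' : ∀ i, evC (θ i y) Z' = 0) (h0 : evTwo (extD (θ 0) y) Z Z' = 0)
    (h3 : evTwo (extD (θ 3) y) Z Z' = 0) :
    evC (singularForms η₁ η₂ π₁ π₂ k c 0 y) Z * evC (singularForms η₁ η₂ π₁ π₂ k c 1 y) Z'
      = evC (singularForms η₁ η₂ π₁ π₂ k c 0 y) Z'
        * evC (singularForms η₁ η₂ π₁ π₂ k c 1 y) Z := by
  obtain ⟨d0, -, -, d3, -⟩ := F.evTwo_extD_values hy Z Z'
  rw [h0, hZ, hZ', hZ, hZ'] at d0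
  rw [h3] at d3
  change evC (π₁ y + (-c * k y) • η₂ y) Z * evC (π₂ y + (c * k y) • η₁ y) Z'
    = evC (π₁ y + (-c * k y) • η₂ y) Z' * evC (π₂ y + (c * k y) • η₁ y) Z
  simp only [evC_add, evC_smul]
  -- For c² = -1 the product (π₁ - ckη₂) ∧ (π₂ + ckη₁) equals -(dθ₃ + ck dθ₀) on vectors annihilated
  -- by θ.
  linear_combination d3 + c * k y * d0 + (k y ^ 2 * (evC (η₁ y) Z * evC (η₂ y) Z'
    - evC (η₁ y) Z' * evC (η₂ y) Z)) * hc

end IsAdaptedFrame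

end Singular

end DarbouxEmbedding

end

noncomputable section

namespace DarbouxEmbedding

/-! ### Identification of a given decomposition with the singular systems -/

section Singular

variable {E : Type*} [NormedAddCommGroup E] [NormedSpace ℝ E]

namespace IsAdaptedFrame

variable {N : Set E} {θ : Fin 4 → E → E →L[ℝ] ℂ} {η₁ η₂ π₁ π₂ : E → E →L[ℝ] ℂ}
  {k p q h : E → ℂ} {y : E}

/-- The two systems of a decomposition coincide with the two singular systems. -/
lemma decomposition_eq_singular (F : IsAdaptedFrame N θ η₁ η₂ π₁ π₂ k p q h) (hy : y ∈ N)
    {σ τ : Fin 2 → E →L[ℝ] ℂ}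
    (hind : LinearIndependent ℂ (Sum.elim (fun i => θ i y) (Sum.elim σ τ)))
    (h03 : ∀ Z Z', (∀ i, evC (θ i y) Z = 0) → (∀ i, evC (θ i y) Z' = 0) →
      (∀ a, evC (τ a) Z = 0) → (∀ a, evC (σ a) Z' = 0) →
      evTwo (extD (θ 0) y) Z Z' = 0 ∧ evTwo (extD (θ 3) y) Z Z' = 0) :
    ∃ c : ℂ, (c = Complex.I ∨ c = -Complex.I) ∧
      (∀ Z, (∀ i, evC (θ i y) Z = 0) → (∀ j, evC (singularForms η₁ η₂ π₁ π₂ k c j y) Z = 0) →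
        ∀ a, evC (σ a) Z = 0) ∧
      (∀ Z, (∀ i, evC (θ i y) Z = 0) → (∀ j, evC (singularForms η₁ η₂ π₁ π₂ k (-c) j y) Z = 0) →
        ∀ a, evC (τ a) Z = 0) := by
  have hfin : ∀ Θ : (Fin 4 ⊕ (Fin 2 ⊕ Fin 2)) → E →L[ℝ] ℂ, LinearIndependent ℂ Θ →
      Submodule.span ℂ (Set.range Θ) = ⊤ := fun Θ h =>
    h.span_eq_top_of_card_eq_finrank (by simp [F.finrank_eq])
  have swap : ∀ (a b : Fin 2 → E →L[ℝ] ℂ),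
      LinearIndependent ℂ (Sum.elim (fun i => θ i y) (Sum.elim a b)) →
      LinearIndependent ℂ (Sum.elim (fun i => θ i y) (Sum.elim b a)) := by
    intro a b h
    have := h.comp (Equiv.sumCongr (Equiv.refl (Fin 4)) (Equiv.sumComm (Fin 2) (Fin 2)))
      (Equiv.injective _)
    convert this using 1
    funext i
    rcases i with i | i | i <;> rfl
  have hI : Complex.I ≠ 0 := Complex.I_ne_zero
  have hs := F.linearIndependent_singular hy hI
  have hs' := F.linearIndependent_singular hy (neg_ne_zero.mpr hI)
  have hspan := hfin _ hind
  have hV : ∀ c : ℂ, c ^ 2 = -1 → ∀ Z Z', (∀ i, evC (θ i y) Z = 0) → (∀ i, evC (θ i y) Z' = 0) →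
      (∀ a, evC (τ a) Z = 0) → (∀ a, evC (σ a) Z' = 0) →
      evC (singularForms η₁ η₂ π₁ π₂ k c 0 y) Z * evC (singularForms η₁ η₂ π₁ π₂ k c 1 y) Z'
      = evC (singularForms η₁ η₂ π₁ π₂ k c 0 y) Z'
        * evC (singularForms η₁ η₂ π₁ π₂ k c 1 y) Z := by
    intro c hc Z Z' hZ hZ' hτ hσ
    obtain ⟨e0, e3⟩ := h03 Z Z' hZ hZ' hτ hσ
    exact F.evTwo_singular hy hc hZ hZ' e0 e3
  -- The forms with c = i and c = -i together with θ span all covectors, so no nonzero vector is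
  -- annihilated by all of them.
  have hne : ∀ (ξ : Fin 2 → E →L[ℝ] ℂ), (∃ Z : E × E, (∀ i, evC (θ i y) Z = 0) ∧
      (∀ a, evC (ξ a) Z = 0) ∧ ∃ α : E →L[ℝ] ℂ, evC α Z ≠ 0) →
      (∀ Z, (∀ i, evC (θ i y) Z = 0) → (∀ a, evC (ξ a) Z = 0) →
        ∀ j, evC (singularForms η₁ η₂ π₁ π₂ k Complex.I j y) Z = 0) →
      (∀ Z, (∀ i, evC (θ i y) Z = 0) → (∀ a, evC (ξ a) Z = 0) →
        ∀ j, evC (singularForms η₁ η₂ π₁ π₂ k (-Complex.I) j y) Z = 0) → False := by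
    rintro ξ ⟨Z, hZ, hξ, α, hα⟩ h1 h2
    refine hα ?_
    have hm : α ∈ Submodule.span ℂ (Set.range (Sum.elim (fun i => θ i y) (Sum.elim
        (fun i => singularForms η₁ η₂ π₁ π₂ k Complex.I i y)
        (fun i => singularForms η₁ η₂ π₁ π₂ k (-Complex.I) i y)))) :=
      hfin _ hs ▸ Submodule.mem_top
    refine evC_eq_zero_of_mem_span hm ?_
    rintro _ ⟨i | i | i, rfl⟩
    exacts [hZ i, h1 Z hZ hξ i, h2 Z hZ hξ i]
  have hnσ := hne σ (by
    obtain ⟨D, hD⟩ := exists_dual hind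
    refine ⟨D (.inr (.inr 0)), fun i => by simpa using hD (.inr (.inr 0)) (.inl i),
      fun i => by simpa using hD (.inr (.inr 0)) (.inr (.inl i)), τ 0, ?_⟩
    have : evC (τ 0) (D (.inr (.inr 0))) = 1 := by simpa using hD (.inr (.inr 0)) (.inr (.inr 0))
    rw [this]
    exact one_ne_zero)
  have hnτ := hne τ (by
    obtain ⟨D, hD⟩ := exists_dual hind
    refine ⟨D (.inr (.inl 0)), fun i => by simpa using hD (.inr (.inl 0)) (.inl i),
      fun i => by simpa using hD (.inr (.inl 0)) (.inr (.inr i)), σ 0, ?_⟩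
    have : evC (σ 0) (D (.inr (.inl 0))) = 1 := by simpa using hD (.inr (.inl 0)) (.inr (.inl 0))
    rw [this]
    exact one_ne_zero)
  have hind' := swap _ _ hind
  have hspan' := hfin _ hind'
  have hs2 := swap _ _ hs
  -- Each of the two pairs of singular forms vanishes on the plane of σ or on that of τ. Both on the
  -- same plane is excluded; the two mixed cases give c = i and c = -i.
  rcases vanishing_or_vanishing hind hspan hs (hV Complex.I Complex.I_sq) with h1 | h1 <;>
  rcases vanishing_or_vanishing hind hspan hs2
    (hV (-Complex.I) (by linear_combination Complex.I_sq)) with h2 | h2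
  · exact absurd (hnσ h1 h2) id
  · refine ⟨Complex.I, Or.inl rfl, ?_, ?_⟩
    · exact fun Z hZ hZs a => evC_eq_zero_of_vanishing hind hspan (hfin _ hs) h1 h2 Z hZ hZs a
    · exact fun Z hZ hZs a => evC_eq_zero_of_vanishing hind' hspan' (hfin _ hs2) h2 h1 Z hZ hZs a
  · refine ⟨-Complex.I, Or.inr rfl, ?_, ?_⟩
    · exact fun Z hZ hZs a => evC_eq_zero_of_vanishing hind hspan (hfin _ hs2) h2 h1 Z hZ hZs a
    · intro Z hZ hZs a
      rw [neg_neg] at hZs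
      exact evC_eq_zero_of_vanishing hind' hspan' (hfin _ hs) h1 h2 Z hZ hZs a
  · exact absurd (hnτ h1 h2) id

/-- Being contained in the singular system with parameter `c` is an open condition for a system
which is everywhere contained in one of the two singular systems. -/
lemma eventually_vanishing (F : IsAdaptedFrame N θ η₁ η₂ π₁ π₂ k p q h) (hy : y ∈ N)
    {σ : Fin 2 → E → E →L[ℝ] ℂ} (hσ : ContDiffAt ℝ ∞ (σ 0) y) {c : ℂ} (hc : c ≠ 0)
    (hnot : ∃ Z : E × E, (∀ i, evC (θ i y) Z = 0) ∧ evC (σ 0 y) Z ≠ 0)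
    (hvan : ∀ Z, (∀ i, evC (θ i y) Z = 0) →
      (∀ j, evC (singularForms η₁ η₂ π₁ π₂ k c j y) Z = 0) → evC (σ 0 y) Z = 0) :
    ∀ᶠ z in 𝓝 y, ¬ ∀ Z, (∀ i, evC (θ i z) Z = 0) →
      (∀ j, evC (singularForms η₁ η₂ π₁ π₂ k (-c) j z) Z = 0) → evC (σ 0 z) Z = 0 := by
  set Θ : (Fin 4 ⊕ (Fin 2 ⊕ Fin 2)) → E → E →L[ℝ] ℂ := Sum.elim θ
    (Sum.elim (singularForms η₁ η₂ π₁ π₂ k c) (singularForms η₁ η₂ π₁ π₂ k (-c))) with hΘ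
  have hfun : ∀ z, (fun i => Θ i z) = Sum.elim (fun i => θ i z) (Sum.elim
      (fun i => singularForms η₁ η₂ π₁ π₂ k c i z)
      (fun i => singularForms η₁ η₂ π₁ π₂ k (-c) i z)) := by
    intro z; funext i
    rcases i with i | i | i <;> rfl
  have hind : LinearIndependent ℂ fun i => Θ i y := by
    rw [hfun]; exact F.linearIndependent_singular hy hc
  have hsm : ∀ i, ContDiffAt ℝ ∞ (Θ i) y := by
    rintro (i | i | i)
    · exact F.contDiffAt_of_contDiffOn hy (F.smooth_θ i)
    · exact F.contDiffAt_singularForms hy _ i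
    · exact F.contDiffAt_singularForms hy _ i
  obtain ⟨f, hf, hfy⟩ := exists_coeff hsm hσ hind
    (hind.span_eq_top_of_card_eq_finrank (by simp [F.finrank_eq]))
  -- At y the form σ 0 is a combination of θ and the c-forms, and it is not a combination of θ
  -- alone. So some coefficient along a c-form is nonzero, and it stays nonzero nearby; this keeps σ
  -- 0 out of the span of θ and the (-c)-forms.
  have hcoef : ∃ j : Fin 2, f y (.inr (.inl j)) ≠ 0 := by
    by_contra hall
    push Not at hall
    obtain ⟨Z, hZ, hne⟩ := hnot
    obtain ⟨W, hW⟩ := exists_evC_eq hind (fun i => Sum.elim (fun _ => 0)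
      (Sum.elim (fun _ => 0) fun j => evC (singularForms η₁ η₂ π₁ π₂ k (-c) j y) Z) i)
    have hW0 := hvan W (fun i => hW (.inl i)) (fun j => hW (.inr (.inl j)))
    apply hne
    rw [← hW0, hfy.self_of_nhds.1, evC_sum, evC_sum, Fintype.sum_sum_type, Fintype.sum_sum_type,
      Fintype.sum_sum_type, Fintype.sum_sum_type]
    simp only [evC_smul, hall, zero_mul, Finset.sum_const_zero, hW]
    have e1 : ∀ i, evC (Θ (.inl i) y) Z = 0 := hZ
    have e2 : ∀ i, evC (Θ (.inr (.inr i)) y) Z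
        = evC (singularForms η₁ η₂ π₁ π₂ k (-c) i y) Z := fun _ => rfl
    simp only [e1, e2, Sum.elim_inl, Sum.elim_inr, mul_zero, Finset.sum_const_zero, zero_add]
  obtain ⟨j, hj⟩ := hcoef
  have hne := (contDiffAt_pi.mp hf (.inr (.inl j))).continuousAt.eventually_ne hj
  filter_upwards [hne, hfy] with z hz hfz hall
  obtain ⟨D, hD⟩ := exists_dual hfz.2
  have h0 := hall (D (.inr (.inl j)))
    (fun i => (hD (.inr (.inl j)) (.inl i)).trans (by simp))
    (fun i => (hD (.inr (.inl j)) (.inr (.inr i))).trans (by simp))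
  rw [hfz.1, evC_sum] at h0
  simp only [evC_smul, hD] at h0
  simp at h0
  exact hz h0

/-- The correction terms in f₁ and f₂ involve only θ, so the first six flag forms span the same
space as θ and the singular forms for c = i. The vectors dual to f₆ and f₇ are killed by all of
these, which excludes the last two coefficients. -/
lemma mem_span_six (F : IsAdaptedFrame N θ η₁ η₂ π₁ π₂ k p q h) (hy : y ∈ N)
    {α : E →L[ℝ] ℂ} (hα : ∀ Z, (∀ i, evC (θ i y) Z = 0) →
      (∀ j, evC (singularForms η₁ η₂ π₁ π₂ k Complex.I j y) Z = 0) → evC α Z = 0) :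
    α ∈ Submodule.span ℂ ((fun i => flagCoframe θ η₁ η₂ π₁ π₂ k p q h i y) '' {i | i < 6}) := by
  have hm : α ∈ Submodule.span ℂ (Set.range fun i => flagCoframe θ η₁ η₂ π₁ π₂ k p q h i y) :=
    F.span_flagCoframe hy ▸ Submodule.mem_top
  obtain ⟨c, rfl⟩ := (Submodule.mem_span_range_iff_exists_fun ℂ).mp hm
  have key : ∀ n : Fin 8, 6 ≤ n → c n = 0 := by
    intro n hn
    obtain ⟨Z, hZ, a0, a1, a2, a3, -⟩ := F.exists_evC_flagCoframe hy (Pi.single n 1)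
    have hz : ∀ i : Fin 8, i < 6 → (Pi.single n 1 : Fin 8 → ℂ) i = 0 := fun i hi =>
      Pi.single_eq_of_ne (ne_of_lt (lt_of_lt_of_le hi hn)) _
    rw [hz 5 (by decide)] at a0
    rw [hz 3 (by decide)] at a1
    rw [hz 4 (by decide)] at a2
    rw [hz 0 (by decide), hz 5 (by decide), hz 3 (by decide)] at a3
    have h1 := hZ 1
    have h2 := hZ 2
    rw [hz 1 (by decide)] at h1
    rw [hz 2 (by decide)] at h2
    have h1' : evC (π₁ y + ((-Complex.I * k y) • η₂ y
      + (-Complex.I * ((k y ^ 2 - p y * h y) / (2 * k y))) • θ 2 y)) Z = 0 := h1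
    have h2' : evC (π₂ y + ((Complex.I * k y) • η₁ y + ((Complex.I * (p y / k y)) • θ 3 y
      + (Complex.I * ((k y ^ 2 + 3 * p y ^ 2 - q y) / (2 * k y))) • θ 1 y))) Z = 0 := h2
    simp only [evC_add, evC_smul, a0, a1, a2, a3] at h1' h2'
    have := hα Z (by
      intro i
      fin_cases i
      · exact a0
      · exact a1
      · exact a2
      · simpa using a3) (by
      intro j
      fin_cases j
      · change evC (π₁ y + (-Complex.I * k y) • η₂ y) Z = 0
        rw [evC_add, evC_smul]
        linear_combination h1'
      · change evC (π₂ y + (Complex.I * k y) • η₁ y) Z = 0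
        rw [evC_add, evC_smul]
        linear_combination h2')
    rw [evC_sum] at this
    simpa [evC_smul, hZ, Pi.single_apply] using this
  exact sum_mem_span_flagCoframe key

/-- The geometric content of Darboux integrability. -/
theorem mul_eq_sq_of_isDarbouxIntegrableNear (F : IsAdaptedFrame N θ η₁ η₂ π₁ π₂ k p q h) {x : E}
    (hx : x ∈ N) {ϑ : Fin 4 → E → E →L[ℝ] ℂ} (h0 : ϑ 0 = θ 0) (h3 : ϑ 3 = θ 3)
    (hann : ∀ y ∈ N, ∀ Z, (∀ i, evC (ϑ i y) Z = 0) ↔ ∀ i, evC (θ i y) Z = 0)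
    (hD : IsDarbouxIntegrableNear ϑ x) : ∀ᶠ y in 𝓝 x, p y * h y = k y ^ 2 := by
  obtain ⟨N', m, n, s, t, σ, τ, Ω₁, Ω₂, hN', hxN', H, -, -, hP⟩ := hD
  -- Eight dimensions leave room for four forms besides the generators, so each family, having at
  -- least two members, has exactly two.
  have hle : 4 + (m + n) ≤ 8 := by
    have hfd : FiniteDimensional ℂ (E →L[ℝ] ℂ) :=
      FiniteDimensional.of_finrank_pos (by rw [F.finrank_eq]; norm_num)
    have := (H.indep x hxN').fintype_card_le_finrank
    simpa [F.finrank_eq] using this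
  obtain rfl : m = 2 := by have := H.two_le_p; have := H.two_le_q; omega
  obtain rfl : n = 2 := by have := H.two_le_q; omega
  filter_upwards [F.isOpen.mem_nhds hx, hN'.mem_nhds hxN'] with y hy hy'
  -- Independence passes from ϑ to θ because both families have the same annihilator: dual vectors
  -- of the first kill the σ, τ coefficients, those of an adapted coframe the rest.
  have hind : ∀ z ∈ N, z ∈ N' → LinearIndependent ℂ (Sum.elim (fun i => θ i z)
      (Sum.elim (fun a => σ a z) (fun a => τ a z))) := by
    intro z hz hz'
    classical
    obtain ⟨D, hD⟩ := exists_dual (H.indep z hz')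
    obtain ⟨D', hD'⟩ := exists_dual (F.linearIndependent_singular hz Complex.I_ne_zero)
    rw [Fintype.linearIndependent_iff]
    intro c hc
    have e : ∀ Z, evC (∑ i, c i • Sum.elim (fun i => θ i z)
      (Sum.elim (fun a => σ a z) (fun a => τ a z)) i) Z = 0 := fun Z => by rw [hc, evC_zero]
    simp only [Fintype.sum_sum_type, Sum.elim_inl, Sum.elim_inr, evC_add, evC_sum, evC_smul] at e
    have e1 : ∀ a, c (.inr a) = 0 := by
      intro a
      have := e (D (.inr a))
      have hθ := (hann z hz (D (.inr a))).mp fun i => by simpa using hD (.inr a) (.inl i)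
      have h1 : ∀ b, evC (σ b z) (D (.inr a)) = if Sum.inl b = a then 1 else 0 := fun b => by
        simpa using hD (.inr a) (.inr (.inl b))
      have h2 : ∀ b, evC (τ b z) (D (.inr a)) = if Sum.inr b = a then 1 else 0 := fun b => by
        simpa using hD (.inr a) (.inr (.inr b))
      rcases a with a | a <;> simpa [hθ, h1, h2] using this
    rintro (i | a)
    · have := e (D' (.inl i))
      have hθ : ∀ j, evC (θ j z) (D' (.inl i)) = if j = i then 1 else 0 := fun j => by
        simpa using hD' (.inl i) (.inl j)
      simpa [e1, hθ] using this
    · exact e1 a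
  have hdich : ∀ z ∈ N, z ∈ N' → ∃ c : ℂ, (c = Complex.I ∨ c = -Complex.I) ∧
      (∀ Z, (∀ i, evC (θ i z) Z = 0) → (∀ j, evC (singularForms η₁ η₂ π₁ π₂ k c j z) Z = 0) →
        ∀ a, evC (σ a z) Z = 0) ∧
      (∀ Z, (∀ i, evC (θ i z) Z = 0) → (∀ j, evC (singularForms η₁ η₂ π₁ π₂ k (-c) j z) Z = 0) →
        ∀ a, evC (τ a z) Z = 0) := by
    intro z hz hz'
    refine F.decomposition_eq_singular hz (hind z hz hz') ?_
    intro Z Z' hZ hZ' hτ hσ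
    have hZ := (hann z hz Z).mpr hZ
    have hZ' := (hann z hz Z').mpr hZ'
    rw [← h0, ← h3]
    exact ⟨H.evTwo_extD_eq_zero hz' 0 hZ hZ' hτ hσ, H.evTwo_extD_eq_zero hz' 3 hZ hZ' hτ hσ⟩
  obtain ⟨c, hc, hcσ, hcτ⟩ := hdich y hy hy'
  have hc0 : c ≠ 0 := by
    rcases hc with rfl | rfl <;> simp
  have hnot : ∃ Z : E × E, (∀ i, evC (θ i y) Z = 0) ∧ evC (σ 0 y) Z ≠ 0 := by
    obtain ⟨D, hD⟩ := exists_dual (hind y hy hy')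
    refine ⟨D (.inr (.inl 0)), fun i => by simpa using hD (.inr (.inl 0)) (.inl i), ?_⟩
    have : evC (σ 0 y) (D (.inr (.inl 0))) = 1 := by simpa using hD (.inr (.inl 0)) (.inr (.inl 0))
    rw [this]
    exact one_ne_zero
  have hopen := F.eventually_vanishing hy ((H.smooth_σ₁ 0).contDiffAt (hN'.mem_nhds hy')) hc0 hnot
    (fun Z h1 h2 => hcσ Z h1 h2 0)
  -- The choice of sign c, made pointwise, is constant near y. This is needed because derived
  -- systems depend on the spaces in a neighbourhood.
  have hnear : ∀ᶠ z in 𝓝 y, z ∈ N ∧ (∀ Z, (∀ i, evC (θ i z) Z = 0) →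
      (∀ j, evC (singularForms η₁ η₂ π₁ π₂ k c j z) Z = 0) → ∀ a, evC (σ a z) Z = 0) ∧
      (∀ Z, (∀ i, evC (θ i z) Z = 0) → (∀ j, evC (singularForms η₁ η₂ π₁ π₂ k (-c) j z) Z = 0) →
        ∀ a, evC (τ a z) Z = 0) := by
    filter_upwards [hopen, F.isOpen.mem_nhds hy, hN'.mem_nhds hy'] with z hz hzN hzN'
    obtain ⟨d, hd, hdσ, hdτ⟩ := hdich z hzN hzN'
    have hdc : d = c := by
      by_contra hne
      have : d = -c := by
        rcases hd with rfl | rfl <;> rcases hc with rfl | rfl <;> simp at hne ⊢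
      subst this
      exact hz fun Z h1 h2 => hdσ Z h1 h2 0
    subst hdc
    exact ⟨hzN, hdσ, hdτ⟩
  have hspan : ∀ z ∈ N, ∀ ξ : Fin 2 → E → E →L[ℝ] ℂ, ∀ d : ℂ,
      (∀ Z, (∀ i, evC (θ i z) Z = 0) →
        (∀ j, evC (singularForms η₁ η₂ π₁ π₂ k d j z) Z = 0) → ∀ a, evC (ξ a z) Z = 0) →
      ∀ α ∈ spanAt ϑ z ⊔ spanAt ξ z, ∀ Z, (∀ i, evC (θ i z) Z = 0) →
        (∀ j, evC (singularForms η₁ η₂ π₁ π₂ k d j z) Z = 0) → evC α Z = 0 := by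
    intro z hz ξ d hξ α hα Z h1 h2
    rw [spanAt, spanAt, ← Submodule.span_union] at hα
    refine evC_eq_zero_of_mem_span hα ?_
    rintro _ (⟨i, rfl⟩ | ⟨a, rfl⟩)
    · exact (hann z hz Z).mpr h1 i
    · exact hξ Z h1 h2 a
  have hsing : ∀ Z : E × E, evC (π₁ y + (Complex.I * k y) • η₂ y) Z = 0 →
      evC (π₂ y + (-Complex.I * k y) • η₁ y) Z = 0 →
      ∀ j, evC (singularForms η₁ η₂ π₁ π₂ k (-Complex.I) j y) Z = 0 := by
    intro Z h1 h2 j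
    fin_cases j
    · change evC (π₁ y + (-(-Complex.I) * k y) • η₂ y) Z = 0
      rwa [neg_neg]
    · exact h2
  -- The flag was computed for c = i. If σ spans the system with c = -i, the roles of σ and τ are
  -- exchanged and the other spanning condition of the Darboux pair is used.
  rcases hc with rfl | rfl
  · refine F.mul_eq_sq_of_transversal hy (V := fun z => spanAt ϑ z ⊔ spanAt σ z)
      (T := spanAt ϑ y ⊔ spanAt τ y) ?_ ?_ (hP.limit_sup y hy')
    · filter_upwards [hnear] with z hz α hα
      exact F.mem_span_six hz.1 (hspan z hz.1 σ _ hz.2.1 α hα)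
    · intro α hα Z h1 h2 h3
      exact hspan y hy τ _ hcτ α hα Z h1 (hsing Z h2 h3)
  · refine F.mul_eq_sq_of_transversal hy (V := fun z => spanAt ϑ z ⊔ spanAt τ z)
      (T := spanAt ϑ y ⊔ spanAt σ y) ?_ ?_ (hP.sup_limit y hy')
    · filter_upwards [hnear] with z hz α hα
      have := hz.2.2
      rw [neg_neg] at this
      exact F.mem_span_six hz.1 (hspan z hz.1 τ _ this α hα)
    · intro α hα Z h1 h2 h3
      exact hspan y hy σ _ hcσ α hα Z h1 (hsing Z h2 h3)

end IsAdaptedFrame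

end Singular

end DarbouxEmbedding

end

noncomputable section

namespace DarbouxEmbedding

/-! ## The structure equations of the frame bundle of Minkowski space -/

lemma minkowski_apply (x v : Fin 3 → ℝ) :
    minkowski x v = x 0 * v 0 - x 1 * v 1 - x 2 * v 2 := by
  simp [minkowski]

/-- Orthonormality reads A J Aᵀ = J, so J Aᵀ J is a right inverse of the frame matrix A and hence a
left inverse. The resulting completeness relations J Aᵀ J A = 1 are the expansion in the frame. -/
lemma minkowski_eq_sum {f : PointFrame} (hf : f ∈ minkowskiFrames) (v w : Fin 3 → ℝ) :
    minkowski v w = ∑ i, frameSign i * (minkowski (f.2 i) v * minkowski (f.2 i) w) := by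
  set A : Matrix (Fin 3) (Fin 3) ℝ := Matrix.of f.2
  set J : Matrix (Fin 3) (Fin 3) ℝ := Matrix.diagonal frameSign with hJ
  have h1 : A * (J * A.transpose * J) = 1 := by
    have h : A * J * A.transpose = J := by
      ext i j
      have := hf.1 i j
      rw [minkowski_apply] at this
      simp only [hJ, Matrix.mul_apply, Fin.sum_univ_three, Matrix.mul_diagonal,
        Matrix.transpose_apply, Matrix.diagonal_apply, A, Matrix.of_apply]
      rw [← this]
      simp [frameSign]
      ring
    have hJJ : J * J = 1 := by
      rw [hJ, Matrix.diagonal_mul_diagonal, ← Matrix.diagonal_one]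
      congr 1
      funext i
      fin_cases i <;> simp [frameSign]
    rw [← mul_assoc, ← mul_assoc, h, hJJ]
  have h2 := mul_eq_one_comm.mp h1
  have h3 : ∀ a b, (∑ i, frameSign a * f.2 i a * frameSign i * f.2 i b) = if a = b then 1 else 0 := by
    intro a b
    have := congrFun (congrFun h2 a) b
    simp only [Matrix.one_apply] at this
    rw [← this, Matrix.mul_apply]
    refine Finset.sum_congr rfl fun i _ => ?_
    simp [hJ, Matrix.mul_diagonal, Matrix.diagonal_mul, A]
  simp only [Fin.sum_univ_three, frameSign] at h3 ⊢
  have h00 := h3 0 0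
  have h01 := h3 0 1
  have h02 := h3 0 2
  have h11 := h3 1 1
  have h12 := h3 1 2
  have h22 := h3 2 2
  simp at h00 h01 h02 h11 h12 h22
  simp only [minkowski_apply, Matrix.cons_val_zero, Matrix.cons_val_one, Matrix.cons_val]
  linear_combination (-v 0 * w 0) * h00 + (v 0 * w 1 + v 1 * w 0) * h01
    + (v 0 * w 2 + v 2 * w 0) * h02 + v 1 * w 1 * h11 + v 2 * w 2 * h22
    + (v 1 * w 2 + v 2 * w 1) * h12

lemma eq_zero_of_minkowski_eq_zero {f : PointFrame} (hf : f ∈ minkowskiFrames) {v : Fin 3 → ℝ}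
    (h : ∀ i, minkowski (f.2 i) v = 0) : v = 0 := by
  have h' : ∀ w, minkowski v w = 0 := fun w => by rw [minkowski_eq_sum hf]; simp [h]
  funext i
  have := h' (Pi.single i 1)
  fin_cases i <;> simpa [minkowski_apply] using this

/-- The identity d⟨f, dg⟩ = ⟨df ∧ dg⟩, a consequence of d(dg) = 0 for each component. -/
lemma extD_minkowski_comp {E : Type*} [NormedAddCommGroup E] [NormedSpace ℝ E]
    {f g : E → Fin 3 → ℝ} {x : E} (s : ℝ) (hf : DifferentiableAt ℝ f x) (hg : ContDiffAt ℝ ∞ g x)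
    (u v : E) :
    extD (fun z => s • (minkowski (f z)).comp (fderiv ℝ g z)) x u v
      = s * (minkowski (fderiv ℝ f x u) (fderiv ℝ g x v)
        - minkowski (fderiv ℝ f x v) (fderiv ℝ g x u)) := by
  have hgi : ∀ i, ContDiffAt ℝ ∞ (fun z => g z i) x := contDiffAt_pi.mp hg
  have hev : (fun z => s • (minkowski (f z)).comp (fderiv ℝ g z)) =ᶠ[𝓝 x]
      fun z => (s * f z 0) • fderiv ℝ (fun z => g z 0) z
        - (s * f z 1) • fderiv ℝ (fun z => g z 1) z - (s * f z 2) • fderiv ℝ (fun z => g z 2) z := by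
    have : ∀ᶠ z in 𝓝 x, ContDiffAt ℝ 1 g z :=
      (hg.of_le (by norm_cast)).eventually (by simp)
    filter_upwards [this] with z hz
    have hd := hz.differentiableAt (by simp)
    have hi : ∀ i w, fderiv ℝ (fun z => g z i) z w = fderiv ℝ g z w i := by
      intro i w
      rw [fderiv_apply (𝕜 := ℝ) hd]
      rfl
    ext w
    simp [minkowski_apply, hi]
    ring
  have hfi : ∀ i, DifferentiableAt ℝ (fun z => f z i) x := fun i => differentiableAt_pi.mp hf i
  have hd : ∀ i, DifferentiableAt ℝ (fderiv ℝ fun z => g z i) x := fun i =>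
    ((hgi i).fderiv_right (m := 1) (by norm_cast)).differentiableAt (by simp)
  have h2 : ∀ i, extD (fderiv ℝ fun z => g z i) x u v = 0 := fun i =>
    extD_fderiv ((hgi i).of_le (by norm_cast)) u v
  have hgd : ∀ i w, fderiv ℝ (fun z => g z i) x w = fderiv ℝ g x w i := by
    intro i w
    rw [fderiv_apply (𝕜 := ℝ) (hg.differentiableAt (by simp))]
    rfl
  have hfd : ∀ i w, fderiv ℝ (fun z => s * f z i) x w = s * fderiv ℝ f x w i := by
    intro i w
    rw [fderiv_const_mul (hfi i), fderiv_apply (𝕜 := ℝ) hf]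
    rfl
  have hsm : ∀ i, DifferentiableAt ℝ (fun z => (s * f z i) • fderiv ℝ (fun z => g z i) z) x :=
    fun i => ((hfi i).const_mul s).smul (hd i)
  have h01 : DifferentiableAt ℝ (fun z => (s * f z 0) • fderiv ℝ (fun z => g z 0) z
      - (s * f z 1) • fderiv ℝ (fun z => g z 1) z) x := (hsm 0).sub (hsm 1)
  rw [extD_congr hev, extD_fun_sub h01 (hsm 2), extD_fun_sub (hsm 0) (hsm 1)]
  simp only [extD_fun_smul ((hfi _).const_mul s) (hd _), h2, hfd, hgd, minkowski_apply]
  ring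

namespace IsFrameParametrization

variable {W : Set FrameCoord} {Ψ : FrameCoord → PointFrame} {w : FrameCoord}

lemma contDiffAt (P : IsFrameParametrization W Ψ) (hw : w ∈ W) : ContDiffAt ℝ ∞ Ψ w :=
  P.smooth.contDiffAt (P.isOpen.mem_nhds hw)

lemma contDiffAt_fst (P : IsFrameParametrization W Ψ) (hw : w ∈ W) :
    ContDiffAt ℝ ∞ (fun z => (Ψ z).1) w := (P.contDiffAt hw).fst

lemma contDiffAt_snd (P : IsFrameParametrization W Ψ) (hw : w ∈ W) (i : Fin 3) :
    ContDiffAt ℝ ∞ (fun z => (Ψ z).2 i) w := contDiffAt_pi.mp (P.contDiffAt hw).snd i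

lemma contDiffAt_form (P : IsFrameParametrization W Ψ) (hw : w ∈ W) (i : Fin 3)
    {g : FrameCoord → Fin 3 → ℝ} (hg : ContDiffAt ℝ ∞ g w) :
    ContDiffAt ℝ ∞ (fun z => frameSign i • (minkowski ((Ψ z).2 i)).comp (fderiv ℝ g z)) w := by
  have hm : ContDiffAt ℝ ∞ (fun z => minkowski ((Ψ z).2 i)) w := by
    have h : ∀ j, ContDiffAt ℝ ∞ (fun z => (Ψ z).2 i j) w :=
      contDiffAt_pi.mp (P.contDiffAt_snd hw i)
    exact (((h 0).smul contDiffAt_const).sub ((h 1).smul contDiffAt_const)).sub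
      ((h 2).smul contDiffAt_const)
  exact (hm.clm_comp (hg.fderiv_right (m := ∞) (by simp))).const_smul _

lemma contDiffAt_canonicalForm (P : IsFrameParametrization W Ψ) (hw : w ∈ W) (i : Fin 3) :
    ContDiffAt ℝ ∞ (canonicalForm Ψ i) w := P.contDiffAt_form hw i (P.contDiffAt_fst hw)

lemma contDiffAt_connectionForm (P : IsFrameParametrization W Ψ) (hw : w ∈ W) (i j : Fin 3) :
    ContDiffAt ℝ ∞ (connectionForm Ψ i j) w := P.contDiffAt_form hw i (P.contDiffAt_snd hw j)

/-- Differentiation of the constant inner products ⟨e_i, e_j⟩. -/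
lemma connectionForm_symm (P : IsFrameParametrization W Ψ) (hw : w ∈ W) (i j : Fin 3)
    (u : FrameCoord) :
    frameSign j * connectionForm Ψ j i w u + frameSign i * connectionForm Ψ i j w u = 0 := by
  have hd : ∀ i, DifferentiableAt ℝ (fun z => (Ψ z).2 i) w := fun i =>
    (P.contDiffAt_snd hw i).differentiableAt (by simp)
  have hdi : ∀ i a, DifferentiableAt ℝ (fun z => (Ψ z).2 i a) w := fun i a =>
    differentiableAt_pi.mp (hd i) a
  have hdv : ∀ i a, fderiv ℝ (fun z => (Ψ z).2 i a) w u = fderiv ℝ (fun z => (Ψ z).2 i) w u a := by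
    intro i a
    rw [fderiv_apply (𝕜 := ℝ) (hd i)]
    rfl
  have hc : (fun z => (Ψ z).2 i 0 * (Ψ z).2 j 0 - (Ψ z).2 i 1 * (Ψ z).2 j 1
      - (Ψ z).2 i 2 * (Ψ z).2 j 2) =ᶠ[𝓝 w] fun _ => if i = j then frameSign i else 0 := by
    filter_upwards [P.isOpen.mem_nhds hw] with z hz
    rw [← (P.mapsTo hz).1 i j, minkowski_apply]
  have h0 := congrArg (fun L : FrameCoord →L[ℝ] ℝ => L u) (hc.fderiv_eq (𝕜 := ℝ))
  have hm : ∀ a, DifferentiableAt ℝ (fun z => (Ψ z).2 i a * (Ψ z).2 j a) w := fun a =>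
    (hdi i a).mul (hdi j a)
  have hm' : DifferentiableAt ℝ (fun z => (Ψ z).2 i 0 * (Ψ z).2 j 0
      - (Ψ z).2 i 1 * (Ψ z).2 j 1) w := (hm 0).sub (hm 1)
  have hmul := fun a => fderiv_fun_mul (hdi i a) (hdi j a)
  simp only [fderiv_fun_sub hm' (hm 2), fderiv_fun_sub (hm 0) (hm 1), hmul] at h0
  simp [hdv] at h0
  have hs : ∀ i, frameSign i * frameSign i = 1 := by
    intro i; fin_cases i <;> simp [frameSign]
  simp only [connectionForm, smul_apply, ContinuousLinearMap.comp_apply,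
    smul_eq_mul, minkowski_apply, ← mul_assoc, hs, one_mul]
  linarith

/-- Expanding ⟨de_i ∧ dg⟩ in the frame gives both families of structure equations at once: g is the
base point for the canonical forms and a frame vector for the connection forms. -/
lemma extD_form (P : IsFrameParametrization W Ψ) (hw : w ∈ W) (i : Fin 3)
    {g : FrameCoord → Fin 3 → ℝ} (hg : ContDiffAt ℝ ∞ g w) (u v : FrameCoord) :
    extD (fun z => frameSign i • (minkowski ((Ψ z).2 i)).comp (fderiv ℝ g z)) w u v
      = ∑ j, frameSign i * frameSign j * wedge (connectionForm Ψ j i w)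
        (frameSign j • (minkowski ((Ψ w).2 j)).comp (fderiv ℝ g w)) u v := by
  rw [extD_minkowski_comp _ ((P.contDiffAt_snd hw i).differentiableAt (by simp)) hg,
    minkowski_eq_sum (P.mapsTo hw), minkowski_eq_sum (P.mapsTo hw) _ (fderiv ℝ g w u)]
  have hs : ∀ i, frameSign i * frameSign i = 1 := by
    intro i; fin_cases i <;> simp [frameSign]
  rw [← Finset.sum_sub_distrib, Finset.mul_sum]
  refine Finset.sum_congr rfl fun j _ => ?_
  simp only [wedge, connectionForm, smul_apply, ContinuousLinearMap.comp_apply,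
    smul_eq_mul]
  linear_combination (-frameSign i * frameSign j * (minkowski ((Ψ w).2 j)
    (fderiv ℝ (fun z => (Ψ z).2 i) w u) * minkowski ((Ψ w).2 j) (fderiv ℝ g w v)
    - minkowski ((Ψ w).2 j) (fderiv ℝ (fun z => (Ψ z).2 i) w v) * minkowski ((Ψ w).2 j)
      (fderiv ℝ g w u))) * hs j

lemma connectionForm_values (P : IsFrameParametrization W Ψ) (hw : w ∈ W) (u : FrameCoord) :
    connectionForm Ψ 0 0 w u = 0 ∧ connectionForm Ψ 1 1 w u = 0 ∧ connectionForm Ψ 2 2 w u = 0 ∧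
    connectionForm Ψ 1 0 w u = connectionForm Ψ 0 1 w u ∧
    connectionForm Ψ 0 2 w u = connectionForm Ψ 2 0 w u ∧
    connectionForm Ψ 1 2 w u = -connectionForm Ψ 2 1 w u := by
  have h := fun i j => P.connectionForm_symm hw i j u
  have h00 := h 0 0
  have h11 := h 1 1
  have h22 := h 2 2
  have h01 := h 0 1
  have h02 := h 0 2
  have h12 := h 1 2
  simp [frameSign] at h00 h11 h22 h01 h02 h12
  refine ⟨?_, ?_, ?_, ?_, ?_, ?_⟩ <;> linarith

/-- The skew symmetry of the connection leaves three independent forms, ω¹₂, ω³₁ and ω³₂ (indices `0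
1`, `2 0`, `2 1`), in which the general structure equations are rewritten. -/
lemma structure_equations (P : IsFrameParametrization W Ψ) (hw : w ∈ W) (u v : FrameCoord) :
    extD (canonicalForm Ψ 0) w u v = -wedge (connectionForm Ψ 0 1 w) (canonicalForm Ψ 1 w) u v
      - wedge (connectionForm Ψ 2 0 w) (canonicalForm Ψ 2 w) u v ∧
    extD (canonicalForm Ψ 1) w u v = -wedge (connectionForm Ψ 0 1 w) (canonicalForm Ψ 0 w) u v
      + wedge (connectionForm Ψ 2 1 w) (canonicalForm Ψ 2 w) u v ∧
    extD (canonicalForm Ψ 2) w u v = -wedge (connectionForm Ψ 2 0 w) (canonicalForm Ψ 0 w) u v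
      - wedge (connectionForm Ψ 2 1 w) (canonicalForm Ψ 1 w) u v ∧
    extD (connectionForm Ψ 0 1) w u v
      = -wedge (connectionForm Ψ 2 0 w) (connectionForm Ψ 2 1 w) u v ∧
    extD (connectionForm Ψ 2 0) w u v
      = -wedge (connectionForm Ψ 2 1 w) (connectionForm Ψ 0 1 w) u v ∧
    extD (connectionForm Ψ 2 1) w u v
      = -wedge (connectionForm Ψ 2 0 w) (connectionForm Ψ 0 1 w) u v := by
  have hcan : ∀ i, extD (canonicalForm Ψ i) w u v = ∑ j, frameSign i * frameSign j *
      wedge (connectionForm Ψ j i w) (canonicalForm Ψ j w) u v :=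
    fun i => P.extD_form hw i (P.contDiffAt_fst hw) u v
  have hcon : ∀ i k, extD (connectionForm Ψ i k) w u v = ∑ j, frameSign i * frameSign j *
      wedge (connectionForm Ψ j i w) (connectionForm Ψ j k w) u v :=
    fun i k => P.extD_form hw i (P.contDiffAt_snd hw k) u v
  obtain ⟨a0, a1, a2, a3, a4, a5⟩ := P.connectionForm_values hw u
  obtain ⟨b0, b1, b2, b3, b4, b5⟩ := P.connectionForm_values hw v
  simp only [hcan, hcon, Fin.sum_univ_three, wedge, a0, a1, a2, a3, a4, a5, b0, b1, b2, b3, b4, b5]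
  simp only [frameSign, Matrix.cons_val_zero, Matrix.cons_val_one, Matrix.cons_val]
  refine ⟨?_, ?_, ?_, ?_, ?_, ?_⟩ <;> ring

/-- By skew symmetry the six forms determine all components of dρ and de_j in the frame, and the
parametrization is an immersion. Hence they form a coframe. -/
lemma eq_zero_of_forms_eq_zero (P : IsFrameParametrization W Ψ) (hw : w ∈ W) {u : FrameCoord}
    (h0 : ∀ i, canonicalForm Ψ i w u = 0) (h01 : connectionForm Ψ 0 1 w u = 0)
    (h20 : connectionForm Ψ 2 0 w u = 0) (h21 : connectionForm Ψ 2 1 w u = 0) : u = 0 := by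
  obtain ⟨a0, a1, a2, a3, a4, a5⟩ := P.connectionForm_values hw u
  have hs : ∀ i, frameSign i ≠ 0 := by
    intro i; fin_cases i <;> simp [frameSign]
  have hcon : ∀ i j, connectionForm Ψ i j w u = 0 := by
    intro i j
    fin_cases i <;> fin_cases j <;> simp_all
  have e1 : fderiv ℝ (fun z => (Ψ z).1) w u = 0 :=
    eq_zero_of_minkowski_eq_zero (P.mapsTo hw) fun i =>
      (mul_eq_zero.mp (h0 i)).resolve_left (hs i)
  have e2 : ∀ j, fderiv ℝ (fun z => (Ψ z).2 j) w u = 0 := fun j =>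
    eq_zero_of_minkowski_eq_zero (P.mapsTo hw) fun i =>
      (mul_eq_zero.mp (hcon i j)).resolve_left (hs i)
  have hd : DifferentiableAt ℝ Ψ w := (P.contDiffAt hw).differentiableAt (by simp)
  apply P.injective_fderiv w hw
  rw [map_zero]
  have hp := hd.hasFDerivAt
  refine Prod.ext ?_ ?_
  · rw [hp.fst.fderiv] at e1
    exact e1
  · funext j
    have := (hasFDerivAt_pi'.mp hp.snd j).fderiv
    have h2 := e2 j
    rw [this] at h2
    exact h2

end IsFrameParametrization

/-! ## Complexified coframes -/

/-- As many covectors as the dimension, without common zero, map E onto ℝⁿ. Real vectors dual to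
them then test any complex relation. -/
lemma linearIndependent_ofReal {E : Type*} [NormedAddCommGroup E] [NormedSpace ℝ E]
    [FiniteDimensional ℝ E] {n : ℕ} (hn : Module.finrank ℝ E = n) {ζ : Fin n → E →L[ℝ] ℝ}
    (h : ∀ u, (∀ i, ζ i u = 0) → u = 0) :
    LinearIndependent ℂ fun i => Complex.ofRealCLM.comp (ζ i) := by
  let L : E →ₗ[ℝ] (Fin n → ℝ) := LinearMap.pi fun i => (ζ i : E →ₗ[ℝ] ℝ)
  have hinj : Function.Injective L := by
    rw [← LinearMap.ker_eq_bot, LinearMap.ker_eq_bot']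
    intro u hu
    exact h u fun i => congrFun hu i
  have hsurj : Function.Surjective L :=
    (LinearMap.injective_iff_surjective_of_finrank_eq_finrank (by simp [hn])).mp hinj
  rw [Fintype.linearIndependent_iff]
  intro c hc i
  obtain ⟨u, hu⟩ := hsurj (Pi.single i 1)
  have hu' : ∀ j, ζ j u = (Pi.single i 1 : Fin n → ℝ) j := fun j => congrFun hu j
  have := congrArg (fun α => α u) hc
  simpa [hu', Pi.single_apply, apply_ite] using this

lemma finrank_complex_dual (E : Type*) [NormedAddCommGroup E] [NormedSpace ℝ E]
    [FiniteDimensional ℝ E] : Module.finrank ℂ (E →L[ℝ] ℂ) = Module.finrank ℝ E := by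
  have e : (E →ₗ[ℝ] ℂ) ≃ₗ[ℂ] (E →L[ℝ] ℂ) :=
    { LinearMap.toContinuousLinearMap (𝕜 := ℝ) (E := E) (F' := ℂ) with
      map_smul' := fun c f => by ext; rfl }
  rw [← e.finrank_eq, Module.finrank_linearMap, Module.finrank_self, mul_one]

end DarbouxEmbedding

end

noncomputable section

namespace DarbouxEmbedding

/-! ## Killing fields in an orthonormal coframe -/

/-- On `U`, the functions `x₁`, `x₂` are the components, in the orthonormal coframe `η₁`, `η₂` with
connection form `η₁₂` and curvature `K`, of a timelike Killing field, whose covariant derivative is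
given by `lam`. -/
structure IsKillingCoframe (U : Set Plane) (η₁ η₂ η₁₂ : Plane → Plane →L[ℝ] ℝ)
    (x₁ x₂ lam K : Plane → ℝ) : Prop where
  isOpen : IsOpen U
  smooth_η₁ : ContDiffOn ℝ ∞ η₁ U
  smooth_η₂ : ContDiffOn ℝ ∞ η₂ U
  smooth_η₁₂ : ContDiffOn ℝ ∞ η₁₂ U
  smooth_x₁ : ContDiffOn ℝ ∞ x₁ U
  smooth_x₂ : ContDiffOn ℝ ∞ x₂ U
  smooth_lam : ContDiffOn ℝ ∞ lam U
  smooth_K : ContDiffOn ℝ ∞ K U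
  indep : ∀ y ∈ U, ∀ a, η₁ y a = 0 → η₂ y a = 0 → a = 0
  pos : ∀ y ∈ U, 0 < x₁ y ^ 2 - x₂ y ^ 2
  extD_η₁ : ∀ y ∈ U, ∀ a b, extD η₁ y a b = -wedge (η₁₂ y) (η₂ y) a b
  extD_η₂ : ∀ y ∈ U, ∀ a b, extD η₂ y a b = -wedge (η₁₂ y) (η₁ y) a b
  extD_η₁₂ : ∀ y ∈ U, ∀ a b, extD η₁₂ y a b = -K y * wedge (η₁ y) (η₂ y) a b
  fderiv_x₁ : ∀ y ∈ U, ∀ a, fderiv ℝ x₁ y a = -x₂ y * η₁₂ y a + lam y * η₂ y a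
  fderiv_x₂ : ∀ y ∈ U, ∀ a, fderiv ℝ x₂ y a = -x₁ y * η₁₂ y a + lam y * η₁ y a
  fderiv_lam : ∀ y ∈ U, ∀ a, fderiv ℝ lam y a = K y * (x₁ y * η₂ y a - x₂ y * η₁ y a)

section DualFrame

variable {U : Set Plane} {η₁ η₂ : Plane → Plane →L[ℝ] ℝ}

lemma exists_dualFrame (h₁ : ContDiffOn ℝ ∞ η₁ U) (h₂ : ContDiffOn ℝ ∞ η₂ U)
    (hind : ∀ y ∈ U, ∀ a, η₁ y a = 0 → η₂ y a = 0 → a = 0) :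
    ∃ e₁ e₂ : Plane → Plane, ContDiffOn ℝ ∞ e₁ U ∧ ContDiffOn ℝ ∞ e₂ U ∧ ∀ y ∈ U,
      η₁ y (e₁ y) = 1 ∧ η₂ y (e₁ y) = 0 ∧ η₁ y (e₂ y) = 0 ∧ η₂ y (e₂ y) = 1 ∧
      ∀ a, a = η₁ y a • e₁ y + η₂ y a • e₂ y := by
  set E₁ : Plane := EuclideanSpace.single 0 1
  set E₂ : Plane := EuclideanSpace.single 1 1
  -- The determinant of the coframe in the coordinate basis; the dual frame is given by Cramer's
  -- rule.
  set D : Plane → ℝ := fun y => η₁ y E₁ * η₂ y E₂ - η₁ y E₂ * η₂ y E₁ with hD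
  have hD0 : ∀ y ∈ U, D y ≠ 0 := by
    intro y hy h0
    have hv : ∀ a b : ℝ, η₁ y (a • E₁ + b • E₂) = 0 → η₂ y (a • E₁ + b • E₂) = 0 →
        a = 0 ∧ b = 0 := by
      intro a b h h'
      have := hind y hy _ h h'
      have e0 := congrArg (fun v : Plane => v 0) this
      have e1 := congrArg (fun v : Plane => v 1) this
      simp [E₁, E₂] at e0 e1
      exact ⟨e0, e1⟩
    simp only [hD] at h0
    have g1 := hv (η₂ y E₂) (-η₂ y E₁) (by simp; linarith) (by simp; ring)
    have g2 := hv (η₁ y E₂) (-η₁ y E₁) (by simp; ring) (by simp; linarith)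
    have := hv 1 0 (by simp; linarith [g2.2]) (by simp; linarith [g1.2])
    exact one_ne_zero this.1
  have s1 : ∀ v, ContDiffOn ℝ ∞ (fun y => η₁ y v) U := fun v => h₁.clm_apply contDiffOn_const
  have s2 : ∀ v, ContDiffOn ℝ ∞ (fun y => η₂ y v) U := fun v => h₂.clm_apply contDiffOn_const
  have sD : ContDiffOn ℝ ∞ (fun y => (D y)⁻¹) U :=
    (((s1 E₁).mul (s2 E₂)).sub ((s1 E₂).mul (s2 E₁))).inv hD0
  refine ⟨fun y => (D y)⁻¹ • (η₂ y E₂ • E₁ - η₂ y E₁ • E₂),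
    fun y => (D y)⁻¹ • (η₁ y E₁ • E₂ - η₁ y E₂ • E₁),
    sD.smul (((s2 E₂).smul contDiffOn_const).sub ((s2 E₁).smul contDiffOn_const)),
    sD.smul (((s1 E₁).smul contDiffOn_const).sub ((s1 E₂).smul contDiffOn_const)), ?_⟩
  intro y hy
  have h0 := hD0 y hy
  have hDy : D y = η₁ y E₁ * η₂ y E₂ - η₁ y E₂ * η₂ y E₁ := rfl
  have q1 : η₁ y ((D y)⁻¹ • (η₂ y E₂ • E₁ - η₂ y E₁ • E₂)) = 1 := by
    simp; field_simp; rw [hDy]; ring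
  have q2 : η₂ y ((D y)⁻¹ • (η₂ y E₂ • E₁ - η₂ y E₁ • E₂)) = 0 := by
    simp; right; ring
  have q3 : η₁ y ((D y)⁻¹ • (η₁ y E₁ • E₂ - η₁ y E₂ • E₁)) = 0 := by
    simp; right; ring
  have q4 : η₂ y ((D y)⁻¹ • (η₁ y E₁ • E₂ - η₁ y E₂ • E₁)) = 1 := by
    simp; field_simp; rw [hDy]
  refine ⟨q1, q2, q3, q4, fun a => ?_⟩
  beta_reduce
  rw [← sub_eq_zero]
  apply hind y hy
  · rw [map_sub, map_add, (η₁ y).map_smul (η₁ y a), (η₁ y).map_smul (η₂ y a), q1, q3]; simp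
  · rw [map_sub, map_add, (η₂ y).map_smul (η₁ y a), (η₂ y).map_smul (η₂ y a), q2, q4]; simp

end DualFrame

lemma extD_eq_mul_wedge {ξ α β : Plane → Plane →L[ℝ] ℝ} {y e₁ e₂ : Plane}
    (h : ∀ a, a = α y a • e₁ + β y a • e₂) (a b : Plane) :
    extD ξ y a b = extD ξ y e₁ e₂ * wedge (α y) (β y) a b := by
  have hl : ∀ a b, fderiv ℝ ξ y a b = α y a * α y b * fderiv ℝ ξ y e₁ e₁
      + α y a * β y b * fderiv ℝ ξ y e₁ e₂ + β y a * α y b * fderiv ℝ ξ y e₂ e₁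
      + β y a * β y b * fderiv ℝ ξ y e₂ e₂ := by
    intro a b
    conv_lhs => rw [h a, h b]
    simp
    ring
  simp only [extD, wedge]
  rw [hl a b, hl b a]
  ring

lemma contDiffOn_extD {ξ : Plane → Plane →L[ℝ] ℝ} {U : Set Plane} {e₁ e₂ : Plane → Plane}
    (hU : IsOpen U) (hξ : ContDiffOn ℝ ∞ ξ U) (h₁ : ContDiffOn ℝ ∞ e₁ U)
    (h₂ : ContDiffOn ℝ ∞ e₂ U) : ContDiffOn ℝ ∞ (fun y => extD ξ y (e₁ y) (e₂ y)) U := by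
  have hd : ContDiffOn ℝ ∞ (fderiv ℝ ξ) U := hξ.fderiv_of_isOpen hU (by simp)
  exact ((hd.clm_apply h₁).clm_apply h₂).sub ((hd.clm_apply h₂).clm_apply h₁)

/-- The Killing equation says that the covariant derivative of X is skew, and in two dimensions a
skew tensor is one function `lam`. The equations d²x₁ = d²x₂ = 0 then determine d lam in terms of
the curvature. -/
theorem exists_isKillingCoframe {G : Plane → Plane → Plane → ℝ} {U : Set Plane}
    {η₁ η₂ η₁₂ : Plane → Plane →L[ℝ] ℝ} (H : IsOrthonormalCoframe G U η₁ η₂ η₁₂)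
    (hind : ∀ y ∈ U, ∀ a, η₁ y a = 0 → η₂ y a = 0 → a = 0) {X : Plane → Plane}
    (hX : ContDiffOn ℝ ∞ X U) (hpos : ∀ y ∈ U, 0 < G y (X y) (X y))
    (hK : ∀ y ∈ U, ∀ a b, fderiv ℝ (fun z => G z a b) y (X y) + G y (fderiv ℝ X y a) b
      + G y a (fderiv ℝ X y b) = 0) :
    ∃ lam K : Plane → ℝ, IsKillingCoframe U η₁ η₂ η₁₂ (fun y => η₁ y (X y))
      (fun y => η₂ y (X y)) lam K := by
  obtain ⟨e₁, e₂, s₁, s₂, he⟩ := exists_dualFrame H.smooth₁ H.smooth₂ hind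
  set x₁ : Plane → ℝ := fun y => η₁ y (X y) with hx₁
  set x₂ : Plane → ℝ := fun y => η₂ y (X y) with hx₂
  have sx₁ : ContDiffOn ℝ ∞ x₁ U := H.smooth₁.clm_apply hX
  have sx₂ : ContDiffOn ℝ ∞ x₂ U := H.smooth₂.clm_apply hX
  have nh : ∀ {y}, y ∈ U → U ∈ 𝓝 y := fun hy => H.isOpen.mem_nhds hy
  have dd : ∀ {A : Type} [NormedAddCommGroup A] [NormedSpace ℝ A] {f : Plane → A},
      ContDiffOn ℝ ∞ f U → ∀ {y}, y ∈ U → DifferentiableAt ℝ f y := fun hf y hy =>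
    (hf.contDiffAt (nh hy)).differentiableAt (by simp)
  -- The functions are read off from their intended equations: `lam` from dx₁ at e₂, K from dη₁₂ at
  -- (e₁, e₂).
  set lam : Plane → ℝ := fun y => fderiv ℝ x₁ y (e₂ y) + x₂ y * η₁₂ y (e₂ y) with hlam
  set K : Plane → ℝ := fun y => -extD η₁₂ y (e₁ y) (e₂ y) with hKdef
  have slam : ContDiffOn ℝ ∞ lam U :=
    ((sx₁.fderiv_of_isOpen H.isOpen (by simp)).clm_apply s₂).add
      (sx₂.mul (H.smooth₁₂.clm_apply s₂))
  have sK : ContDiffOn ℝ ∞ K U := (contDiffOn_extD H.isOpen H.smooth₁₂ s₁ s₂).neg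
  have hdx : ∀ y ∈ U, ∀ a, fderiv ℝ x₁ y a = -x₂ y * η₁₂ y a + lam y * η₂ y a ∧
      fderiv ℝ x₂ y a = -x₁ y * η₁₂ y a + lam y * η₁ y a := by
    intro y hy
    obtain ⟨q1, q2, q3, q4, hb⟩ := he y hy
    have d1 : ∀ a, fderiv ℝ x₁ y a = fderiv ℝ η₁ y a (X y) + η₁ y (fderiv ℝ X y a) := by
      intro a
      have : fderiv ℝ x₁ y = _ := ((dd H.smooth₁ hy).hasFDerivAt.clm_apply (dd hX hy).hasFDerivAt).fderiv
      rw [this]; simp; ring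
    have d2 : ∀ a, fderiv ℝ x₂ y a = fderiv ℝ η₂ y a (X y) + η₂ y (fderiv ℝ X y a) := by
      intro a
      have : fderiv ℝ x₂ y = _ := ((dd H.smooth₂ hy).hasFDerivAt.clm_apply (dd hX hy).hasFDerivAt).fderiv
      rw [this]; simp; ring
    have dG : ∀ a b, fderiv ℝ (fun z => G z a b) y (X y) = fderiv ℝ η₁ y (X y) a * η₁ y b
        + η₁ y a * fderiv ℝ η₁ y (X y) b - fderiv ℝ η₂ y (X y) a * η₂ y b
        - η₂ y a * fderiv ℝ η₂ y (X y) b := by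
      intro a b
      have hev : (fun z => G z a b) =ᶠ[𝓝 y] fun z => η₁ z a * η₁ z b - η₂ z a * η₂ z b := by
        filter_upwards [nh hy] with z hz
        exact H.metric_eq z hz a b
      have c1 : ∀ a, HasFDerivAt (fun z => η₁ z a) _ y := fun a =>
        (dd H.smooth₁ hy).hasFDerivAt.clm_apply (hasFDerivAt_const a y)
      have c2 : ∀ a, HasFDerivAt (fun z => η₂ z a) _ y := fun a =>
        (dd H.smooth₂ hy).hasFDerivAt.clm_apply (hasFDerivAt_const a y)
      rw [hev.fderiv_eq, (((c1 a).fun_mul (c1 b)).fun_sub ((c2 a).fun_mul (c2 b))).fderiv]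
      simp
      ring
    have x1 := H.extD₁ y hy (X y)
    have x2 := H.extD₂ y hy (X y)
    simp only [extD, wedge] at x1 x2
    -- The three components of the Killing equation give three of the four derivatives of x₁, x₂
    -- along the frame; the fourth defines `lam`.
    have k11 := hK y hy (e₁ y) (e₁ y)
    have k12 := hK y hy (e₁ y) (e₂ y)
    have k22 := hK y hy (e₂ y) (e₂ y)
    simp only [dG, H.metric_eq y hy, q1, q2, q3, q4] at k11 k12 k22
    have a11 := x1 (e₁ y)
    have a12 := x1 (e₂ y)
    have a21 := x2 (e₁ y)
    have a22 := x2 (e₂ y)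
    have b11 := d1 (e₁ y)
    have b12 := d1 (e₂ y)
    have b21 := d2 (e₁ y)
    have b22 := d2 (e₂ y)
    simp only [q1, q2, q3, q4] at a11 a12 a21 a22
    have hlamy : lam y = fderiv ℝ x₁ y (e₂ y) + x₂ y * η₁₂ y (e₂ y) := rfl
    have hx1y : η₁ y (X y) = x₁ y := rfl
    have hx2y : η₂ y (X y) = x₂ y := rfl
    rw [hx1y] at a21 a22
    rw [hx2y] at a11 a12
    have f1 : fderiv ℝ x₁ y (e₁ y) = -x₂ y * η₁₂ y (e₁ y) := by linarith
    have f2 : fderiv ℝ x₂ y (e₂ y) = -x₁ y * η₁₂ y (e₂ y) := by linarith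
    have f3 : fderiv ℝ x₂ y (e₁ y) = -x₁ y * η₁₂ y (e₁ y) + lam y := by linarith
    intro a
    have ha := hb a
    have g1 : fderiv ℝ x₁ y a = η₁ y a * fderiv ℝ x₁ y (e₁ y) + η₂ y a * fderiv ℝ x₁ y (e₂ y) := by
      conv_lhs => rw [ha]
      simp
    have g2 : fderiv ℝ x₂ y a = η₁ y a * fderiv ℝ x₂ y (e₁ y) + η₂ y a * fderiv ℝ x₂ y (e₂ y) := by
      conv_lhs => rw [ha]
      simp
    have g3 : η₁₂ y a = η₁ y a * η₁₂ y (e₁ y) + η₂ y a * η₁₂ y (e₂ y) := by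
      conv_lhs => rw [ha]
      simp
    rw [g1, g2, g3, f1, f2, f3, hlamy]
    constructor <;> ring
  have hcurv : ∀ y ∈ U, ∀ a b, extD η₁₂ y a b = -K y * wedge (η₁ y) (η₂ y) a b := by
    intro y hy a b
    rw [extD_eq_mul_wedge (α := η₁) (β := η₂) (he y hy).2.2.2.2 a b]
    simp only [hKdef, neg_neg]
  refine ⟨lam, K, H.isOpen, H.smooth₁, H.smooth₂, H.smooth₁₂, sx₁, sx₂, slam, sK, hind, ?_, H.extD₁,
    H.extD₂, hcurv, fun y hy a => (hdx y hy a).1, fun y hy a => (hdx y hy a).2, ?_⟩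
  · intro y hy
    have := hpos y hy
    rw [H.metric_eq y hy] at this
    simp only [hx₁, hx₂]
    linarith
  · intro y hy a
    obtain ⟨q1, q2, q3, q4, hb⟩ := he y hy
    have e1 : fderiv ℝ x₁ =ᶠ[𝓝 y] fun z => lam z • η₂ z - x₂ z • η₁₂ z := by
      filter_upwards [nh hy] with z hz
      ext a
      rw [(hdx z hz a).1]
      simp
      ring
    have e2 : fderiv ℝ x₂ =ᶠ[𝓝 y] fun z => lam z • η₁ z - x₁ z • η₁₂ z := by
      filter_upwards [nh hy] with z hz
      ext a
      rw [(hdx z hz a).2]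
      simp
      ring
    -- Closedness of dx₁ and dx₂, evaluated on (e₁, e₂), yields the derivatives of `lam` along e₁
    -- and e₂ respectively.
    have z1 := extD_fderiv ((sx₁.contDiffAt (nh hy)).of_le (by norm_cast)) (e₁ y) (e₂ y)
    have z2 := extD_fderiv ((sx₂.contDiffAt (nh hy)).of_le (by norm_cast)) (e₁ y) (e₂ y)
    rw [extD_congr e1, extD_fun_sub ((dd slam hy).fun_smul (dd H.smooth₂ hy))
      ((dd sx₂ hy).fun_smul (dd H.smooth₁₂ hy)), extD_fun_smul (dd slam hy) (dd H.smooth₂ hy),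
      extD_fun_smul (dd sx₂ hy) (dd H.smooth₁₂ hy), hcurv y hy, H.extD₂ y hy, (hdx y hy _).2,
      (hdx y hy _).2] at z1
    rw [extD_congr e2, extD_fun_sub ((dd slam hy).fun_smul (dd H.smooth₁ hy))
      ((dd sx₁ hy).fun_smul (dd H.smooth₁₂ hy)), extD_fun_smul (dd slam hy) (dd H.smooth₁ hy),
      extD_fun_smul (dd sx₁ hy) (dd H.smooth₁₂ hy), hcurv y hy, H.extD₁ y hy, (hdx y hy _).1,
      (hdx y hy _).1] at z2
    simp only [wedge, q1, q2, q3, q4] at z1 z2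
    have g1 : fderiv ℝ lam y a = η₁ y a * fderiv ℝ lam y (e₁ y) + η₂ y a * fderiv ℝ lam y (e₂ y) := by
      conv_lhs => rw [hb a]
      simp
    have f1 : fderiv ℝ lam y (e₁ y) = -x₂ y * K y := by linarith
    have f2 : fderiv ℝ lam y (e₂ y) = x₁ y * K y := by linarith
    rw [g1, f1, f2]
    ring

namespace IsKillingCoframe

variable {U : Set Plane} {η₁ η₂ η₁₂ : Plane → Plane →L[ℝ] ℝ} {x₁ x₂ lam K : Plane → ℝ} {y : Plane}

lemma contDiffAt (H : IsKillingCoframe U η₁ η₂ η₁₂ x₁ x₂ lam K) (hy : y ∈ U) {A : Type*}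
    [NormedAddCommGroup A] [NormedSpace ℝ A] {f : Plane → A} (hf : ContDiffOn ℝ ∞ f U) :
    ContDiffAt ℝ ∞ f y := hf.contDiffAt (H.isOpen.mem_nhds hy)

lemma differentiableAt (H : IsKillingCoframe U η₁ η₂ η₁₂ x₁ x₂ lam K) (hy : y ∈ U) {A : Type*}
    [NormedAddCommGroup A] [NormedSpace ℝ A] {f : Plane → A} (hf : ContDiffOn ℝ ∞ f U) :
    DifferentiableAt ℝ f y := (H.contDiffAt hy hf).differentiableAt (by simp)

lemma x₁_ne_zero (H : IsKillingCoframe U η₁ η₂ η₁₂ x₁ x₂ lam K) (hy : y ∈ U) : x₁ y ≠ 0 := by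
  intro h
  have := H.pos y hy
  rw [h] at this
  nlinarith [sq_nonneg (x₂ y)]

/-- The form is the contraction of the area form η₁ ∧ η₂ with X, closed because an isometric flow
preserves area; here it follows from the structure equations. -/
lemma extD_mu (H : IsKillingCoframe U η₁ η₂ η₁₂ x₁ x₂ lam K) (hy : y ∈ U) (a b : Plane) :
    extD (fun z => x₁ z • η₂ z - x₂ z • η₁ z) y a b = 0 := by
  have d {A : Type} [NormedAddCommGroup A] [NormedSpace ℝ A] {f : Plane → A}
      (hf : ContDiffOn ℝ ∞ f U) := H.differentiableAt hy hf
  rw [extD_fun_sub ((d H.smooth_x₁).fun_smul (d H.smooth_η₂)) ((d H.smooth_x₂).fun_smul (d H.smooth_η₁)),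
    extD_fun_smul (d H.smooth_x₁) (d H.smooth_η₂), extD_fun_smul (d H.smooth_x₂) (d H.smooth_η₁),
    H.extD_η₁ y hy, H.extD_η₂ y hy, H.fderiv_x₁ y hy, H.fderiv_x₁ y hy, H.fderiv_x₂ y hy,
    H.fderiv_x₂ y hy]
  simp only [wedge]
  ring

/-- If `df = A μ` with `μ = x₁ η₂ - x₂ η₁`, then also `dA` is a multiple of `μ`. -/
lemma exists_fderiv_eq (H : IsKillingCoframe U η₁ η₂ η₁₂ x₁ x₂ lam K) {f A : Plane → ℝ}
    (hf : ContDiffOn ℝ ∞ f U) (hA : ContDiffOn ℝ ∞ A U)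
    (h : ∀ y ∈ U, ∀ a, fderiv ℝ f y a = A y * (x₁ y * η₂ y a - x₂ y * η₁ y a)) :
    ∃ B : Plane → ℝ, ContDiffOn ℝ ∞ B U ∧
      ∀ y ∈ U, ∀ a, fderiv ℝ A y a = B y * (x₁ y * η₂ y a - x₂ y * η₁ y a) := by
  obtain ⟨e₁, e₂, s₁, s₂, he⟩ := exists_dualFrame H.smooth_η₁ H.smooth_η₂ H.indep
  -- As dA ∧ μ = 0, the factor can be read off at e₂, where μ takes the value x₁, nonzero since X is
  -- timelike.
  refine ⟨fun y => fderiv ℝ A y (e₂ y) / x₁ y,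
    ((hA.fderiv_of_isOpen H.isOpen (by simp)).clm_apply s₂).div H.smooth_x₁
      fun y hy => H.x₁_ne_zero hy, ?_⟩
  intro y hy a
  obtain ⟨q1, q2, q3, q4, hb⟩ := he y hy
  have e1 : fderiv ℝ f =ᶠ[𝓝 y] fun z => A z • (x₁ z • η₂ z - x₂ z • η₁ z) := by
    filter_upwards [H.isOpen.mem_nhds hy] with z hz
    ext a
    rw [h z hz a]
    simp
  have z1 := extD_fderiv ((H.contDiffAt hy hf).of_le (by norm_cast)) (e₁ y) (e₂ y)
  have hd : DifferentiableAt ℝ (fun z => x₁ z • η₂ z - x₂ z • η₁ z) y :=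
    H.differentiableAt hy ((H.smooth_x₁.smul H.smooth_η₂).sub (H.smooth_x₂.smul H.smooth_η₁))
  rw [extD_congr e1, extD_fun_smul (H.differentiableAt hy hA) hd, H.extD_mu hy] at z1
  simp [q1, q2, q3, q4] at z1
  have g1 : fderiv ℝ A y a = η₁ y a * fderiv ℝ A y (e₁ y) + η₂ y a * fderiv ℝ A y (e₂ y) := by
    conv_lhs => rw [hb a]
    simp
  have := H.x₁_ne_zero hy
  rw [g1]
  field_simp
  linear_combination η₁ y a * z1

end IsKillingCoframe

end DarbouxEmbedding

end

noncomputable section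

namespace DarbouxEmbedding

/-! ## The adapted frame of a Killing field on the total space -/

section Lift

variable {E : Type*} [NormedAddCommGroup E] [NormedSpace ℝ E]

/-- A real one-form, as a complex-valued one-form. -/
def complexify (ξ : E → E →L[ℝ] ℝ) (y : E) : E →L[ℝ] ℂ := Complex.ofRealCLM.comp (ξ y)

lemma contDiffOn_complexify {ξ : E → E →L[ℝ] ℝ} {N : Set E} (h : ContDiffOn ℝ ∞ ξ N) :
    ContDiffOn ℝ ∞ (complexify ξ) N := contDiffOn_const.clm_comp h

lemma contDiffOn_ofReal {f : E → ℝ} {N : Set E} (h : ContDiffOn ℝ ∞ f N) :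
    ContDiffOn ℝ ∞ (fun z => (f z : ℂ)) N := Complex.ofRealCLM.contDiff.comp_contDiffOn h

lemma extD_complexify {ξ : E → E →L[ℝ] ℝ} {y : E} (h : DifferentiableAt ℝ ξ y) (u v : E) :
    extD (complexify ξ) y u v = ((extD ξ y u v : ℝ) : ℂ) := by
  have h1 : fderiv ℝ (complexify ξ) y = _ :=
    ((hasFDerivAt_const Complex.ofRealCLM y).clm_comp h.hasFDerivAt).fderiv
  simp [extD, h1]

lemma fderiv_ofReal {f : E → ℝ} {y : E} (h : DifferentiableAt ℝ f y) (u : E) :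
    fderiv ℝ (fun z => (f z : ℂ)) y u = ((fderiv ℝ f y u : ℝ) : ℂ) := by
  have h1 : fderiv ℝ (fun z => (f z : ℂ)) y = _ :=
    (Complex.ofRealCLM.hasFDerivAt.comp y h.hasFDerivAt).fderiv
  simp [h1]

lemma fderiv_div_apply {f g : E → ℝ} {y : E} (hf : DifferentiableAt ℝ f y)
    (hg : DifferentiableAt ℝ g y) (h0 : g y ≠ 0) (u : E) :
    fderiv ℝ (fun z => f z / g z) y u = (fderiv ℝ f y u * g y - f y * fderiv ℝ g y u) / g y ^ 2 := by
  have h1 : HasFDerivAt (fun z => f z * (g z)⁻¹) _ y :=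
    hf.hasFDerivAt.fun_mul ((hasDerivAt_inv h0).comp_hasFDerivAt y hg.hasFDerivAt)
  simp only [div_eq_mul_inv]
  rw [h1.fderiv]
  simp
  field_simp
  ring

lemma extD_combination {f g : E → ℝ} {ξ ζ : E → E →L[ℝ] ℝ} {y : E} (hf : DifferentiableAt ℝ f y)
    (hg : DifferentiableAt ℝ g y) (hξ : DifferentiableAt ℝ ξ y) (hζ : DifferentiableAt ℝ ζ y)
    (u v : E) : extD (fun z => f z • ξ z + g z • ζ z) y u v
      = fderiv ℝ f y u * ξ y v - fderiv ℝ f y v * ξ y u + f y * extD ξ y u v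
        + (fderiv ℝ g y u * ζ y v - fderiv ℝ g y v * ζ y u + g y * extD ζ y u v) := by
  rw [extD_fun_add (hf.fun_smul hξ) (hg.fun_smul hζ), extD_fun_smul hf hξ, extD_fun_smul hg hζ]

/-- The structure equations of the generators `t` of the isometric embedding system, together with
those of an orthonormal coframe and of the components of a timelike Killing field. -/
structure IsKillingLift (N : Set E) (t : Fin 4 → E → E →L[ℝ] ℝ) (η₁ η₂ η₁₂ π₁ π₂ : E → E →L[ℝ] ℝ)
    (x₁ x₂ lam K R B : E → ℝ) : Prop where
  isOpen : IsOpen N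
  smooth_t : ∀ i, ContDiffOn ℝ ∞ (t i) N
  smooth_η₁ : ContDiffOn ℝ ∞ η₁ N
  smooth_η₂ : ContDiffOn ℝ ∞ η₂ N
  smooth_η₁₂ : ContDiffOn ℝ ∞ η₁₂ N
  smooth_π₁ : ContDiffOn ℝ ∞ π₁ N
  smooth_π₂ : ContDiffOn ℝ ∞ π₂ N
  smooth_x₁ : ContDiffOn ℝ ∞ x₁ N
  smooth_x₂ : ContDiffOn ℝ ∞ x₂ N
  smooth_lam : ContDiffOn ℝ ∞ lam N
  smooth_K : ContDiffOn ℝ ∞ K N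
  smooth_R : ContDiffOn ℝ ∞ R N
  smooth_B : ContDiffOn ℝ ∞ B N
  pos : ∀ y ∈ N, 0 < x₁ y ^ 2 - x₂ y ^ 2
  K_pos : ∀ y ∈ N, 0 < K y
  indep : ∀ y ∈ N, ∀ u, (∀ i, t i y u = 0) → η₁ y u = 0 → η₂ y u = 0 → π₁ y u = 0 → π₂ y u = 0 →
    u = 0
  extD_t₀ : ∀ y ∈ N, ∀ u v, extD (t 0) y u v
    = -wedge (π₁ y) (t 1 y + η₁ y) u v - wedge (π₂ y) (t 2 y + η₂ y) u v
  extD_t₁ : ∀ y ∈ N, ∀ u v, extD (t 1) y u v = -wedge (t 3 y + η₁₂ y) (t 2 y + η₂ y) u v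
    - wedge (π₁ y) (t 0 y) u v + wedge (η₁₂ y) (η₂ y) u v
  extD_t₂ : ∀ y ∈ N, ∀ u v, extD (t 2) y u v = -wedge (t 3 y + η₁₂ y) (t 1 y + η₁ y) u v
    + wedge (π₂ y) (t 0 y) u v + wedge (η₁₂ y) (η₁ y) u v
  extD_t₃ : ∀ y ∈ N, ∀ u v, extD (t 3) y u v
    = -wedge (π₁ y) (π₂ y) u v + K y * wedge (η₁ y) (η₂ y) u v
  extD_π₁ : ∀ y ∈ N, ∀ u v, extD π₁ y u v = -wedge (π₂ y) (t 3 y + η₁₂ y) u v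
  extD_π₂ : ∀ y ∈ N, ∀ u v, extD π₂ y u v = -wedge (π₁ y) (t 3 y + η₁₂ y) u v
  extD_η₁ : ∀ y ∈ N, ∀ u v, extD η₁ y u v = -wedge (η₁₂ y) (η₂ y) u v
  extD_η₂ : ∀ y ∈ N, ∀ u v, extD η₂ y u v = -wedge (η₁₂ y) (η₁ y) u v
  fderiv_x₁ : ∀ y ∈ N, ∀ u, fderiv ℝ x₁ y u = -x₂ y * η₁₂ y u + lam y * η₂ y u
  fderiv_x₂ : ∀ y ∈ N, ∀ u, fderiv ℝ x₂ y u = -x₁ y * η₁₂ y u + lam y * η₁ y u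
  fderiv_lam : ∀ y ∈ N, ∀ u, fderiv ℝ lam y u = K y * (x₁ y * η₂ y u - x₂ y * η₁ y u)
  fderiv_K : ∀ y ∈ N, ∀ u, fderiv ℝ K y u = R y * (x₁ y * η₂ y u - x₂ y * η₁ y u)
  fderiv_R : ∀ y ∈ N, ∀ u, fderiv ℝ R y u = B y * (x₁ y * η₂ y u - x₂ y * η₁ y u)

namespace IsKillingLift

variable {N : Set E} {t : Fin 4 → E → E →L[ℝ] ℝ} {η₁ η₂ η₁₂ π₁ π₂ : E → E →L[ℝ] ℝ}
  {x₁ x₂ lam K R B : E → ℝ} {y : E}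

lemma differentiableAt (H : IsKillingLift N t η₁ η₂ η₁₂ π₁ π₂ x₁ x₂ lam K R B) (hy : y ∈ N)
    {A : Type*} [NormedAddCommGroup A] [NormedSpace ℝ A] {f : E → A} (hf : ContDiffOn ℝ ∞ f N) :
    DifferentiableAt ℝ f y := (hf.contDiffAt (H.isOpen.mem_nhds hy)).differentiableAt (by simp)

/-- The boost which makes the timelike Killing field a multiple of the first frame vector. -/
lemma exists_boost (H : IsKillingLift N t η₁ η₂ η₁₂ π₁ π₂ x₁ x₂ lam K R B) :
    ∃ C S F : E → ℝ, ContDiffOn ℝ ∞ C N ∧ ContDiffOn ℝ ∞ S N ∧ ContDiffOn ℝ ∞ F N ∧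
    ∀ y ∈ N, 0 < F y ∧ x₁ y = F y * C y ∧ x₂ y = -(F y * S y) ∧ C y ^ 2 - S y ^ 2 = 1 ∧
      F y ^ 2 = x₁ y ^ 2 - x₂ y ^ 2 ∧
      ∀ u, fderiv ℝ F y u = lam y * (S y * η₁ y u + C y * η₂ y u) ∧
      fderiv ℝ C y u = S y * (η₁₂ y u - lam y / F y * (C y * η₁ y u + S y * η₂ y u)) ∧
      fderiv ℝ S y u = C y * (η₁₂ y u - lam y / F y * (C y * η₁ y u + S y * η₂ y u)) := by
  set Q : E → ℝ := fun y => x₁ y ^ 2 - x₂ y ^ 2 with hQ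
  have sQ : ContDiffOn ℝ ∞ Q N := (H.smooth_x₁.pow 2).sub (H.smooth_x₂.pow 2)
  set F : E → ℝ := fun y => Real.sqrt (Q y) with hF
  have sF : ContDiffOn ℝ ∞ F N := sQ.sqrt fun y hy => (H.pos y hy).ne'
  have F0 : ∀ y ∈ N, 0 < F y := fun y hy => Real.sqrt_pos.mpr (H.pos y hy)
  have F2 : ∀ y ∈ N, F y ^ 2 = x₁ y ^ 2 - x₂ y ^ 2 := fun y hy => Real.sq_sqrt (H.pos y hy).le
  have sS : ContDiffOn ℝ ∞ (fun y => -(x₂ y / F y)) N :=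
    (H.smooth_x₂.div sF fun y hy => (F0 y hy).ne').neg
  -- With C = x₁/F and S = -x₂/F, the coframe Cη₁ + Sη₂, Sη₁ + Cη₂ takes the values F and 0 on X,
  -- and F times its second member is μ.
  refine ⟨fun y => x₁ y / F y, fun y => -(x₂ y / F y), F,
    H.smooth_x₁.div sF fun y hy => (F0 y hy).ne', sS, sF, ?_⟩
  intro y hy
  have f0 := (F0 y hy).ne'
  have d1 := H.differentiableAt hy H.smooth_x₁
  have d2 := H.differentiableAt hy H.smooth_x₂
  have dF := H.differentiableAt hy sF
  have hFd : ∀ u, fderiv ℝ F y u = lam y * (x₁ y * η₂ y u - x₂ y * η₁ y u) / F y := by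
    intro u
    have h1 : fderiv ℝ F y = _ :=
      (((d1.hasFDerivAt.pow 2).fun_sub (d2.hasFDerivAt.pow 2)).sqrt (H.pos y hy).ne').fderiv
    have h2 : Real.sqrt (x₁ y ^ 2 - x₂ y ^ 2) = F y := rfl
    rw [h1, h2]
    simp [H.fderiv_x₁ y hy, H.fderiv_x₂ y hy]
    field_simp
    ring
  refine ⟨F0 y hy, by field_simp, by field_simp, ?_, F2 y hy, fun u => ⟨?_, ?_, ?_⟩⟩
  · have := F2 y hy
    field_simp
    linarith
  · rw [hFd]
    field_simp
    ring
  · rw [fderiv_div_apply d1 dF f0, hFd, H.fderiv_x₁ y hy]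
    have := F2 y hy
    field_simp
    linear_combination (lam y * η₂ y u) * this
  · have h1 : fderiv ℝ (fun z => -(x₂ z / F z)) y u = - fderiv ℝ (fun z => x₂ z / F z) y u := by
      rw [fderiv_fun_neg]; rfl
    rw [h1, fderiv_div_apply d2 dF f0, hFd, H.fderiv_x₂ y hy]
    have := F2 y hy
    field_simp
    linear_combination (-lam y * η₁ y u) * this

/-- Darboux integrability of the isometric embedding system of a metric with a timelike Killing
field gives a differential equation for the metric. -/
theorem mul_eq_of_isDarbouxIntegrableNear [FiniteDimensional ℝ E]
    (hE : Module.finrank ℝ E = 8) (H : IsKillingLift N t η₁ η₂ η₁₂ π₁ π₂ x₁ x₂ lam K R B)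
    (hy : y ∈ N) (hD : IsDarbouxIntegrableNear (fun i => complexify (t i)) y) :
    ∀ᶠ z in 𝓝 y, lam z * R z = 4 * K z ^ 2 := by
  obtain ⟨C, S, F, sC, sS, sF, hb⟩ := H.exists_boost
  have d {A : Type} [NormedAddCommGroup A] [NormedSpace ℝ A] {f : E → A} {y : E} (hy : y ∈ N)
    (hf : ContDiffOn ℝ ∞ f N) : DifferentiableAt ℝ f y := H.differentiableAt hy hf
  have d' {f : E → E →L[ℝ] ℝ} {y : E} (hy : y ∈ N) (hf : ContDiffOn ℝ ∞ f N) :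
    DifferentiableAt ℝ f y := H.differentiableAt hy hf
  have sK : ContDiffOn ℝ ∞ (fun z => Real.sqrt (K z)) N :=
    H.smooth_K.sqrt fun y hy => (H.K_pos y hy).ne'
  have hk2 : ∀ z ∈ N, Real.sqrt (K z) ^ 2 = K z := fun z hz => Real.sq_sqrt (H.K_pos z hz).le
  have hk0 : ∀ z ∈ N, Real.sqrt (K z) ≠ 0 := fun z hz => (Real.sqrt_pos.mpr (H.K_pos z hz)).ne'
  have h4K : ∀ z ∈ N, 4 * K z ≠ 0 := fun z hz => by have := H.K_pos z hz; positivity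
  -- From K = k² and dK = Rμ = RF e₂, the equation dk = 2kp e₂ forces p = RF/(4K). Then q is its
  -- derivative along e₂, computed from dF = lam e₂ and dR = BF e₂; the boosted connection form is
  -- (lam/F) e₁.
  have sp : ContDiffOn ℝ ∞ (fun z => R z * F z / (4 * K z)) N :=
    (H.smooth_R.mul sF).div (contDiffOn_const.mul H.smooth_K) h4K
  have sq : ContDiffOn ℝ ∞ (fun z => F z * ((B z * F z + R z * lam z / F z) / (4 * K z)
      - R z ^ 2 * F z / (4 * K z * K z))) N :=
    sF.mul ((((H.smooth_B.mul sF).add ((H.smooth_R.mul H.smooth_lam).div sF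
      fun z hz => (hb z hz).1.ne')).div (contDiffOn_const.mul H.smooth_K) h4K).sub
      (((H.smooth_R.pow 2).mul sF).div ((contDiffOn_const.mul H.smooth_K).mul H.smooth_K)
        fun z hz => mul_ne_zero (h4K z hz) (H.K_pos z hz).ne'))
  have sh : ContDiffOn ℝ ∞ (fun z => lam z / F z) N :=
    H.smooth_lam.div sF fun z hz => (hb z hz).1.ne'
  set T₁ : E → E →L[ℝ] ℝ := fun z => C z • t 1 z + S z • t 2 z with hT₁
  set T₂ : E → E →L[ℝ] ℝ := fun z => S z • t 1 z + C z • t 2 z with hT₂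
  set e₁ : E → E →L[ℝ] ℝ := fun z => C z • η₁ z + S z • η₂ z with he₁
  set e₂ : E → E →L[ℝ] ℝ := fun z => S z • η₁ z + C z • η₂ z with he₂
  -- The forms π₁, π₂ are boosted by the inverse matrix, which preserves π₁ ∧ η₁ + π₂ ∧ η₂.
  set p₁ : E → E →L[ℝ] ℝ := fun z => C z • π₁ z + (-S z) • π₂ z with hp₁
  set p₂ : E → E →L[ℝ] ℝ := fun z => (-S z) • π₁ z + C z • π₂ z with hp₂
  have sT₁ : ContDiffOn ℝ ∞ T₁ N := (sC.smul (H.smooth_t 1)).add (sS.smul (H.smooth_t 2))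
  have sT₂ : ContDiffOn ℝ ∞ T₂ N := (sS.smul (H.smooth_t 1)).add (sC.smul (H.smooth_t 2))
  have se₁ : ContDiffOn ℝ ∞ e₁ N := (sC.smul H.smooth_η₁).add (sS.smul H.smooth_η₂)
  have se₂ : ContDiffOn ℝ ∞ e₂ N := (sS.smul H.smooth_η₁).add (sC.smul H.smooth_η₂)
  have sp₁ : ContDiffOn ℝ ∞ p₁ N := (sC.smul H.smooth_π₁).add (sS.neg.smul H.smooth_π₂)
  have sp₂ : ContDiffOn ℝ ∞ p₂ N := (sS.neg.smul H.smooth_π₁).add (sC.smul H.smooth_π₂)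
  have hnS : ∀ z u, fderiv ℝ (fun z => -S z) z u = -fderiv ℝ S z u := fun z u => by
    rw [fderiv_fun_neg]; rfl
  have hCT : ∀ z ∈ N, ∀ Z, evC (complexify T₁ z) Z
      = C z * evC (complexify (t 1) z) Z + S z * evC (complexify (t 2) z) Z := by
    intro z _ Z
    simp [evC, complexify, T₁]
    ring
  have hST : ∀ z ∈ N, ∀ Z, evC (complexify T₂ z) Z
      = S z * evC (complexify (t 1) z) Z + C z * evC (complexify (t 2) z) Z := by
    intro z _ Z
    simp [evC, complexify, T₂]
    ring
  have hframe : IsAdaptedFrame N ![complexify (t 0), complexify T₁, complexify T₂, complexify (t 3)]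
      (complexify e₁) (complexify e₂) (complexify p₁) (complexify p₂)
      (fun z => (Real.sqrt (K z) : ℂ)) (fun z => ((R z * F z / (4 * K z) : ℝ) : ℂ))
      (fun z => ((F z * ((B z * F z + R z * lam z / F z) / (4 * K z)
        - R z ^ 2 * F z / (4 * K z * K z)) : ℝ) : ℂ)) (fun z => ((lam z / F z : ℝ) : ℂ)) :=
    { isOpen := H.isOpen
      smooth_θ := by
        intro i
        fin_cases i
        · exact contDiffOn_complexify (H.smooth_t 0)
        · exact contDiffOn_complexify sT₁
        · exact contDiffOn_complexify sT₂
        · exact contDiffOn_complexify (H.smooth_t 3)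
      smooth_η₁ := contDiffOn_complexify se₁
      smooth_η₂ := contDiffOn_complexify se₂
      smooth_π₁ := contDiffOn_complexify sp₁
      smooth_π₂ := contDiffOn_complexify sp₂
      smooth_k := contDiffOn_ofReal sK
      smooth_p := contDiffOn_ofReal sp
      smooth_q := contDiffOn_ofReal sq
      smooth_h := contDiffOn_ofReal sh
      k_ne_zero := fun z hz => by exact_mod_cast hk0 z hz
      finrank_eq := by rw [finrank_complex_dual, hE]
      indep := by
        intro z hz
        have hker : ∀ u, (∀ i, ![t 0 z, T₁ z, T₂ z, t 3 z, e₁ z, e₂ z, p₁ z, p₂ z] i u = 0) →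
            u = 0 := by
          intro u hu
          obtain ⟨-, -, -, hCS, -⟩ := hb z hz
          have a0 : t 0 z u = 0 := hu 0
          have a1 : C z * t 1 z u + S z * t 2 z u = 0 := hu 1
          have a2 : S z * t 1 z u + C z * t 2 z u = 0 := hu 2
          have a3 : t 3 z u = 0 := hu 3
          have a4 : C z * η₁ z u + S z * η₂ z u = 0 := hu 4
          have a5 : S z * η₁ z u + C z * η₂ z u = 0 := hu 5
          have a6 : C z * π₁ z u + (-S z) * π₂ z u = 0 := hu 6
          have a7 : (-S z) * π₁ z u + C z * π₂ z u = 0 := hu 7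
          refine H.indep z hz u ?_ ?_ ?_ ?_ ?_
          · intro i
            fin_cases i
            · exact a0
            · change t 1 z u = 0
              linear_combination C z * a1 - S z * a2 - t 1 z u * hCS
            · change t 2 z u = 0
              linear_combination C z * a2 - S z * a1 - t 2 z u * hCS
            · exact a3
          · linear_combination C z * a4 - S z * a5 - η₁ z u * hCS
          · linear_combination C z * a5 - S z * a4 - η₂ z u * hCS
          · linear_combination C z * a6 + S z * a7 - π₁ z u * hCS
          · linear_combination C z * a7 + S z * a6 - π₂ z u * hCS
        have := linearIndependent_ofReal hE hker
        convert this using 1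
        funext i
        fin_cases i <;> rfl
      extD_θ₀ := by
        intro z hz
        funext u v
        obtain ⟨-, -, -, hCS, -, hd⟩ := hb z hz
        have e : extD (t 0) z u v = -wedge (p₁ z) (e₁ z + T₁ z) u v
            - wedge (p₂ z) (e₂ z + T₂ z) u v := by
          rw [H.extD_t₀ z hz]
          simp only [wedge, add_apply, smul_apply, smul_eq_mul, hT₁, hT₂, he₁, he₂, hp₁, hp₂]
          linear_combination (π₁ z u * (t 1 z v + η₁ z v) - π₁ z v * (t 1 z u + η₁ z u)
            + π₂ z u * (t 2 z v + η₂ z v) - π₂ z v * (t 2 z u + η₂ z u)) * hCS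
        change extD (complexify (t 0)) z u v = _
        rw [extD_complexify (d' hz (H.smooth_t 0)), e]
        simp [wedge, complexify]
      extD_θ₁ := by
        intro z hz
        funext u v
        obtain ⟨-, -, -, hCS, -, hd⟩ := hb z hz
        have e : extD T₁ z u v = -wedge ((lam z / F z) • e₁ z) (T₂ z) u v
            - wedge (t 3 z) (e₂ z + T₂ z) u v - wedge (p₁ z) (t 0 z) u v := by
          rw [hT₁, extD_combination (d hz sC) (d hz sS) (d' hz (H.smooth_t 1)) (d' hz (H.smooth_t 2)),
            H.extD_t₁ z hz, H.extD_t₂ z hz, (hd u).2.1, (hd v).2.1, (hd u).2.2, (hd v).2.2]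
          simp only [wedge, add_apply, smul_apply, smul_eq_mul, hT₁, hT₂, he₁, he₂, hp₁, hp₂]
          ring
        change extD (complexify T₁) z u v = _
        rw [extD_complexify (d' hz sT₁), e]
        simp [wedge, complexify]
      extD_θ₂ := by
        intro z hz
        funext u v
        obtain ⟨-, -, -, hCS, -, hd⟩ := hb z hz
        have e : extD T₂ z u v = -wedge ((lam z / F z) • e₁ z) (T₁ z) u v
            - wedge (t 3 z) (e₁ z + T₁ z) u v + wedge (p₂ z) (t 0 z) u v := by
          rw [hT₂, extD_combination (d hz sS) (d hz sC) (d' hz (H.smooth_t 1)) (d' hz (H.smooth_t 2)),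
            H.extD_t₁ z hz, H.extD_t₂ z hz, (hd u).2.1, (hd v).2.1, (hd u).2.2, (hd v).2.2]
          simp only [wedge, add_apply, smul_apply, smul_eq_mul, hT₁, hT₂, he₁, he₂, hp₁, hp₂]
          ring
        change extD (complexify T₂) z u v = _
        rw [extD_complexify (d' hz sT₂), e]
        simp [wedge, complexify]
      extD_θ₃ := by
        intro z hz
        funext u v
        obtain ⟨-, -, -, hCS, -, hd⟩ := hb z hz
        have e : extD (t 3) z u v = -wedge (p₁ z) (p₂ z) u v
            + Real.sqrt (K z) ^ 2 * wedge (e₁ z) (e₂ z) u v := by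
          rw [H.extD_t₃ z hz, hk2 z hz]
          simp only [wedge, add_apply, smul_apply, smul_eq_mul, hT₁, hT₂, he₁, he₂, hp₁, hp₂]
          linear_combination (π₁ z u * π₂ z v - π₁ z v * π₂ z u
            - K z * (η₁ z u * η₂ z v - η₁ z v * η₂ z u)) * hCS
        change extD (complexify (t 3)) z u v = _
        rw [extD_complexify (d' hz (H.smooth_t 3)), e]
        simp [wedge, complexify]
      extD_η₁ := by
        intro z hz
        funext u v
        obtain ⟨-, -, -, hCS, -, hd⟩ := hb z hz
        have e : extD e₁ z u v = -(lam z / F z * wedge (e₁ z) (e₂ z) u v) := by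
          rw [he₁, extD_combination (d hz sC) (d hz sS) (d' hz H.smooth_η₁) (d' hz H.smooth_η₂),
            H.extD_η₁ z hz, H.extD_η₂ z hz, (hd u).2.1, (hd v).2.1, (hd u).2.2, (hd v).2.2]
          simp only [wedge, add_apply, smul_apply, smul_eq_mul, hT₁, hT₂, he₁, he₂, hp₁, hp₂]
          ring
        rw [extD_complexify (d' hz se₁), e]
        simp [wedge, complexify]
      extD_η₂ := by
        intro z hz
        funext u v
        obtain ⟨-, -, -, hCS, -, hd⟩ := hb z hz
        have e : extD e₂ z u v = 0 := by
          rw [he₂, extD_combination (d hz sS) (d hz sC) (d' hz H.smooth_η₁) (d' hz H.smooth_η₂),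
            H.extD_η₁ z hz, H.extD_η₂ z hz, (hd u).2.1, (hd v).2.1, (hd u).2.2, (hd v).2.2]
          simp only [wedge, add_apply, smul_apply, smul_eq_mul, hT₁, hT₂, he₁, he₂, hp₁, hp₂]
          ring
        rw [extD_complexify (d' hz se₂), e]
        simp
      extD_π₁ := by
        intro z hz
        funext u v
        obtain ⟨-, -, -, hCS, -, hd⟩ := hb z hz
        have e : extD p₁ z u v = -wedge (p₂ z) ((lam z / F z) • e₁ z + t 3 z) u v := by
          rw [hp₁, extD_combination (d hz sC) (d hz sS.neg) (d' hz H.smooth_π₁) (d' hz H.smooth_π₂),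
            H.extD_π₁ z hz, H.extD_π₂ z hz, hnS, hnS, (hd u).2.1, (hd v).2.1, (hd u).2.2,
            (hd v).2.2]
          simp only [wedge, add_apply, smul_apply, smul_eq_mul, hT₁, hT₂, he₁, he₂, hp₁, hp₂]
          ring
        rw [extD_complexify (d' hz sp₁), e]
        simp [wedge, complexify]
      extD_π₂ := by
        intro z hz
        funext u v
        obtain ⟨-, -, -, hCS, -, hd⟩ := hb z hz
        have e : extD p₂ z u v = -wedge (p₁ z) ((lam z / F z) • e₁ z + t 3 z) u v := by
          rw [hp₂, extD_combination (d hz sS.neg) (d hz sC) (d' hz H.smooth_π₁) (d' hz H.smooth_π₂),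
            H.extD_π₁ z hz, H.extD_π₂ z hz, hnS, hnS, (hd u).2.1, (hd v).2.1, (hd u).2.2,
            (hd v).2.2]
          simp only [wedge, add_apply, smul_apply, smul_eq_mul, hT₁, hT₂, he₁, he₂, hp₁, hp₂]
          ring
        rw [extD_complexify (d' hz sp₂), e]
        simp [wedge, complexify]
      fderiv_k := by
        intro z hz
        obtain ⟨hF, hx1, hx2, hCS, -, hd⟩ := hb z hz
        ext u
        have h0 := hk0 z hz
        have e : fderiv ℝ (fun z => Real.sqrt (K z)) z u
            = 2 * Real.sqrt (K z) * (R z * F z / (4 * K z)) * e₂ z u := by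
          have h1 : fderiv ℝ (fun z => Real.sqrt (K z)) z = _ :=
            ((d hz H.smooth_K).hasFDerivAt.sqrt (H.K_pos z hz).ne').fderiv
          rw [h1]
          simp only [smul_apply, smul_eq_mul, add_apply, he₂, H.fderiv_K z hz, hx1, hx2]
          rw [← hk2 z hz, Real.sqrt_sq (Real.sqrt_nonneg _)]
          field_simp
          ring
        rw [fderiv_ofReal (d hz sK), e]
        simp [complexify]
      fderiv_p := by
        intro z hz
        obtain ⟨hF, hx1, hx2, hCS, -, hd⟩ := hb z hz
        ext u
        have h0 := (H.K_pos z hz).ne'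
        have e : fderiv ℝ (fun z => R z * F z / (4 * K z)) z u
            = F z * ((B z * F z + R z * lam z / F z) / (4 * K z)
              - R z ^ 2 * F z / (4 * K z * K z)) * e₂ z u := by
          rw [fderiv_div_apply ((d hz H.smooth_R).fun_mul (d hz sF)) ((d hz H.smooth_K).const_mul 4)
            (h4K z hz), fderiv_fun_mul (d hz H.smooth_R) (d hz sF), fderiv_const_mul (d hz H.smooth_K)]
          simp [he₂, H.fderiv_K z hz, H.fderiv_R z hz, hx1, hx2, (hd u).1]
          field_simp
          ring
        rw [fderiv_ofReal (d hz sp), e]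
        simp [complexify] }
  -- The boost replaces the two middle generators by combinations with the same span and leaves θ₀
  -- and θ₃ unchanged, so integrability in the original frame can be used.
  have hmain := hframe.mul_eq_sq_of_isDarbouxIntegrableNear hy (ϑ := fun i => complexify (t i))
    rfl rfl ?_ hD
  · filter_upwards [hmain, H.isOpen.mem_nhds hy] with z hz hzN
    have h1 : R z * F z / (4 * K z) * (lam z / F z) = Real.sqrt (K z) ^ 2 := by exact_mod_cast hz
    rw [hk2 z hzN] at h1
    have hF := (hb z hzN).1.ne'
    have h0 := (H.K_pos z hzN).ne'
    field_simp at h1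
    linarith
  · intro z hz Z
    obtain ⟨-, -, -, hCS, -⟩ := hb z hz
    have hCS' : (C z : ℂ) ^ 2 - (S z : ℂ) ^ 2 = 1 := by exact_mod_cast hCS
    constructor
    · intro h i
      have h1 := h 1
      have h2 := h 2
      fin_cases i
      · exact h 0
      · change evC (complexify T₁ z) Z = 0
        rw [hCT z hz, h1, h2]; simp
      · change evC (complexify T₂ z) Z = 0
        rw [hST z hz, h1, h2]; simp
      · exact h 3
    · intro h i
      have h1 : evC (complexify T₁ z) Z = 0 := h 1
      have h2 : evC (complexify T₂ z) Z = 0 := h 2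
      rw [hCT z hz] at h1
      rw [hST z hz] at h2
      fin_cases i
      · exact h 0
      · change evC (complexify (t 1) z) Z = 0
        linear_combination (C z : ℂ) * h1 - S z * h2 - evC (complexify (t 1) z) Z * hCS'
      · change evC (complexify (t 2) z) Z = 0
        linear_combination (C z : ℂ) * h2 - S z * h1 - evC (complexify (t 2) z) Z * hCS'
      · exact h 3

end IsKillingLift

end Lift

end DarbouxEmbedding

end

noncomputable section

namespace DarbouxEmbedding

/-! ### Pull-back to the product of the surface and the frame bundle -/

section Product

variable {E₁ E₂ : Type*} [NormedAddCommGroup E₁] [NormedSpace ℝ E₁] [NormedAddCommGroup E₂]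
  [NormedSpace ℝ E₂]

/-- The pull-back of a one-form from the first factor of a product. -/
def pullFst (E₂ : Type*) [NormedAddCommGroup E₂] [NormedSpace ℝ E₂] (α : E₁ → E₁ →L[ℝ] ℝ)
    (z : E₁ × E₂) : E₁ × E₂ →L[ℝ] ℝ := (α z.1).comp (ContinuousLinearMap.fst ℝ E₁ E₂)

/-- The pull-back of a one-form from the second factor of a product. -/
def pullSnd (E₁ : Type*) [NormedAddCommGroup E₁] [NormedSpace ℝ E₁] (α : E₂ → E₂ →L[ℝ] ℝ)
    (z : E₁ × E₂) : E₁ × E₂ →L[ℝ] ℝ := (α z.2).comp (ContinuousLinearMap.snd ℝ E₁ E₂)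

lemma pullFst_apply (α : E₁ → E₁ →L[ℝ] ℝ) (z u : E₁ × E₂) :
    pullFst E₂ α z u = α z.1 u.1 := rfl

lemma pullSnd_apply (α : E₂ → E₂ →L[ℝ] ℝ) (z u : E₁ × E₂) :
    pullSnd E₁ α z u = α z.2 u.2 := rfl

lemma differentiableAt_pullFst {α : E₁ → E₁ →L[ℝ] ℝ} {z : E₁ × E₂}
    (h : DifferentiableAt ℝ α z.1) : DifferentiableAt ℝ (pullFst E₂ α) z :=
  (DifferentiableAt.comp z h differentiableAt_fst).clm_comp (differentiableAt_const _)

lemma differentiableAt_pullSnd {α : E₂ → E₂ →L[ℝ] ℝ} {z : E₁ × E₂}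
    (h : DifferentiableAt ℝ α z.2) : DifferentiableAt ℝ (pullSnd E₁ α) z :=
  (DifferentiableAt.comp z h differentiableAt_snd).clm_comp (differentiableAt_const _)

lemma extD_pullFst {α : E₁ → E₁ →L[ℝ] ℝ} {z : E₁ × E₂} (h : DifferentiableAt ℝ α z.1)
    (u v : E₁ × E₂) : extD (pullFst E₂ α) z u v = extD α z.1 u.1 v.1 := by
  have h1 : fderiv ℝ (pullFst E₂ α) z = _ := ((h.hasFDerivAt.comp z hasFDerivAt_fst).clm_comp
    (hasFDerivAt_const (ContinuousLinearMap.fst ℝ E₁ E₂) z)).fderiv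
  simp [extD, h1]

lemma extD_pullSnd {α : E₂ → E₂ →L[ℝ] ℝ} {z : E₁ × E₂} (h : DifferentiableAt ℝ α z.2)
    (u v : E₁ × E₂) : extD (pullSnd E₁ α) z u v = extD α z.2 u.2 v.2 := by
  have h1 : fderiv ℝ (pullSnd E₁ α) z = _ := ((h.hasFDerivAt.comp z hasFDerivAt_snd).clm_comp
    (hasFDerivAt_const (ContinuousLinearMap.snd ℝ E₁ E₂) z)).fderiv
  simp [extD, h1]

lemma fderiv_comp_fst {f : E₁ → ℝ} {z : E₁ × E₂} (h : DifferentiableAt ℝ f z.1)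
    (u : E₁ × E₂) : fderiv ℝ (fun z : E₁ × E₂ => f z.1) z u = fderiv ℝ f z.1 u.1 := by
  have h1 : fderiv ℝ (fun z : E₁ × E₂ => f z.1) z = _ :=
    (h.hasFDerivAt.comp z hasFDerivAt_fst).fderiv
  simp [h1]

lemma contDiffOn_comp_fst {A : Type*} [NormedAddCommGroup A] [NormedSpace ℝ A] {f : E₁ → A}
    {U : Set E₁} (W : Set E₂) (h : ContDiffOn ℝ ∞ f U) :
    ContDiffOn ℝ ∞ (fun z : E₁ × E₂ => f z.1) (U ×ˢ W) :=
  h.comp contDiffOn_fst fun _ hz => hz.1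

lemma contDiffOn_pullFst {α : E₁ → E₁ →L[ℝ] ℝ} {U : Set E₁} (W : Set E₂)
    (h : ContDiffOn ℝ ∞ α U) : ContDiffOn ℝ ∞ (pullFst E₂ α) (U ×ˢ W) :=
  (contDiffOn_comp_fst W h).clm_comp contDiffOn_const

lemma contDiffOn_pullSnd {α : E₂ → E₂ →L[ℝ] ℝ} (U : Set E₁) {W : Set E₂}
    (h : ContDiffOn ℝ ∞ α W) : ContDiffOn ℝ ∞ (pullSnd E₁ α) (U ×ˢ W) :=
  ContDiffOn.clm_comp (h.comp contDiffOn_snd fun _ hz => hz.2) contDiffOn_const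

end Product

/-- The real generators of the isometric embedding system. -/
def realSystem (η₁ η₂ η₁₂ : Plane → Plane →L[ℝ] ℝ) (Ψ : FrameCoord → PointFrame) :
    Fin 4 → Plane × FrameCoord → Plane × FrameCoord →L[ℝ] ℝ :=
  ![fun z => pullSnd Plane (canonicalForm Ψ 2) z - pullFst FrameCoord 0 z,
    fun z => pullSnd Plane (canonicalForm Ψ 0) z - pullFst FrameCoord η₁ z,
    fun z => pullSnd Plane (canonicalForm Ψ 1) z - pullFst FrameCoord η₂ z,
    fun z => pullSnd Plane (connectionForm Ψ 0 1) z - pullFst FrameCoord η₁₂ z]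

lemma embeddingSystem_eq (η₁ η₂ η₁₂ : Plane → Plane →L[ℝ] ℝ) (Ψ : FrameCoord → PointFrame) :
    embeddingSystem η₁ η₂ η₁₂ Ψ = fun i => complexify (realSystem η₁ η₂ η₁₂ Ψ i) := by
  funext i
  fin_cases i <;> rfl

namespace IsKillingCoframe

variable {U : Set Plane} {η₁ η₂ η₁₂ : Plane → Plane →L[ℝ] ℝ} {x₁ x₂ lam K : Plane → ℝ} {y : Plane}

/-- The structure equations of the two factors are subtracted. The four generators, η₁, η₂ and ω³₁,
ω³₂ have no common zero: the first factor is killed by η₁, η₂, and the remaining six forms are then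
a coframe of the second. -/
lemma isKillingLift (H : IsKillingCoframe U η₁ η₂ η₁₂ x₁ x₂ lam K) (hKpos : ∀ y ∈ U, 0 < K y)
    {R B : Plane → ℝ} (hR : ContDiffOn ℝ ∞ R U) (hB : ContDiffOn ℝ ∞ B U)
    (dK : ∀ y ∈ U, ∀ a, fderiv ℝ K y a = R y * (x₁ y * η₂ y a - x₂ y * η₁ y a))
    (dR : ∀ y ∈ U, ∀ a, fderiv ℝ R y a = B y * (x₁ y * η₂ y a - x₂ y * η₁ y a))
    {W : Set FrameCoord} {Ψ : FrameCoord → PointFrame} (P : IsFrameParametrization W Ψ) :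
    IsKillingLift (U ×ˢ W) (realSystem η₁ η₂ η₁₂ Ψ) (pullFst FrameCoord η₁) (pullFst FrameCoord η₂)
      (pullFst FrameCoord η₁₂) (pullSnd Plane (connectionForm Ψ 2 0))
      (pullSnd Plane (connectionForm Ψ 2 1)) (fun z => x₁ z.1) (fun z => x₂ z.1) (fun z => lam z.1)
      (fun z => K z.1) (fun z => R z.1) (fun z => B z.1) := by
  have scan : ∀ i, ContDiffOn ℝ ∞ (canonicalForm Ψ i) W := fun i w hw =>
    (P.contDiffAt_canonicalForm hw i).contDiffWithinAt
  have scon : ∀ i j, ContDiffOn ℝ ∞ (connectionForm Ψ i j) W := fun i j w hw =>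
    (P.contDiffAt_connectionForm hw i j).contDiffWithinAt
  have s0 : ContDiffOn ℝ ∞ (0 : Plane → Plane →L[ℝ] ℝ) U := contDiffOn_const
  have d1 {α : Plane → Plane →L[ℝ] ℝ} {z : Plane × FrameCoord} (hz : z ∈ U ×ˢ W)
    (h : ContDiffOn ℝ ∞ α U) : DifferentiableAt ℝ α z.1 := H.differentiableAt hz.1 h
  have d1' {α : Plane → ℝ} {z : Plane × FrameCoord} (hz : z ∈ U ×ˢ W)
    (h : ContDiffOn ℝ ∞ α U) : DifferentiableAt ℝ α z.1 := H.differentiableAt hz.1 h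
  have d2 {α : FrameCoord → FrameCoord →L[ℝ] ℝ} {z : Plane × FrameCoord} (hz : z ∈ U ×ˢ W)
    (h : ContDiffOn ℝ ∞ α W) : DifferentiableAt ℝ α z.2 :=
    (h.contDiffAt (P.isOpen.mem_nhds hz.2)).differentiableAt (by simp)
  have key {α : Plane → Plane →L[ℝ] ℝ} {β : FrameCoord → FrameCoord →L[ℝ] ℝ}
      {z : Plane × FrameCoord} (hz : z ∈ U ×ˢ W) (hα : ContDiffOn ℝ ∞ α U)
      (hβ : ContDiffOn ℝ ∞ β W) (u v : Plane × FrameCoord) :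
      extD (fun z => pullSnd Plane β z - pullFst FrameCoord α z) z u v
        = extD β z.2 u.2 v.2 - extD α z.1 u.1 v.1 := by
    rw [extD_fun_sub (differentiableAt_pullSnd (d2 hz hβ)) (differentiableAt_pullFst (d1 hz hα)),
      extD_pullSnd (d2 hz hβ), extD_pullFst (d1 hz hα)]
  have z0 : ∀ y a b, extD (0 : Plane → Plane →L[ℝ] ℝ) y a b = 0 := by
    intro y a b
    simp [extD]
  refine
    { isOpen := H.isOpen.prod P.isOpen
      smooth_t := ?_
      smooth_η₁ := contDiffOn_pullFst W H.smooth_η₁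
      smooth_η₂ := contDiffOn_pullFst W H.smooth_η₂
      smooth_η₁₂ := contDiffOn_pullFst W H.smooth_η₁₂
      smooth_π₁ := contDiffOn_pullSnd U (scon 2 0)
      smooth_π₂ := contDiffOn_pullSnd U (scon 2 1)
      smooth_x₁ := contDiffOn_comp_fst W H.smooth_x₁
      smooth_x₂ := contDiffOn_comp_fst W H.smooth_x₂
      smooth_lam := contDiffOn_comp_fst W H.smooth_lam
      smooth_K := contDiffOn_comp_fst W H.smooth_K
      smooth_R := contDiffOn_comp_fst W hR
      smooth_B := contDiffOn_comp_fst W hB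
      pos := fun z hz => H.pos z.1 hz.1
      K_pos := fun z hz => hKpos z.1 hz.1
      indep := ?_
      extD_t₀ := ?_
      extD_t₁ := ?_
      extD_t₂ := ?_
      extD_t₃ := ?_
      extD_π₁ := ?_
      extD_π₂ := ?_
      extD_η₁ := fun z hz u v => by
        rw [extD_pullFst (d1 hz H.smooth_η₁), H.extD_η₁ z.1 hz.1]; rfl
      extD_η₂ := fun z hz u v => by
        rw [extD_pullFst (d1 hz H.smooth_η₂), H.extD_η₂ z.1 hz.1]; rfl
      fderiv_x₁ := fun z hz u => by
        rw [fderiv_comp_fst (d1' hz H.smooth_x₁), H.fderiv_x₁ z.1 hz.1]; rfl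
      fderiv_x₂ := fun z hz u => by
        rw [fderiv_comp_fst (d1' hz H.smooth_x₂), H.fderiv_x₂ z.1 hz.1]; rfl
      fderiv_lam := fun z hz u => by
        rw [fderiv_comp_fst (d1' hz H.smooth_lam), H.fderiv_lam z.1 hz.1]; rfl
      fderiv_K := fun z hz u => by
        rw [fderiv_comp_fst (d1' hz H.smooth_K), dK z.1 hz.1]; rfl
      fderiv_R := fun z hz u => by
        rw [fderiv_comp_fst (d1' hz hR), dR z.1 hz.1]; rfl }
  · intro i
    fin_cases i
    · exact (contDiffOn_pullSnd U (scan 2)).sub (contDiffOn_pullFst W s0)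
    · exact (contDiffOn_pullSnd U (scan 0)).sub (contDiffOn_pullFst W H.smooth_η₁)
    · exact (contDiffOn_pullSnd U (scan 1)).sub (contDiffOn_pullFst W H.smooth_η₂)
    · exact (contDiffOn_pullSnd U (scon 0 1)).sub (contDiffOn_pullFst W H.smooth_η₁₂)
  · intro z hz u ht h1 h2 h3 h4
    have hu1 : u.1 = 0 := H.indep z.1 hz.1 u.1 h1 h2
    have t0 : canonicalForm Ψ 2 z.2 u.2 - (0 : Plane →L[ℝ] ℝ) u.1 = 0 := ht 0
    have t1 : canonicalForm Ψ 0 z.2 u.2 - η₁ z.1 u.1 = 0 := ht 1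
    have t2 : canonicalForm Ψ 1 z.2 u.2 - η₂ z.1 u.1 = 0 := ht 2
    have t3 : connectionForm Ψ 0 1 z.2 u.2 - η₁₂ z.1 u.1 = 0 := ht 3
    rw [hu1, map_zero, sub_zero] at t0 t1 t2 t3
    refine Prod.ext hu1 (P.eq_zero_of_forms_eq_zero hz.2 ?_ t3 h3 h4)
    intro i
    fin_cases i
    · exact t1
    · exact t2
    · exact t0
  · intro z hz u v
    refine (key hz s0 (scan 2) u v).trans ?_
    rw [z0, (P.structure_equations hz.2 u.2 v.2).2.2.1]
    simp only [wedge, realSystem, pullFst_apply, pullSnd_apply, add_apply, sub_apply,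
      Matrix.cons_val_zero, Matrix.cons_val_one, Matrix.cons_val]
    ring
  · intro z hz u v
    refine (key hz H.smooth_η₁ (scan 0) u v).trans ?_
    rw [H.extD_η₁ z.1 hz.1, (P.structure_equations hz.2 u.2 v.2).1]
    simp only [wedge, realSystem, pullFst_apply, pullSnd_apply, add_apply, sub_apply,
      Matrix.cons_val_zero, Matrix.cons_val_one, Matrix.cons_val, Pi.zero_apply, zero_apply]
    ring
  · intro z hz u v
    refine (key hz H.smooth_η₂ (scan 1) u v).trans ?_
    rw [H.extD_η₂ z.1 hz.1, (P.structure_equations hz.2 u.2 v.2).2.1]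
    simp only [wedge, realSystem, pullFst_apply, pullSnd_apply, add_apply, sub_apply,
      Matrix.cons_val_zero, Matrix.cons_val_one, Matrix.cons_val, Pi.zero_apply, zero_apply]
    ring
  · intro z hz u v
    refine (key hz H.smooth_η₁₂ (scon 0 1) u v).trans ?_
    rw [H.extD_η₁₂ z.1 hz.1, (P.structure_equations hz.2 u.2 v.2).2.2.2.1]
    simp only [wedge, pullFst_apply, pullSnd_apply]
    ring
  · intro z hz u v
    rw [extD_pullSnd (d2 hz (scon 2 0)), (P.structure_equations hz.2 u.2 v.2).2.2.2.2.1]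
    simp only [wedge, realSystem, pullFst_apply, pullSnd_apply, add_apply, sub_apply,
      Matrix.cons_val_zero, Matrix.cons_val_one, Matrix.cons_val]
    ring
  · intro z hz u v
    rw [extD_pullSnd (d2 hz (scon 2 1)), (P.structure_equations hz.2 u.2 v.2).2.2.2.2.2]
    simp only [wedge, realSystem, pullFst_apply, pullSnd_apply, add_apply, sub_apply,
      Matrix.cons_val_zero, Matrix.cons_val_one, Matrix.cons_val]
    ring

/-- The equation obtained on the product involves only functions of the first factor, so it is
restricted to the slice through w. -/
theorem eventually_lam_mul_eq (H : IsKillingCoframe U η₁ η₂ η₁₂ x₁ x₂ lam K)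
    (hKpos : ∀ y ∈ U, 0 < K y) {R : Plane → ℝ} (hR : ContDiffOn ℝ ∞ R U)
    (dK : ∀ y ∈ U, ∀ a, fderiv ℝ K y a = R y * (x₁ y * η₂ y a - x₂ y * η₁ y a))
    {W : Set FrameCoord} {Ψ : FrameCoord → PointFrame} (P : IsFrameParametrization W Ψ)
    (hy : y ∈ U) {w : FrameCoord} (hw : w ∈ W)
    (hD : IsDarbouxIntegrableNear (embeddingSystem η₁ η₂ η₁₂ Ψ) (y, w)) :
    ∀ᶠ z in 𝓝 y, lam z * R z = 4 * K z ^ 2 := by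
  obtain ⟨B, hB, dR⟩ := H.exists_fderiv_eq H.smooth_K hR dK
  rw [embeddingSystem_eq] at hD
  have hev := (H.isKillingLift hKpos hR hB dK dR P).mul_eq_of_isDarbouxIntegrableNear
    (by simp) (Set.mk_mem_prod hy hw) hD
  have hc : Filter.Tendsto (fun z : Plane => (z, w)) (𝓝 y) (𝓝 (y, w)) :=
    (Continuous.prodMk_left w).continuousAt
  exact hc.eventually hev

end IsKillingCoframe

end DarbouxEmbedding

end

noncomputable section

namespace DarbouxEmbedding

/-! ## The normal form near a point -/

/-- The smooth inverse function theorem in the plane. -/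
lemma exists_openPartialHomeomorph {f : Plane → Plane} {V : Set Plane} (hV : IsOpen V)
    (hf : ContDiffOn ℝ ∞ f V) (hinj : ∀ y ∈ V, ∀ a, fderiv ℝ f y a = 0 → a = 0) {y₀ : Plane}
    (hy₀ : y₀ ∈ V) : ∃ ψ : OpenPartialHomeomorph Plane Plane, y₀ ∈ ψ.source ∧ ψ.source ⊆ V ∧
      (∀ y, ψ y = f y) ∧ ContDiffOn ℝ ∞ ψ.symm ψ.target := by
  have hc : ∀ y ∈ V, ContDiffAt ℝ ∞ f y := fun y hy => hf.contDiffAt (hV.mem_nhds hy)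
  have hequiv : ∀ y ∈ V, ∃ e : Plane ≃L[ℝ] Plane, HasFDerivAt f (e : Plane →L[ℝ] Plane) y := by
    intro y hy
    have hi : Function.Injective (fderiv ℝ f y : Plane →ₗ[ℝ] Plane) := by
      rw [← LinearMap.ker_eq_bot, LinearMap.ker_eq_bot']
      exact hinj y hy
    refine ⟨(LinearEquiv.ofInjectiveEndo _ hi).toContinuousLinearEquiv, ?_⟩
    have : ((LinearEquiv.ofInjectiveEndo _ hi).toContinuousLinearEquiv : Plane →L[ℝ] Plane)
        = fderiv ℝ f y := by
      ext; rfl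
    rw [this]
    exact ((hc y hy).differentiableAt (by simp)).hasFDerivAt
  obtain ⟨e, he⟩ := hequiv y₀ hy₀
  set ψ₀ := (hc y₀ hy₀).toOpenPartialHomeomorph f he (by simp) with hψ₀
  refine ⟨ψ₀.restrOpen V hV, ?_, ?_, fun y => rfl, ?_⟩
  · exact ⟨(hc y₀ hy₀).mem_toOpenPartialHomeomorph_source he (by simp), hy₀⟩
  · exact fun y hy => hy.2
  · intro z hz
    have hm : (ψ₀.restrOpen V hV).symm z ∈ V := ((ψ₀.restrOpen V hV).map_target hz).2
    obtain ⟨e', he'⟩ := hequiv _ hm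
    exact ((ψ₀.restrOpen V hV).contDiffAt_symm hz he' (hc _ hm)).contDiffWithinAt

lemma fderiv_toLp_apply {u v : Plane → ℝ} {y : Plane} (hu : DifferentiableAt ℝ u y)
    (hv : DifferentiableAt ℝ v y) (a : Plane) :
    fderiv ℝ (fun z => (!₂[u z, v z] : Plane)) y a = !₂[fderiv ℝ u y a, fderiv ℝ v y a] := by
  have h : HasFDerivAt (fun z => (!₂[u z, v z] : Plane)) (fderiv ℝ (fun z => (!₂[u z, v z] : Plane)) y) y := by
    apply DifferentiableAt.hasFDerivAt
    rw [differentiableAt_euclidean]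
    intro i
    fin_cases i
    · exact hu
    · exact hv
  have hp : ∀ i : Fin 2, fderiv ℝ (fun z => (!₂[u z, v z] : Plane) i) y a
      = (fderiv ℝ (fun z => (!₂[u z, v z] : Plane)) y a) i := fun i =>
    congrArg (fun L : Plane →L[ℝ] ℝ => L a)
      ((EuclideanSpace.proj (𝕜 := ℝ) i : Plane →L[ℝ] ℝ).hasFDerivAt.comp y h).fderiv
  ext i
  fin_cases i
  · exact (hp 0).symm
  · exact (hp 1).symm

/-- The scale of a metric of the normal form, as a function of the square of the length of a Killing
field, of the square of the invariant `lam`, and of the curvature. -/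
def metricScale (Q L K : ℝ) : ℝ := K / L ^ 2 * (Q + L / K) ^ 2

namespace IsKillingCoframe

variable {U : Set Plane} {η₁ η₂ η₁₂ : Plane → Plane →L[ℝ] ℝ} {x₁ x₂ lam K : Plane → ℝ} {y : Plane}

lemma fderiv_Q (H : IsKillingCoframe U η₁ η₂ η₁₂ x₁ x₂ lam K) (hy : y ∈ U) (a : Plane) :
    fderiv ℝ (fun z => x₁ z ^ 2 - x₂ z ^ 2) y a
      = 2 * lam y * (x₁ y * η₂ y a - x₂ y * η₁ y a) := by
  have h1 := (H.differentiableAt hy H.smooth_x₁).hasFDerivAt.pow 2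
  have h2 := (H.differentiableAt hy H.smooth_x₂).hasFDerivAt.pow 2
  rw [(h1.fun_sub h2).fderiv]
  simp [H.fderiv_x₁ y hy, H.fderiv_x₂ y hy]
  ring

/-- This is g(X, ·)/g(X, X), with value 1 on X. Its potential is, up to a constant factor, the
coordinate v. -/
lemma extD_nu_div (H : IsKillingCoframe U η₁ η₂ η₁₂ x₁ x₂ lam K) (hy : y ∈ U) (a b : Plane) :
    extD (fun z => (x₁ z ^ 2 - x₂ z ^ 2)⁻¹ • (x₁ z • η₁ z - x₂ z • η₂ z)) y a b = 0 := by
  have d {A : Type} [NormedAddCommGroup A] [NormedSpace ℝ A] {f : Plane → A}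
      (hf : ContDiffOn ℝ ∞ f U) := H.differentiableAt hy hf
  have hQ : DifferentiableAt ℝ (fun z => x₁ z ^ 2 - x₂ z ^ 2) y :=
    d ((H.smooth_x₁.pow 2).sub (H.smooth_x₂.pow 2))
  have h0 := (H.pos y hy).ne'
  have hi : ∀ a, fderiv ℝ (fun z => (x₁ z ^ 2 - x₂ z ^ 2)⁻¹) y a
      = -(2 * lam y * (x₁ y * η₂ y a - x₂ y * η₁ y a)) / (x₁ y ^ 2 - x₂ y ^ 2) ^ 2 := by
    intro a
    have h1 : HasFDerivAt (fun z => (x₁ z ^ 2 - x₂ z ^ 2)⁻¹) _ y :=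
      (hasDerivAt_inv h0).comp_hasFDerivAt y hQ.hasFDerivAt
    rw [h1.fderiv]
    simp only [smul_apply, H.fderiv_Q hy, smul_eq_mul]
    ring
  rw [extD_fun_smul (hQ.fun_inv h0) (((d H.smooth_x₁).fun_smul (d H.smooth_η₁)).fun_sub
      ((d H.smooth_x₂).fun_smul (d H.smooth_η₂))), hi, hi,
    extD_fun_sub ((d H.smooth_x₁).fun_smul (d H.smooth_η₁))
      ((d H.smooth_x₂).fun_smul (d H.smooth_η₂)),
    extD_fun_smul (d H.smooth_x₁) (d H.smooth_η₁), extD_fun_smul (d H.smooth_x₂) (d H.smooth_η₂),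
    H.extD_η₁ y hy, H.extD_η₂ y hy, H.fderiv_x₁ y hy, H.fderiv_x₁ y hy, H.fderiv_x₂ y hy,
    H.fderiv_x₂ y hy]
  simp only [wedge, sub_apply, smul_apply, smul_eq_mul]
  field_simp
  ring

variable {R : Plane → ℝ}

/-- In a parameter with differential μ, Q' = 2 lam, lam' = K and K' = R = 4K²/lam. The two functions
are first integrals of this ordinary differential equation. -/
lemma fderiv_invariants (H : IsKillingCoframe U η₁ η₂ η₁₂ x₁ x₂ lam K) (hK : ∀ y ∈ U, K y ≠ 0)
    (hlam : ∀ y ∈ U, lam y ≠ 0)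
    (dK : ∀ y ∈ U, ∀ a, fderiv ℝ K y a = R y * (x₁ y * η₂ y a - x₂ y * η₁ y a))
    (hR : ∀ y ∈ U, lam y * R y = 4 * K y ^ 2) (hy : y ∈ U) :
    fderiv ℝ (fun z => K z / lam z ^ 4) y = 0 ∧
    fderiv ℝ (fun z => x₁ z ^ 2 - x₂ z ^ 2 + lam z ^ 2 / K z) y = 0 := by
  have dl := H.differentiableAt hy H.smooth_lam
  have dk := H.differentiableAt hy H.smooth_K
  have hQ : DifferentiableAt ℝ (fun z => x₁ z ^ 2 - x₂ z ^ 2) y :=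
    H.differentiableAt hy ((H.smooth_x₁.pow 2).sub (H.smooth_x₂.pow 2))
  have k0 := hK y hy
  have l0 := hlam y hy
  have hR' : R y = 4 * K y ^ 2 / lam y := by rw [← hR y hy]; field_simp
  have p : ∀ (n : ℕ) a, fderiv ℝ (fun z => lam z ^ n) y a
      = n * lam y ^ (n - 1) * (K y * (x₁ y * η₂ y a - x₂ y * η₁ y a)) := by
    intro n a
    rw [(dl.hasFDerivAt.pow n).fderiv]
    simp [H.fderiv_lam y hy]
  constructor
  · ext a
    rw [fderiv_div_apply dk (dl.fun_pow 4) (pow_ne_zero 4 l0), p, dK y hy, hR', zero_apply]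
    field_simp
    push_cast
    ring
  · ext a
    have hd : DifferentiableAt ℝ (fun z => lam z ^ 2 / K z) y :=
      H.differentiableAt hy ((H.smooth_lam.pow 2).div H.smooth_K hK)
    rw [fderiv_fun_add hQ hd, add_apply, H.fderiv_Q hy,
      fderiv_div_apply (dl.fun_pow 2) dk k0, p, dK y hy, hR', zero_apply]
    field_simp
    push_cast
    ring

/-- With c₀ = K/lam⁴ and d₀ = Q + lam²/K constant, sin²u = Q/d₀ gives cos²u = lam²/(K d₀), and the
metric (ν² - μ²)/Q splits into its du and dv parts with common factor c₀d₀². -/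
theorem exists_normal_coordinates (H : IsKillingCoframe U η₁ η₂ η₁₂ x₁ x₂ lam K)
    (hK : ∀ y ∈ U, 0 < K y)
    (dK : ∀ y ∈ U, ∀ a, fderiv ℝ K y a = R y * (x₁ y * η₂ y a - x₂ y * η₁ y a))
    (hR : ∀ y ∈ U, lam y * R y = 4 * K y ^ 2) {y₀ : Plane} (hy₀ : y₀ ∈ U) :
    ∃ ψ : OpenPartialHomeomorph Plane Plane, y₀ ∈ ψ.source ∧ ψ.source ⊆ U ∧
      ContDiffOn ℝ ∞ ψ ψ.source ∧ ContDiffOn ℝ ∞ ψ.symm ψ.target ∧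
      0 < metricScale (x₁ y₀ ^ 2 - x₂ y₀ ^ 2) (lam y₀ ^ 2) (K y₀) ∧
      ∀ y ∈ ψ.source, lam y ≠ 0 ∧ metricScale (x₁ y ^ 2 - x₂ y ^ 2) (lam y ^ 2) (K y)
          = metricScale (x₁ y₀ ^ 2 - x₂ y₀ ^ 2) (lam y₀ ^ 2) (K y₀) ∧
        0 < ψ y 0 ∧ ψ y 0 < Real.pi / 2 ∧
        (∀ a b, η₁ y a * η₁ y b - η₂ y a * η₂ y b
          = metricScale (x₁ y₀ ^ 2 - x₂ y₀ ^ 2) (lam y₀ ^ 2) (K y₀)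
            * normalForm (ψ y) (fderiv ℝ ψ y a) (fderiv ℝ ψ y b)) ∧
        K y = 1 / (metricScale (x₁ y₀ ^ 2 - x₂ y₀ ^ 2) (lam y₀ ^ 2) (K y₀)
          * Real.cos (ψ y 0) ^ 4) := by
  -- A zero of `lam` would give 4K² = 0, against K > 0.
  have hlam : ∀ y ∈ U, lam y ≠ 0 := by
    intro y hy h
    have := hR y hy
    have := hK y hy
    rw [h] at *
    nlinarith
  obtain ⟨r, hr, hrU⟩ := Metric.isOpen_iff.mp H.isOpen y₀ hy₀
  -- A ball serves twice: its connectedness makes the first integrals constant, and its convexity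
  -- gives a potential of the closed form τ.
  set V := Metric.ball y₀ r with hV
  have hVo : IsOpen V := Metric.isOpen_ball
  have hy₀V : y₀ ∈ V := Metric.mem_ball_self hr
  have sQ : ContDiffOn ℝ ∞ (fun z => x₁ z ^ 2 - x₂ z ^ 2) U :=
    (H.smooth_x₁.pow 2).sub (H.smooth_x₂.pow 2)
  set c₀ := K y₀ / lam y₀ ^ 4 with hc₀
  set d₀ := x₁ y₀ ^ 2 - x₂ y₀ ^ 2 + lam y₀ ^ 2 / K y₀ with hd₀
  have c₀pos : 0 < c₀ := by
    have := hK y₀ hy₀; have := hlam y₀ hy₀; positivity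
  have d₀pos : 0 < d₀ := by
    have := hK y₀ hy₀; have := hlam y₀ hy₀; have := H.pos y₀ hy₀; positivity
  have hscale : metricScale (x₁ y₀ ^ 2 - x₂ y₀ ^ 2) (lam y₀ ^ 2) (K y₀) = c₀ * d₀ ^ 2 := by
    simp only [metricScale, hc₀, hd₀]
    ring
  have hconst : ∀ y ∈ V, K y / lam y ^ 4 = c₀ ∧ x₁ y ^ 2 - x₂ y ^ 2 + lam y ^ 2 / K y = d₀ := by
    have hfd := fun y (hy : y ∈ V) => H.fderiv_invariants (fun y hy => (hK y hy).ne') hlam dK hR (hrU hy)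
    intro y hy
    constructor
    · refine hVo.is_const_of_fderiv_eq_zero (f := fun z => K z / lam z ^ 4)
        (convex_ball y₀ r).isPreconnected ?_ (fun z hz => (hfd z hz).1) hy hy₀V
      exact ((H.smooth_K.div (H.smooth_lam.pow 4) fun z hz => pow_ne_zero 4 (hlam z hz)).mono
        hrU).differentiableOn (by simp)
    · refine hVo.is_const_of_fderiv_eq_zero (f := fun z => x₁ z ^ 2 - x₂ z ^ 2 + lam z ^ 2 / K z)
        (convex_ball y₀ r).isPreconnected ?_ (fun z hz => (hfd z hz).2) hy hy₀V
      exact ((sQ.add ((H.smooth_lam.pow 2).div H.smooth_K fun z hz => (hK z hz).ne')).mono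
        hrU).differentiableOn (by simp)
  set τ : Plane → Plane →L[ℝ] ℝ :=
    fun z => (x₁ z ^ 2 - x₂ z ^ 2)⁻¹ • (x₁ z • η₁ z - x₂ z • η₂ z) with hτ
  have sτ : ContDiffOn ℝ ∞ τ V := ((sQ.inv fun z hz => (H.pos z hz).ne').smul
    ((H.smooth_x₁.smul H.smooth_η₁).sub (H.smooth_x₂.smul H.smooth_η₂))).mono hrU
  obtain ⟨T, hT⟩ := (convex_ball y₀ r).exists_forall_hasFDerivAt_of_fderiv_symmetric hVo
    (sτ.differentiableOn (by simp)) (fun a ha u v => sub_eq_zero.mp (H.extD_nu_div (hrU ha) u v))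
  have sT : ContDiffOn ℝ ∞ T V := by
    rw [contDiffOn_infty_iff_fderiv_of_isOpen hVo]
    exact ⟨fun z hz => (hT z hz).differentiableAt.differentiableWithinAt,
      sτ.congr fun z hz => (hT z hz).fderiv⟩
  set u : Plane → ℝ := fun z => Real.arcsin (Real.sqrt ((x₁ z ^ 2 - x₂ z ^ 2) / d₀)) with hu
  -- The normalization √(c₀d₀) makes c₀d₀² sin²u dv² equal to ν²/Q.
  set v : Plane → ℝ := fun z => T z / Real.sqrt (c₀ * d₀) with hv
  have hfrac : ∀ y ∈ V, 0 < (x₁ y ^ 2 - x₂ y ^ 2) / d₀ ∧ (x₁ y ^ 2 - x₂ y ^ 2) / d₀ < 1 := by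
    intro y hy
    have h1 := H.pos y (hrU hy)
    refine ⟨div_pos h1 d₀pos, (div_lt_one d₀pos).mpr ?_⟩
    rw [← (hconst y hy).2]
    have := hK y (hrU hy)
    have := hlam y (hrU hy)
    have : 0 < lam y ^ 2 / K y := by positivity
    linarith
  have hsqrt : ∀ y ∈ V, 0 < Real.sqrt ((x₁ y ^ 2 - x₂ y ^ 2) / d₀) ∧
      Real.sqrt ((x₁ y ^ 2 - x₂ y ^ 2) / d₀) < 1 := fun y hy =>
    ⟨Real.sqrt_pos.mpr (hfrac y hy).1, by
      rw [Real.sqrt_lt' one_pos, one_pow]; exact (hfrac y hy).2⟩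
  have su : ContDiffOn ℝ ∞ u V := by
    have h1 : ContDiffOn ℝ ∞ (fun z => Real.sqrt ((x₁ z ^ 2 - x₂ z ^ 2) / d₀)) V :=
      ((sQ.mono hrU).div_const d₀).sqrt fun z hz => (hfrac z hz).1.ne'
    intro z hz
    exact ContDiffAt.comp_contDiffWithinAt (g := Real.arcsin) z (Real.contDiffAt_arcsin
      (by linarith [(hsqrt z hz).1]) (hsqrt z hz).2.ne) (h1 z hz)
  have sv : ContDiffOn ℝ ∞ v V := sT.div_const _
  have hu0 : ∀ y ∈ V, 0 < u y := fun y hy => Real.arcsin_pos.mpr (hsqrt y hy).1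
  have hu1 : ∀ y ∈ V, u y < Real.pi / 2 := fun y hy => Real.arcsin_lt_pi_div_two.mpr (hsqrt y hy).2
  have hsin : ∀ y ∈ V, Real.sin (u y) ^ 2 = (x₁ y ^ 2 - x₂ y ^ 2) / d₀ := by
    intro y hy
    simp only [hu]
    rw [Real.sin_arcsin (by linarith [(hsqrt y hy).1]) (hsqrt y hy).2.le, Real.sq_sqrt (hfrac y hy).1.le]
  have hcos : ∀ y ∈ V, Real.cos (u y) ^ 2 = lam y ^ 2 / (K y * d₀) := by
    intro y hy
    have h1 := Real.sin_sq_add_cos_sq (u y)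
    have h2 : d₀ - (x₁ y ^ 2 - x₂ y ^ 2) = lam y ^ 2 / K y := by linarith [(hconst y hy).2]
    have h3 := (hK y (hrU hy)).ne'
    rw [hsin y hy] at h1
    have h4 : Real.cos (u y) ^ 2 = (d₀ - (x₁ y ^ 2 - x₂ y ^ 2)) / d₀ := by
      rw [eq_sub_of_add_eq' h1]; field_simp
    rw [h4, h2]
    field_simp
  have sin0 : ∀ y ∈ V, 0 < Real.sin (u y) := fun y hy =>
    Real.sin_pos_of_pos_of_lt_pi (hu0 y hy) (by linarith [hu1 y hy, Real.pi_pos])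
  have cos0 : ∀ y ∈ V, 0 < Real.cos (u y) := fun y hy =>
    Real.cos_pos_of_mem_Ioo ⟨by linarith [hu0 y hy, Real.pi_pos], hu1 y hy⟩
  have dd : ∀ {f : Plane → ℝ}, ContDiffOn ℝ ∞ f V → ∀ {y}, y ∈ V → DifferentiableAt ℝ f y :=
    fun hf y hy => (hf.contDiffAt (hVo.mem_nhds hy)).differentiableAt (by simp)
  have hdu : ∀ y ∈ V, ∀ a, fderiv ℝ u y a = lam y * (x₁ y * η₂ y a - x₂ y * η₁ y a)
      / (d₀ * Real.sin (u y) * Real.cos (u y)) := by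
    intro y hy a
    have e1 : (fun z => Real.sin (u z) ^ 2) =ᶠ[𝓝 y] fun z => (x₁ z ^ 2 - x₂ z ^ 2) * d₀⁻¹ := by
      filter_upwards [hVo.mem_nhds hy] with z hz
      rw [hsin z hz]; rfl
    have e2 := congrArg (fun L : Plane →L[ℝ] ℝ => L a) (e1.fderiv_eq (𝕜 := ℝ))
    have h1 : HasFDerivAt (fun z => Real.sin (u z) ^ 2) _ y := (dd su hy).hasFDerivAt.sin.pow 2
    simp only [h1.fderiv] at e2
    rw [fderiv_mul_const (H.differentiableAt (hrU hy) sQ)] at e2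
    simp [H.fderiv_Q (hrU hy)] at e2
    have := (sin0 y hy).ne'
    have := (cos0 y hy).ne'
    field_simp at e2 ⊢
    linear_combination e2
  have hdv : ∀ y ∈ V, ∀ a, fderiv ℝ v y a = (x₁ y ^ 2 - x₂ y ^ 2)⁻¹
      * (x₁ y * η₁ y a - x₂ y * η₂ y a) / Real.sqrt (c₀ * d₀) := by
    intro y hy a
    have h1 : fderiv ℝ v y = _ := ((hT y hy).mul_const (Real.sqrt (c₀ * d₀))⁻¹).fderiv
    rw [h1]
    simp [hτ]
    ring
  have hs0 : 0 < Real.sqrt (c₀ * d₀) := Real.sqrt_pos.mpr (mul_pos c₀pos d₀pos)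
  have hs2 : Real.sqrt (c₀ * d₀) ^ 2 = c₀ * d₀ := Real.sq_sqrt (mul_pos c₀pos d₀pos).le
  have sf : ContDiffOn ℝ ∞ (fun z => (!₂[u z, v z] : Plane)) V := by
    rw [contDiffOn_euclidean]
    intro i
    fin_cases i
    · exact su
    · exact sv
  have hfd : ∀ y ∈ V, ∀ a, fderiv ℝ (fun z => (!₂[u z, v z] : Plane)) y a
      = !₂[fderiv ℝ u y a, fderiv ℝ v y a] := fun y hy a =>
    fderiv_toLp_apply (dd su hy) (dd sv hy) a
  obtain ⟨ψ, hψ1, hψ2, hψ3, hψ4⟩ := exists_openPartialHomeomorph hVo sf (by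
    intro y hy a ha
    rw [hfd y hy] at ha
    have a1 : fderiv ℝ u y a = 0 := congrArg (fun w : Plane => w 0) ha
    have a2 : fderiv ℝ v y a = 0 := congrArg (fun w : Plane => w 1) ha
    have := sin0 y hy
    have := cos0 y hy
    have hQ := (H.pos y (hrU hy)).ne'
    rw [hdu y hy, div_eq_zero_iff, or_iff_left (by positivity), mul_eq_zero,
      or_iff_right (hlam y (hrU hy))] at a1
    rw [hdv y hy, div_eq_zero_iff, or_iff_left hs0.ne', mul_eq_zero,
      or_iff_right (inv_ne_zero hQ)] at a2
    refine H.indep y (hrU hy) a ?_ ?_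
    · refine (mul_eq_zero.mp ?_).resolve_left hQ
      linear_combination x₁ y * a2 + x₂ y * a1
    · refine (mul_eq_zero.mp ?_).resolve_left hQ
      linear_combination x₁ y * a1 + x₂ y * a2) hy₀V
  have hψ : (ψ : Plane → Plane) = fun z => (!₂[u z, v z] : Plane) := funext hψ3
  refine ⟨ψ, hψ1, hψ2.trans hrU, hψ ▸ sf.mono hψ2, hψ4, ?_, ?_⟩
  · rw [hscale]; positivity
  · intro y hyψ
    have hy := hψ2 hyψ
    have k0 := (hK y (hrU hy)).ne'
    have l0 := hlam y (hrU hy)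
    have hQ := (H.pos y (hrU hy)).ne'
    obtain ⟨hc, hd⟩ := hconst y hy
    have hψ0 : ψ y 0 = u y := by rw [hψ3]; rfl
    refine ⟨l0, ?_, ?_, ?_, ?_, ?_⟩
    · rw [hscale, ← hc, ← hd]
      simp only [metricScale]
      ring
    · rw [hψ0]; exact hu0 y hy
    · rw [hψ0]; exact hu1 y hy
    · intro a b
      rw [hscale, hψ, hfd y hy, hfd y hy]
      simp only [normalForm]
      change _ = c₀ * d₀ ^ 2 * (Real.sin (u y) ^ 2 * (fderiv ℝ v y a * fderiv ℝ v y b)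
        - Real.cos (u y) ^ 4 * (fderiv ℝ u y a * fderiv ℝ u y b))
      rw [hdu y hy, hdu y hy, hdv y hy, hdv y hy]
      have s0 := (sin0 y hy).ne'
      have t0 := (cos0 y hy).ne'
      set s := Real.sin (u y)
      set t := Real.cos (u y)
      set q := Real.sqrt (c₀ * d₀)
      have hs := hsin y hy
      have ht := hcos y hy
      set Q := x₁ y ^ 2 - x₂ y ^ 2 with hQd
      -- The dv part is ν²/Q and the du part, treated next, is μ²/Q; their difference is the metric
      -- by the definition of Q.
      have e1 : c₀ * d₀ ^ 2 * (s ^ 2 * (Q⁻¹ * (x₁ y * η₁ y a - x₂ y * η₂ y a) / q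
          * (Q⁻¹ * (x₁ y * η₁ y b - x₂ y * η₂ y b) / q)))
          = (x₁ y * η₁ y a - x₂ y * η₂ y a) * (x₁ y * η₁ y b - x₂ y * η₂ y b) / Q := by
        have : q ≠ 0 := hs0.ne'
        have h2 : c₀ * d₀ ^ 2 * (s ^ 2 * (Q⁻¹ * (x₁ y * η₁ y a - x₂ y * η₂ y a) / q
          * (Q⁻¹ * (x₁ y * η₁ y b - x₂ y * η₂ y b) / q)))
          = c₀ * d₀ ^ 2 * s ^ 2 * (Q⁻¹ ^ 2 * (x₁ y * η₁ y a - x₂ y * η₂ y a)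
            * (x₁ y * η₁ y b - x₂ y * η₂ y b)) / q ^ 2 := by ring
        rw [h2, hs2, hs]
        field_simp
      have e2 : c₀ * d₀ ^ 2 * (t ^ 4 * (lam y * (x₁ y * η₂ y a - x₂ y * η₁ y a) / (d₀ * s * t)
          * (lam y * (x₁ y * η₂ y b - x₂ y * η₁ y b) / (d₀ * s * t))))
          = (x₁ y * η₂ y a - x₂ y * η₁ y a) * (x₁ y * η₂ y b - x₂ y * η₁ y b) / Q := by
        have h2 : c₀ * d₀ ^ 2 * (t ^ 4 * (lam y * (x₁ y * η₂ y a - x₂ y * η₁ y a) / (d₀ * s * t)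
          * (lam y * (x₁ y * η₂ y b - x₂ y * η₁ y b) / (d₀ * s * t))))
          = c₀ * (t ^ 2 * lam y ^ 2 * ((x₁ y * η₂ y a - x₂ y * η₁ y a)
            * (x₁ y * η₂ y b - x₂ y * η₁ y b))) / s ^ 2 := by
          field_simp
        rw [h2, hs, ht, ← hc]
        field_simp
      rw [mul_sub, e1, e2, ← sub_div, eq_div_iff hQ, hQd]
      ring
    · have ht := hcos y hy
      have : Real.cos (ψ y 0) ^ 4 = (Real.cos (u y) ^ 2) ^ 2 := by rw [hψ0]; ring
      rw [hscale, this, ht, ← hc]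
      field_simp

end IsKillingCoframe

end DarbouxEmbedding

end

noncomputable section

namespace DarbouxEmbedding

/-! ## The curvature of the normal form -/

lemma extD_smul_const {f : Plane → ℝ} {y : Plane} (hf : DifferentiableAt ℝ f y)
    (α : Plane →L[ℝ] ℝ) (a b : Plane) :
    extD (fun z => f z • α) y a b = fderiv ℝ f y a * α b - fderiv ℝ f y b * α a := by
  rw [extD_fun_smul hf (differentiableAt_const α)]
  simp [extD]

/-- The coframe sin u dv, cos²u du has connection form sec u dv, whose derivative sec u tan u du ∧
dv is sec⁴u times sin u cos²u du ∧ dv. -/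
theorem hasCoordCurvatureAt_normalForm {y : Plane} (h0 : 0 < y 0) (h1 : y 0 < Real.pi / 2) :
    HasCoordCurvatureAt normalForm y (1 / Real.cos (y 0) ^ 4) := by
  set du : Plane →L[ℝ] ℝ := EuclideanSpace.proj 0
  set dv : Plane →L[ℝ] ℝ := EuclideanSpace.proj 1
  have hp : ∀ z : Plane, HasFDerivAt (fun z : Plane => z 0) du z := fun z =>
    (EuclideanSpace.proj (𝕜 := ℝ) 0 : Plane →L[ℝ] ℝ).hasFDerivAt
  have sp : ContDiff ℝ ∞ fun z : Plane => z 0 :=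
    (EuclideanSpace.proj (𝕜 := ℝ) 0 : Plane →L[ℝ] ℝ).contDiff
  set U : Set Plane := {z | 0 < z 0 ∧ z 0 < Real.pi / 2} with hU
  have hcos : ∀ z ∈ U, Real.cos (z 0) ≠ 0 := fun z hz =>
    (Real.cos_pos_of_mem_Ioo ⟨by linarith [hz.1, Real.pi_pos], hz.2⟩).ne'
  have dsin : ∀ z a, fderiv ℝ (fun z : Plane => Real.sin (z 0)) z a = Real.cos (z 0) * a 0 := by
    intro z a
    rw [(hp z).sin.fderiv]
    rfl
  have dcos2 : ∀ z a, fderiv ℝ (fun z : Plane => Real.cos (z 0) ^ 2) z a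
      = -2 * Real.cos (z 0) * Real.sin (z 0) * a 0 := by
    intro z a
    rw [((hp z).cos.pow 2).fderiv]
    simp [du]
    ring
  have dsec : ∀ z ∈ U, ∀ a, fderiv ℝ (fun z : Plane => 1 / Real.cos (z 0)) z a
      = Real.sin (z 0) / Real.cos (z 0) ^ 2 * a 0 := by
    intro z hz a
    rw [fderiv_div_apply (differentiableAt_const _) (hp z).cos.differentiableAt (hcos z hz),
      (hp z).cos.fderiv]
    simp [du]
    ring
  have ss : ContDiff ℝ ∞ fun z : Plane => Real.sin (z 0) := Real.contDiff_sin.comp sp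
  have sc : ContDiff ℝ ∞ fun z : Plane => Real.cos (z 0) := Real.contDiff_cos.comp sp
  have ssec : ContDiffOn ℝ ∞ (fun z : Plane => 1 / Real.cos (z 0)) U :=
    contDiffOn_const.div sc.contDiffOn hcos
  have hUo : IsOpen U := (isOpen_lt continuous_const sp.continuous).inter
    (isOpen_lt sp.continuous continuous_const)
  refine ⟨U, fun z => Real.sin (z 0) • dv, fun z => Real.cos (z 0) ^ 2 • du,
    fun z => (1 / Real.cos (z 0)) • dv, ⟨hUo, (ss.smul contDiff_const).contDiffOn,
      ((sc.pow 2).smul contDiff_const).contDiffOn, ssec.smul contDiffOn_const, ?_, ?_, ?_⟩,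
    ⟨h0, h1⟩, ?_⟩
  · intro z _ a b
    simp [normalForm, du, dv]
    ring
  · intro z hz a b
    have := hcos z hz
    rw [extD_smul_const (ss.differentiable (by simp) z), dsin, dsin]
    simp [wedge, du, dv]
    field_simp
  · intro z hz a b
    rw [extD_smul_const ((sc.pow 2).differentiable (by simp) z), dcos2, dcos2]
    simp [wedge, du, dv]
    ring
  · intro a b
    have hy : y ∈ U := ⟨h0, h1⟩
    have := hcos y hy
    rw [extD_smul_const ((ssec.contDiffAt (hUo.mem_nhds hy)).differentiableAt (by simp)),
      dsec y hy, dsec y hy]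
    simp [wedge, du, dv]
    field_simp
    ring

/-! ## Uniqueness of the invariants -/

/-- The invariants `lam ^ 2` and `K` of a Killing field are determined by the length of the Killing
field and by the square of the form `μ`. -/
lemma invariants_unique {N : Set Plane} (hN : IsOpen N) {Q lam lam' K K' : Plane → ℝ}
    {μ μ' : Plane → Plane → ℝ} (hl : ∀ y ∈ N, DifferentiableAt ℝ lam y)
    (hl' : ∀ y ∈ N, DifferentiableAt ℝ lam' y) (hK : ContinuousOn K N) (hK' : ContinuousOn K' N)
    (dQ : ∀ y ∈ N, ∀ a, fderiv ℝ Q y a = 2 * lam y * μ y a)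
    (dQ' : ∀ y ∈ N, ∀ a, fderiv ℝ Q y a = 2 * lam' y * μ' y a)
    (dl : ∀ y ∈ N, ∀ a, fderiv ℝ lam y a = K y * μ y a)
    (dl' : ∀ y ∈ N, ∀ a, fderiv ℝ lam' y a = K' y * μ' y a)
    (hμ : ∀ y ∈ N, ∀ a, μ y a ^ 2 = μ' y a ^ 2) (hne : ∀ y ∈ N, ∃ a, μ y a ≠ 0) {y : Plane}
    (hy : y ∈ N) : lam y ^ 2 = lam' y ^ 2 ∧ K y = K' y := by
  -- Only squares can be compared: the forms μ, μ' agree up to sign, so the signs of lam, lam' are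
  -- not determined. Squaring dQ = 2 lam μ = 2 lam' μ' removes this ambiguity.
  have hL : ∀ y ∈ N, lam y ^ 2 = lam' y ^ 2 := by
    intro y hy
    obtain ⟨a, ha⟩ := hne y hy
    have h1 := (dQ y hy a).symm.trans (dQ' y hy a)
    have h2 : (lam y ^ 2 - lam' y ^ 2) * μ y a ^ 2 = 0 := by
      linear_combination (1 / 4) * (2 * lam y * μ y a + 2 * lam' y * μ' y a) * h1
        - lam' y ^ 2 * hμ y hy a
    exact sub_eq_zero.mp ((mul_eq_zero.mp h2).resolve_right (pow_ne_zero 2 ha))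
  refine ⟨hL y hy, ?_⟩
  have hgen : ∀ y ∈ N, lam y ≠ 0 → K y = K' y := by
    intro y hy h0
    obtain ⟨a, ha⟩ := hne y hy
    have e : (fun z => lam z ^ 2) =ᶠ[𝓝 y] fun z => lam' z ^ 2 := by
      filter_upwards [hN.mem_nhds hy] with z hz
      exact hL z hz
    have h1 := congrArg (fun L : Plane →L[ℝ] ℝ => L a) (e.fderiv_eq (𝕜 := ℝ))
    simp only [((hl y hy).hasFDerivAt.pow 2).fderiv, ((hl' y hy).hasFDerivAt.pow 2).fderiv] at h1
    simp [dl y hy, dl' y hy] at h1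
    have h2 := (dQ y hy a).symm.trans (dQ' y hy a)
    have h3 : (K y - K' y) * (lam y ^ 2 * μ y a ^ 2) = 0 := by
      linear_combination (lam y * μ y a / 2) * h1 + (K' y * lam' y * μ' y a / 2) * h2
        - K' y * μ y a ^ 2 * hL y hy - K' y * lam' y ^ 2 * hμ y hy a
    exact sub_eq_zero.mp ((mul_eq_zero.mp h3).resolve_right
      (mul_ne_zero (pow_ne_zero 2 h0) (pow_ne_zero 2 ha)))
  by_contra hneq
  -- If K and K' differed at y, they would differ nearby, so lam and lam' would vanish there. Their
  -- differentials Kμ and K'μ' would then be zero at y, giving K = K' = 0.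
  have hop : ∀ᶠ z in 𝓝 y, K z - K' z ≠ 0 :=
    ((hK.sub hK').continuousAt (hN.mem_nhds hy)).eventually_ne (sub_ne_zero.mpr hneq)
  have hlam : ∀ᶠ z in 𝓝 y, lam z = 0 ∧ lam' z = 0 := by
    filter_upwards [hop, hN.mem_nhds hy] with z hz hzN
    have h0 : lam z = 0 := by
      by_contra h
      exact hz (sub_eq_zero.mpr (hgen z hzN h))
    refine ⟨h0, ?_⟩
    have := hL z hzN
    rw [h0] at this
    exact pow_eq_zero_iff two_ne_zero |>.mp (this.symm.trans (by ring))
  obtain ⟨a, ha⟩ := hne y hy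
  have ha' : μ' y a ≠ 0 := by
    intro h
    have := hμ y hy a
    rw [h] at this
    exact ha (pow_eq_zero_iff two_ne_zero |>.mp (this.trans (by ring)))
  have e1 : lam =ᶠ[𝓝 y] fun _ => 0 := hlam.mono fun z hz => hz.1
  have e2 : lam' =ᶠ[𝓝 y] fun _ => 0 := hlam.mono fun z hz => hz.2
  have k1 := dl y hy a
  have k2 := dl' y hy a
  rw [e1.fderiv_eq] at k1
  rw [e2.fderiv_eq] at k2
  simp [ha] at k1
  simp [ha'] at k2
  exact hneq (k1.trans k2.symm)

lemma IsKillingCoframe.mono {U V : Set Plane} {η₁ η₂ η₁₂ : Plane → Plane →L[ℝ] ℝ}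
    {x₁ x₂ lam K : Plane → ℝ} (H : IsKillingCoframe U η₁ η₂ η₁₂ x₁ x₂ lam K) (hV : IsOpen V)
    (h : V ⊆ U) : IsKillingCoframe V η₁ η₂ η₁₂ x₁ x₂ lam K :=
  ⟨hV, H.smooth_η₁.mono h, H.smooth_η₂.mono h, H.smooth_η₁₂.mono h, H.smooth_x₁.mono h,
    H.smooth_x₂.mono h, H.smooth_lam.mono h, H.smooth_K.mono h, fun y hy => H.indep y (h hy),
    fun y hy => H.pos y (h hy), fun y hy => H.extD_η₁ y (h hy), fun y hy => H.extD_η₂ y (h hy),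
    fun y hy => H.extD_η₁₂ y (h hy), fun y hy => H.fderiv_x₁ y (h hy),
    fun y hy => H.fderiv_x₂ y (h hy), fun y hy => H.fderiv_lam y (h hy)⟩

lemma IsOrthonormalCoframe.mono {G : Plane → Plane → Plane → ℝ} {U V : Set Plane}
    {η₁ η₂ η₁₂ : Plane → Plane →L[ℝ] ℝ} (H : IsOrthonormalCoframe G U η₁ η₂ η₁₂) (hV : IsOpen V)
    (h : V ⊆ U) : IsOrthonormalCoframe G V η₁ η₂ η₁₂ :=
  ⟨hV, H.smooth₁.mono h, H.smooth₂.mono h, H.smooth₁₂.mono h, fun y hy => H.metric_eq y (h hy),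
    fun y hy => H.extD₁ y (h hy), fun y hy => H.extD₂ y (h hy)⟩

/-- An orthonormal coframe of an indefinite metric is linearly independent. -/
lemma IsOrthonormalCoframe.indep {G : Plane → Plane → Plane → ℝ} {U : Set Plane}
    {η₁ η₂ η₁₂ : Plane → Plane →L[ℝ] ℝ} (H : IsOrthonormalCoframe G U η₁ η₂ η₁₂) {y : Plane}
    (hy : y ∈ U) (hp : ∃ v, 0 < G y v v) (hn : ∃ v, G y v v < 0) {a : Plane}
    (h₁ : η₁ y a = 0) (h₂ : η₂ y a = 0) : a = 0 := by
  obtain ⟨v, hv⟩ := hp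
  obtain ⟨w, hw⟩ := hn
  rw [H.metric_eq y hy] at hv hw
  let L : Plane →ₗ[ℝ] ℝ × ℝ := ((η₁ y).prod (η₂ y) : Plane →L[ℝ] ℝ × ℝ)
  have hsurj : Function.Surjective L := by
    -- One vector is timelike and the other spacelike; vectors with proportional coframe values
    -- would have squares of the same sign.
    have hdet : η₁ y v * η₂ y w - η₂ y v * η₁ y w ≠ 0 := by
      intro h
      nlinarith [sq_nonneg (η₁ y v * η₁ y w - η₂ y v * η₂ y w), mul_pos hv (neg_pos.mpr hw)]
    rintro ⟨s, t⟩
    refine ⟨((s * η₂ y w - t * η₁ y w) / (η₁ y v * η₂ y w - η₂ y v * η₁ y w)) • v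
      + ((t * η₁ y v - s * η₂ y v) / (η₁ y v * η₂ y w - η₂ y v * η₁ y w)) • w, ?_⟩
    have e1 : ∀ z, L z = (η₁ y z, η₂ y z) := fun z => rfl
    rw [e1, map_add, map_add, map_smul, map_smul, map_smul, map_smul]
    simp only [smul_eq_mul, div_mul_eq_mul_div, ← add_div]
    refine Prod.ext ?_ ?_
    · change _ / _ = s
      rw [div_eq_iff hdet]
      ring
    · change _ / _ = t
      rw [div_eq_iff hdet]
      ring
  have hinj : Function.Injective L :=
    (LinearMap.injective_iff_surjective_of_finrank_eq_finrank (by simp)).mpr hsurj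
  apply hinj
  rw [map_zero]
  exact Prod.ext h₁ h₂

end DarbouxEmbedding

end

noncomputable section

namespace DarbouxEmbedding

/-! ## Metrics and vector fields in charts -/

section Charts

variable {M : Type*} [TopologicalSpace M] [ChartedSpace Plane M] [IsManifold (𝓡 2) ∞ M]
  {φ φ₁ φ₂ : OpenPartialHomeomorph M Plane} {p : M}

lemma mdifferentiableAt_chart (hφ : φ ∈ IsManifold.maximalAtlas (𝓡 2) ∞ M) (hp : p ∈ φ.source) :
    MDifferentiableAt (𝓡 2) 𝓘(ℝ, Plane) φ p :=
  (contMDiffAt_of_mem_maximalAtlas hφ hp).mdifferentiableAt (by simp)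

lemma mdifferentiableAt_chart_symm (hφ : φ ∈ IsManifold.maximalAtlas (𝓡 2) ∞ M) {y : Plane}
    (hy : y ∈ φ.target) : MDifferentiableAt 𝓘(ℝ, Plane) (𝓡 2) φ.symm y :=
  (contMDiffAt_symm_of_mem_maximalAtlas hφ hy).mdifferentiableAt (by simp)

lemma mfderiv_symm_mfderiv (hφ : φ ∈ IsManifold.maximalAtlas (𝓡 2) ∞ M) (hp : p ∈ φ.source)
    (v : TangentSpace (𝓡 2) p) :
    (mfderiv 𝓘(ℝ, Plane) (𝓡 2) φ.symm (φ p) (mfderiv (𝓡 2) 𝓘(ℝ, Plane) φ p v) : Plane) = v := by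
  have h := mfderiv_comp p (mdifferentiableAt_chart_symm hφ (φ.map_source hp))
    (mdifferentiableAt_chart hφ hp)
  have hid : φ.symm ∘ φ =ᶠ[𝓝 p] id := φ.eventually_left_inverse hp
  rw [hid.mfderiv_eq, mfderiv_id] at h
  exact (congrArg (fun L : Plane →L[ℝ] Plane => L v) h).symm

lemma fderiv_transition (hφ₁ : φ₁ ∈ IsManifold.maximalAtlas (𝓡 2) ∞ M)
    (hφ₂ : φ₂ ∈ IsManifold.maximalAtlas (𝓡 2) ∞ M) (h₁ : p ∈ φ₁.source) (h₂ : p ∈ φ₂.source) :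
    DifferentiableAt ℝ (φ₂ ∘ φ₁.symm) (φ₁ p) ∧ ∀ v : TangentSpace (𝓡 2) p,
    fderiv ℝ (φ₂ ∘ φ₁.symm) (φ₁ p) (mfderiv (𝓡 2) 𝓘(ℝ, Plane) φ₁ p v)
      = (mfderiv (𝓡 2) 𝓘(ℝ, Plane) φ₂ p v : Plane) := by
  have hs := mdifferentiableAt_chart_symm hφ₁ (φ₁.map_source h₁)
  have hl : φ₁.symm (φ₁ p) = p := φ₁.left_inv h₁
  have h2 : MDifferentiableAt (𝓡 2) 𝓘(ℝ, Plane) φ₂ (φ₁.symm (φ₁ p)) := by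
    rw [hl]; exact mdifferentiableAt_chart hφ₂ h₂
  refine ⟨(h2.comp (φ₁ p) hs).differentiableAt, fun v => ?_⟩
  have hτ : MDifferentiableAt 𝓘(ℝ, Plane) 𝓘(ℝ, Plane) (φ₂ ∘ φ₁.symm) (φ₁ p) := h2.comp (φ₁ p) hs
  have h := mfderiv_comp p hτ (mdifferentiableAt_chart hφ₁ h₁)
  have hid : (φ₂ ∘ φ₁.symm) ∘ φ₁ =ᶠ[𝓝 p] φ₂ := by
    filter_upwards [φ₁.eventually_left_inverse h₁] with q hq
    simp [hq]
  rw [hid.mfderiv_eq, mfderiv_eq_fderiv] at h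
  exact (congrArg (fun L : Plane →L[ℝ] Plane => L v) h).symm

lemma mfderiv_chart_surjective (hφ : φ ∈ IsManifold.maximalAtlas (𝓡 2) ∞ M) (hp : p ∈ φ.source)
    (a : Plane) : ∃ v : TangentSpace (𝓡 2) p, (mfderiv (𝓡 2) 𝓘(ℝ, Plane) φ p v : Plane) = a := by
  let L : Plane →L[ℝ] Plane := mfderiv (𝓡 2) 𝓘(ℝ, Plane) φ p
  have hi : Function.Injective (L : Plane →ₗ[ℝ] Plane) := by
    intro v w hvw
    rw [← mfderiv_symm_mfderiv hφ hp v, ← mfderiv_symm_mfderiv hφ hp w]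
    exact congrArg _ hvw
  exact LinearMap.injective_iff_surjective.mp hi a

lemma coord_mfderiv (g : LorentzianMetric M) (hφ : φ ∈ IsManifold.maximalAtlas (𝓡 2) ∞ M)
    (hp : p ∈ φ.source) (v w : TangentSpace (𝓡 2) p) :
    g.coord φ (φ p) (mfderiv (𝓡 2) 𝓘(ℝ, Plane) φ p v) (mfderiv (𝓡 2) 𝓘(ℝ, Plane) φ p w)
      = g.val p v w := by
  -- The point φ.symm (φ p) equals p only propositionally and occurs in the type of tangent vectors;
  -- generalizing it to q allows substitution.
  have key : ∀ q, q = p → ∀ v' w' : Plane, v' = v → w' = w →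
      (g.val q : Plane →L[ℝ] Plane →L[ℝ] ℝ) v' w' = g.val p v w := by
    rintro _ rfl _ _ rfl rfl
    rfl
  exact key _ (φ.left_inv hp) _ _ (mfderiv_symm_mfderiv hφ hp v) (mfderiv_symm_mfderiv hφ hp w)

lemma coordField_apply (X : ∀ p : M, TangentSpace (𝓡 2) p) (hp : p ∈ φ.source) :
    coordField X φ (φ p) = (mfderiv (𝓡 2) 𝓘(ℝ, Plane) φ p (X p) : Plane) := by
  have key : ∀ q, q = p → (mfderiv (𝓡 2) 𝓘(ℝ, Plane) φ q (X q) : Plane)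
      = mfderiv (𝓡 2) 𝓘(ℝ, Plane) φ p (X p) := by
    rintro _ rfl
    rfl
  exact key _ (φ.left_inv hp)

lemma coord_transition (g : LorentzianMetric M) (hφ₁ : φ₁ ∈ IsManifold.maximalAtlas (𝓡 2) ∞ M)
    (hφ₂ : φ₂ ∈ IsManifold.maximalAtlas (𝓡 2) ∞ M) (h₁ : p ∈ φ₁.source) (h₂ : p ∈ φ₂.source)
    (a b : Plane) : g.coord φ₂ (φ₂ p) (fderiv ℝ (φ₂ ∘ φ₁.symm) (φ₁ p) a)
      (fderiv ℝ (φ₂ ∘ φ₁.symm) (φ₁ p) b) = g.coord φ₁ (φ₁ p) a b := by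
  obtain ⟨v, rfl⟩ := mfderiv_chart_surjective hφ₁ h₁ a
  obtain ⟨w, rfl⟩ := mfderiv_chart_surjective hφ₁ h₁ b
  rw [coord_mfderiv g hφ₁ h₁, (fderiv_transition hφ₁ hφ₂ h₁ h₂).2 v,
    (fderiv_transition hφ₁ hφ₂ h₁ h₂).2 w, coord_mfderiv g hφ₂ h₂]

lemma coordField_transition (X : ∀ p : M, TangentSpace (𝓡 2) p)
    (hφ₁ : φ₁ ∈ IsManifold.maximalAtlas (𝓡 2) ∞ M) (hφ₂ : φ₂ ∈ IsManifold.maximalAtlas (𝓡 2) ∞ M)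
    (h₁ : p ∈ φ₁.source) (h₂ : p ∈ φ₂.source) :
    fderiv ℝ (φ₂ ∘ φ₁.symm) (φ₁ p) (coordField X φ₁ (φ₁ p)) = coordField X φ₂ (φ₂ p) := by
  rw [coordField_apply X h₁, (fderiv_transition hφ₁ hφ₂ h₁ h₂).2, coordField_apply X h₂]

/-- The coordinate field is the fibre component of the tangent map of the chart applied to the
section X. -/
lemma contDiffOn_coordField {X : ∀ p : M, TangentSpace (𝓡 2) p}
    (hX : ContMDiff (𝓡 2) (𝓡 2).tangent ∞ (fun p => (⟨p, X p⟩ : TangentBundle (𝓡 2) M)))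
    (hφ : φ ∈ IsManifold.maximalAtlas (𝓡 2) ∞ M) : ContDiffOn ℝ ∞ (coordField X φ) φ.target := by
  have : IsManifold (𝓡 2) 1 M := .of_le (n := ∞) (by simp)
  have h1 := (contMDiffOn_of_mem_maximalAtlas hφ).contMDiffOn_tangentMapWithin (m := ∞) (by simp)
    φ.open_source.uniqueMDiffOn
  have h2 := h1.comp (hX.comp_contMDiffOn (contMDiffOn_symm_of_mem_maximalAtlas hφ))
    (fun y hy => φ.map_target hy)
  have h3 := (contMDiff_snd_tangentBundle_modelSpace (n := ∞) Plane 𝓘(ℝ, Plane)).comp_contMDiffOn h2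
  refine (contMDiffOn_iff_contDiffOn.mp h3).congr fun y hy => ?_
  exact congrArg (fun L : Plane →L[ℝ] Plane => L (X (φ.symm y)))
    (mfderivWithin_of_isOpen (I := 𝓡 2) (I' := 𝓡 2) (f := φ) φ.open_source (φ.map_target hy)).symm

/-- In any chart, the values of a timelike Killing field in an orthonormal coframe satisfy the
structure equations. -/
lemma exists_isKillingCoframe_coord {g : LorentzianMetric M} {X : ∀ p : M, TangentSpace (𝓡 2) p}
    (hX : IsKilling g X) (htimelike : ∀ p : M, 0 < g.val p (X p) (X p))
    (hφ : φ ∈ IsManifold.maximalAtlas (𝓡 2) ∞ M) {U : Set Plane} (hU : U ⊆ φ.target)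
    {η₁ η₂ η₁₂ : Plane → Plane →L[ℝ] ℝ} (H : IsOrthonormalCoframe (g.coord φ) U η₁ η₂ η₁₂) :
    ∃ lam K : Plane → ℝ, IsKillingCoframe U η₁ η₂ η₁₂ (fun y => η₁ y (coordField X φ y))
      (fun y => η₂ y (coordField X φ y)) lam K := by
  have hval : ∀ y ∈ U, ∀ v : TangentSpace (𝓡 2) (φ.symm y),
      g.coord φ y (mfderiv (𝓡 2) 𝓘(ℝ, Plane) φ (φ.symm y) v)
        (mfderiv (𝓡 2) 𝓘(ℝ, Plane) φ (φ.symm y) v) = g.val (φ.symm y) v v := by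
    intro y hy v
    have := coord_mfderiv g hφ (φ.map_target (hU hy)) v v
    rwa [φ.right_inv (hU hy)] at this
  refine exists_isKillingCoframe H ?_ ((contDiffOn_coordField hX.1 hφ).mono hU) ?_
    fun y hy a b => hX.2 φ hφ y (hU hy) a b
  · intro y hy a h1 h2
    obtain ⟨v, hv⟩ := g.exists_pos (φ.symm y)
    obtain ⟨w, hw⟩ := g.exists_neg (φ.symm y)
    rw [← hval y hy] at hv hw
    exact H.indep hy ⟨_, hv⟩ ⟨_, hw⟩ h1 h2
  · intro y hy
    have := htimelike (φ.symm y)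
    rw [← hval y hy] at this
    exact this

/-- At `p`, the metric has curvature `κ`, and the square of the covariant derivative of the
Killing field `X` is `L`. -/
def HasInvariantsAt (g : LorentzianMetric M) (X : ∀ p : M, TangentSpace (𝓡 2) p) (p : M)
    (L κ : ℝ) : Prop :=
  ∃ φ ∈ IsManifold.maximalAtlas (𝓡 2) ∞ M, p ∈ φ.source ∧
    ∃ (U : Set Plane) (η₁ η₂ η₁₂ : Plane → Plane →L[ℝ] ℝ) (lam K : Plane → ℝ),
      U ⊆ φ.target ∧ φ p ∈ U ∧
      (∀ y ∈ U, ∀ a b, g.coord φ y a b = η₁ y a * η₁ y b - η₂ y a * η₂ y b) ∧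
      IsKillingCoframe U η₁ η₂ η₁₂ (fun y => η₁ y (coordField X φ y))
        (fun y => η₂ y (coordField X φ y)) lam K ∧ lam (φ p) ^ 2 = L ∧ K (φ p) = κ

/-- The transition map carries metric and field of one chart to those of the other. The squared
length Q is therefore shared, and so is μ², which depends on metric and field alone; Q and μ²
determine lam² and K. -/
theorem HasInvariantsAt.unique {g : LorentzianMetric M} {X : ∀ p : M, TangentSpace (𝓡 2) p}
    {L L' κ κ' : ℝ} (h : HasInvariantsAt g X p L κ) (h' : HasInvariantsAt g X p L' κ') :
    L = L' ∧ κ = κ' := by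
  obtain ⟨φ₁, hφ₁, hp₁, U₁, η₁, η₂, η₁₂, lam, K, hU₁, hpU₁, hG₁, H₁, rfl, rfl⟩ := h
  obtain ⟨φ₂, hφ₂, hp₂, U₂, ζ₁, ζ₂, ζ₁₂, lam', K', hU₂, hpU₂, hG₂, H₂, rfl, rfl⟩ := h'
  set e := φ₁.symm.trans φ₂ with he
  have hee : (e : Plane → Plane) = φ₂ ∘ φ₁.symm := rfl
  set N : Set Plane := U₁ ∩ (e.source ∩ e ⁻¹' U₂) with hN
  have hNo : IsOpen N := H₁.isOpen.inter (e.isOpen_inter_preimage H₂.isOpen)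
  have hpN : φ₁ p ∈ N := by
    refine ⟨hpU₁, ?_, ?_⟩
    · simp [he, φ₁.map_source hp₁, φ₁.left_inv hp₁, hp₂]
    · simpa [hee, φ₁.left_inv hp₁] using hpU₂
  have hpt : ∀ y ∈ N, ∃ q, q ∈ φ₁.source ∧ q ∈ φ₂.source ∧ φ₁ q = y ∧ φ₂ q = e y := by
    intro y hy
    have h1 := hU₁ hy.1
    have h2 : φ₁.symm y ∈ φ₂.source := by
      have := hy.2.1
      simp only [he, OpenPartialHomeomorph.trans_source] at this
      exact this.2
    exact ⟨φ₁.symm y, φ₁.map_target h1, h2, φ₁.right_inv h1, rfl⟩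
  have hdiff : ∀ y ∈ N, DifferentiableAt ℝ e y := by
    intro y hy
    obtain ⟨q, h1, h2, rfl, -⟩ := hpt y hy
    exact (fderiv_transition hφ₁ hφ₂ h1 h2).1
  have hGe : ∀ y ∈ N, ∀ a b, ζ₁ (e y) (fderiv ℝ e y a) * ζ₁ (e y) (fderiv ℝ e y b)
      - ζ₂ (e y) (fderiv ℝ e y a) * ζ₂ (e y) (fderiv ℝ e y b)
      = η₁ y a * η₁ y b - η₂ y a * η₂ y b := by
    intro y hy a b
    rw [← hG₂ _ hy.2.2, ← hG₁ y hy.1]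
    obtain ⟨q, h1, h2, rfl, h3⟩ := hpt y hy
    rw [← h3]
    exact coord_transition g hφ₁ hφ₂ h1 h2 a b
  have hXe : ∀ y ∈ N, fderiv ℝ e y (coordField X φ₁ y) = coordField X φ₂ (e y) := by
    intro y hy
    obtain ⟨q, h1, h2, rfl, h3⟩ := hpt y hy
    rw [← h3]
    have := coordField_transition X hφ₁ hφ₂ h1 h2
    exact this
  have hchain : ∀ {f : Plane → ℝ} {y}, y ∈ N → DifferentiableAt ℝ f (e y) → ∀ a,
      fderiv ℝ (fun z => f (e z)) y a = fderiv ℝ f (e y) (fderiv ℝ e y a) := by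
    intro f y hy hf a
    have h1 : fderiv ℝ (fun z => f (e z)) y = _ :=
      (hf.hasFDerivAt.comp y (hdiff y hy).hasFDerivAt).fderiv
    rw [h1]
    rfl
  have hcont : ContinuousOn e N := e.continuousOn.mono fun y hy => hy.2.1
  have key := invariants_unique hNo
    (Q := fun y => η₁ y (coordField X φ₁ y) ^ 2 - η₂ y (coordField X φ₁ y) ^ 2)
    (lam := lam) (lam' := fun y => lam' (e y)) (K := K) (K' := fun y => K' (e y))
    (μ := fun y a => η₁ y (coordField X φ₁ y) * η₂ y a - η₂ y (coordField X φ₁ y) * η₁ y a)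
    (μ' := fun y a => ζ₁ (e y) (coordField X φ₂ (e y)) * ζ₂ (e y) (fderiv ℝ e y a)
      - ζ₂ (e y) (coordField X φ₂ (e y)) * ζ₁ (e y) (fderiv ℝ e y a))
    (fun y hy => H₁.differentiableAt hy.1 H₁.smooth_lam)
    (fun y hy => DifferentiableAt.comp (g := lam') y (H₂.differentiableAt hy.2.2 H₂.smooth_lam)
      (hdiff y hy))
    (H₁.smooth_K.continuousOn.mono fun y hy => hy.1)
    (H₂.smooth_K.continuousOn.comp hcont fun y hy => hy.2.2)
    (fun y hy a => H₁.fderiv_Q hy.1 a) ?_ (fun y hy a => H₁.fderiv_lam y hy.1 a) ?_ ?_ ?_ hpN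
  · have hep : e (φ₁ p) = φ₂ p := by
      change φ₂ (φ₁.symm (φ₁ p)) = _
      rw [φ₁.left_inv hp₁]
    rw [hep] at key
    exact key
  · intro y hy a
    have hev : (fun y => η₁ y (coordField X φ₁ y) ^ 2 - η₂ y (coordField X φ₁ y) ^ 2) =ᶠ[𝓝 y]
        fun y => (fun z => ζ₁ z (coordField X φ₂ z) ^ 2 - ζ₂ z (coordField X φ₂ z) ^ 2) (e y) := by
      filter_upwards [hNo.mem_nhds hy] with z hz
      have := hGe z hz (coordField X φ₁ z) (coordField X φ₁ z)
      rw [hXe z hz] at this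
      simp only [pow_two]
      exact this.symm
    rw [hev.fderiv_eq, hchain hy (H₂.differentiableAt hy.2.2
      ((H₂.smooth_x₁.pow 2).sub (H₂.smooth_x₂.pow 2))), H₂.fderiv_Q hy.2.2]
  · intro y hy a
    rw [hchain hy (H₂.differentiableAt hy.2.2 H₂.smooth_lam), H₂.fderiv_lam _ hy.2.2]
  · intro y hy a
    have h1 := hGe y hy (coordField X φ₁ y) a
    have h2 := hGe y hy (coordField X φ₁ y) (coordField X φ₁ y)
    have h3 := hGe y hy a a
    rw [hXe y hy] at h1 h2
    -- The Lorentzian Lagrange identity μ(a)² = g(X, a)² - g(X, X) g(a, a) expresses μ² through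
    -- metric and field.
    have e1 : ∀ x₁ x₂ s t : ℝ, (x₁ * t - x₂ * s) ^ 2
        = (x₁ * s - x₂ * t) ^ 2 - (x₁ * x₁ - x₂ * x₂) * (s * s - t * t) := by
      intros; ring
    refine (e1 _ _ _ _).trans (Eq.trans ?_ (e1 _ _ _ _).symm)
    rw [h1, h2, h3]
  · intro y hy
    obtain ⟨e₁, e₂, -, -, hd⟩ := exists_dualFrame H₁.smooth_η₁ H₁.smooth_η₂ H₁.indep
    obtain ⟨-, -, q3, q4, -⟩ := hd y hy.1
    refine ⟨e₂ y, ?_⟩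
    simp only [q3, q4, mul_one, mul_zero, sub_zero]
    exact H₁.x₁_ne_zero hy.1

end Charts

end DarbouxEmbedding

end

noncomputable section

namespace DarbouxEmbedding

/-! ### The local normal form on the surface and the constancy of the scale -/

section NormalForm

variable {M : Type*} [TopologicalSpace M] [ChartedSpace Plane M] [IsManifold (𝓡 2) ∞ M]
  {g : LorentzianMetric M} {X : ∀ p : M, TangentSpace (𝓡 2) p}

/-- The standard frame at the origin. -/
lemma standardFrame_mem : ((0, fun i => Pi.single i 1) : PointFrame) ∈ minkowskiFrames := by
  constructor
  · intro i j
    fin_cases i <;> fin_cases j <;> simp [minkowski_apply, frameSign]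
  · have : Matrix.of (fun i : Fin 3 => (Pi.single i 1 : Fin 3 → ℝ)) = 1 := by
      ext i j
      simp [Matrix.one_apply, Pi.single_apply, eq_comm]
    change Matrix.det (Matrix.of (fun i : Fin 3 => (Pi.single i 1 : Fin 3 → ℝ))) = 1
    rw [this, Matrix.det_one]

lemma IsKillingCoframe.eq_of_extD {U : Set Plane} {η₁ η₂ η₁₂ : Plane → Plane →L[ℝ] ℝ}
    {x₁ x₂ lam K : Plane → ℝ} (H : IsKillingCoframe U η₁ η₂ η₁₂ x₁ x₂ lam K) {y : Plane}
    (hy : y ∈ U) {κ : ℝ} (h : ∀ a b, extD η₁₂ y a b = -κ * wedge (η₁ y) (η₂ y) a b) :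
    K y = κ := by
  obtain ⟨e₁, e₂, -, -, hd⟩ := exists_dualFrame H.smooth_η₁ H.smooth_η₂ H.indep
  obtain ⟨q1, q2, q3, q4, -⟩ := hd y hy
  have := (H.extD_η₁₂ y hy (e₁ y) (e₂ y)).symm.trans (h (e₁ y) (e₂ y))
  simp [wedge, q1, q2, q3, q4] at this
  exact this

/-- The curvature of an elliptic metric is positive in every chart and coframe. -/
lemma curvature_pos (hell : g.IsElliptic) (hX : IsKilling g X)
    (htimelike : ∀ p : M, 0 < g.val p (X p) (X p)) {p : M} {L κ : ℝ}
    (h : HasInvariantsAt g X p L κ) : 0 < κ := by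
  obtain ⟨κ', hκ', φ, hφ, hp, U, η₁, η₂, η₁₂, H, hpU, hcurv⟩ := hell p
  have H' := H.mono (H.isOpen.inter φ.open_target) Set.inter_subset_left
  obtain ⟨lam, K, HK⟩ := exists_isKillingCoframe_coord hX htimelike hφ Set.inter_subset_right H'
  have hm : φ p ∈ U ∩ φ.target := ⟨hpU, φ.map_source hp⟩
  have h' : HasInvariantsAt g X p (lam (φ p) ^ 2) (K (φ p)) :=
    ⟨φ, hφ, hp, _, η₁, η₂, η₁₂, lam, K, Set.inter_subset_right, hm, H'.metric_eq, HK, rfl, rfl⟩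
  rw [(h.unique h').2, HK.eq_of_extD hm hcurv]
  exact hκ'

/-- Besides the normal coordinates, it records that c is the value of `metricScale` on intrinsic
invariants at every point of the chart. This is what permits comparison of the constants of
different charts. -/
theorem exists_local_normalForm (hell : g.IsElliptic) (hdarboux : IsDarbouxIntegrable g)
    (hX : IsKilling g X) (htimelike : ∀ p : M, 0 < g.val p (X p) (X p)) (p : M) :
    ∃ c : ℝ, 0 < c ∧ ∃ φ ∈ IsManifold.maximalAtlas (𝓡 2) ∞ M, p ∈ φ.source ∧
      (∀ q ∈ φ.source, ∃ L κ, HasInvariantsAt g X q L κ ∧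
        metricScale (g.val q (X q) (X q)) L κ = c) ∧
      ∀ y ∈ φ.target, 0 < y 0 ∧ y 0 < Real.pi / 2 ∧
        (∀ a b, g.coord φ y a b = c * normalForm y a b) ∧
        g.HasGaussCurvatureAt (φ.symm y) (1 / (c * Real.cos (y 0) ^ 4)) := by
  -- A single frame suffices, since the resulting equation lives on the surface.
  obtain ⟨φ, hφ, hp, U, η₁, η₂, η₁₂, hU, hpU, H, W, Ψ, w, P, hw, -, hD⟩ :=
    hdarboux p _ standardFrame_mem
  obtain ⟨lam, K, HK⟩ := exists_isKillingCoframe_coord hX htimelike hφ hU H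
  have hinv : ∀ q ∈ φ.source, φ q ∈ U → HasInvariantsAt g X q (lam (φ q) ^ 2) (K (φ q)) :=
    fun q hq hqU => ⟨φ, hφ, hq, U, η₁, η₂, η₁₂, lam, K, hU, hqU, H.metric_eq, HK, rfl, rfl⟩
  -- Ellipticity may be witnessed in another chart and coframe; uniqueness of the invariants
  -- transfers positivity to K.
  have hKpos : ∀ y ∈ U, 0 < K y := by
    intro y hy
    have := curvature_pos hell hX htimelike (hinv (φ.symm y) (φ.map_target (hU hy))
      (by rwa [φ.right_inv (hU hy)]))
    rwa [φ.right_inv (hU hy)] at this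
  obtain ⟨R, hR, dK⟩ := HK.exists_fderiv_eq HK.smooth_lam HK.smooth_K HK.fderiv_lam
  obtain ⟨V, hV, hVo, hpV⟩ := eventually_nhds_iff.mp
    (HK.eventually_lam_mul_eq hKpos hR dK P hpU hw hD)
  have HV := HK.mono (hVo.inter HK.isOpen) Set.inter_subset_right
  obtain ⟨ψ, hψp, hψV, hψ, hψ', hc, hmain⟩ := HV.exists_normal_coordinates
    (fun y hy => hKpos y hy.2) (fun y hy => dK y hy.2) (fun y hy => hV y hy.1)
    (y₀ := φ p) ⟨hpV, hpU⟩
  set c := metricScale (η₁ (φ p) (coordField X φ (φ p)) ^ 2 - η₂ (φ p) (coordField X φ (φ p)) ^ 2)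
    (lam (φ p) ^ 2) (K (φ p)) with hcdef
  have hφψ : φ.trans ψ ∈ IsManifold.maximalAtlas (𝓡 2) ∞ M := by
    refine OpenPartialHomeomorph.mem_maximalAtlas_of_contMDiffOn _ ?_ ?_
    · refine (contMDiffOn_iff_contDiffOn.mpr hψ).comp
        ((contMDiffOn_of_mem_maximalAtlas hφ).mono ?_) ?_
      · intro q hq
        rw [OpenPartialHomeomorph.trans_source] at hq
        exact hq.1
      · intro q hq
        rw [OpenPartialHomeomorph.trans_source] at hq
        exact hq.2
    · refine (contMDiffOn_symm_of_mem_maximalAtlas hφ).comp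
        ((contMDiffOn_iff_contDiffOn.mpr hψ').mono ?_) ?_
      · intro q hq
        rw [OpenPartialHomeomorph.trans_target] at hq
        exact hq.1
      · intro q hq
        rw [OpenPartialHomeomorph.trans_target] at hq
        exact hq.2
  refine ⟨c, hc, φ.trans ψ, hφψ, ?_, ?_, ?_⟩
  · rw [OpenPartialHomeomorph.trans_source]
    exact ⟨hp, hψp⟩
  · intro q hq
    rw [OpenPartialHomeomorph.trans_source] at hq
    have hqU : φ q ∈ U := (hψV hq.2).2
    refine ⟨_, _, hinv q hq.1 hqU, ?_⟩
    have hQ : g.val q (X q) (X q) = η₁ (φ q) (coordField X φ (φ q)) ^ 2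
        - η₂ (φ q) (coordField X φ (φ q)) ^ 2 := by
      rw [← coord_mfderiv g hφ hq.1, ← coordField_apply X hq.1, H.metric_eq _ hqU]
      ring
    rw [hQ]
    exact (hmain _ hq.2).2.1
  · intro y hy
    have hq := (φ.trans ψ).map_target hy
    have hqy : (φ.trans ψ) ((φ.trans ψ).symm y) = y := (φ.trans ψ).right_inv hy
    set q := (φ.trans ψ).symm y with hqdef
    have hq' := hq
    rw [OpenPartialHomeomorph.trans_source] at hq'
    obtain ⟨hq1, hq2⟩ := hq'
    have hqψ : ψ (φ q) = y := hqy
    have hqU : φ q ∈ U := (hψV hq2).2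
    obtain ⟨-, -, h0, h1, hG, hκ⟩ := hmain (φ q) hq2
    rw [hqψ] at h0 h1 hG hκ
    refine ⟨h0, h1, ?_, ?_⟩
    · intro a b
      have hev : (φ.trans ψ) ∘ φ.symm =ᶠ[𝓝 (φ q)] ψ := by
        filter_upwards [φ.open_target.mem_nhds (φ.map_source hq1)] with z hz
        change ψ (φ (φ.symm z)) = ψ z
        rw [φ.right_inv hz]
      -- Vectors in the new coordinates are images of vectors in the old ones, so the metric
      -- identity along ψ determines the metric in the new chart.
      have hsurj : ∀ a, ∃ a', fderiv ℝ ψ (φ q) a' = a := by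
        intro a
        obtain ⟨v, hv⟩ := mfderiv_chart_surjective hφψ hq a
        have h := (fderiv_transition hφ hφψ hq1 hq).2 v
        rw [hev.fderiv_eq] at h
        exact ⟨_, h.trans hv⟩
      obtain ⟨a', rfl⟩ := hsurj a
      obtain ⟨b', rfl⟩ := hsurj b
      have h := coord_transition g hφ hφψ hq1 hq a' b'
      rw [hev.fderiv_eq, hqy] at h
      rw [h, H.metric_eq _ hqU, hG]
    · refine ⟨φ, hφ, hq1, U, η₁, η₂, η₁₂, H, hqU, fun a b => ?_⟩
      rw [HK.extD_η₁₂ _ hqU, hκ]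

end NormalForm

end DarbouxEmbedding

end

/-- The constants of the local normal forms agree near each point because both equal `metricScale`
on the same invariants. They form a locally constant function on a connected surface, so one
constant serves everywhere. -/
theorem mainTheorem11 {M : Type*} [TopologicalSpace M] [ConnectedSpace M]
    [ChartedSpace DarbouxEmbedding.Plane M] [IsManifold (𝓡 2) ∞ M]
    (g : DarbouxEmbedding.LorentzianMetric M)
    (hell : g.IsElliptic)
    (hdarboux : DarbouxEmbedding.IsDarbouxIntegrable g)
    (X : ∀ p : M, TangentSpace (𝓡 2) p)
    (hkilling : DarbouxEmbedding.IsKilling g X)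
    (htimelike : ∀ p : M, 0 < g.val p (X p) (X p)) :
    (∀ y : DarbouxEmbedding.Plane, 0 < y 0 → y 0 < Real.pi / 2 →
      DarbouxEmbedding.HasCoordCurvatureAt DarbouxEmbedding.normalForm y
        (1 / Real.cos (y 0) ^ 4)) ∧
    ∃ c : ℝ, 0 < c ∧ ∀ p : M, ∃ φ ∈ IsManifold.maximalAtlas (𝓡 2) ∞ M, p ∈ φ.source ∧
      ∀ y ∈ φ.target, 0 < y 0 ∧ y 0 < Real.pi / 2 ∧
        (∀ a b, g.coord φ y a b = c * DarbouxEmbedding.normalForm y a b) ∧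
        g.HasGaussCurvatureAt (φ.symm y) (1 / (c * Real.cos (y 0) ^ 4)) := by
  refine ⟨fun y h0 h1 => DarbouxEmbedding.hasCoordCurvatureAt_normalForm h0 h1, ?_⟩
  choose c hc φ hφ hp hinv hform using
    DarbouxEmbedding.exists_local_normalForm hell hdarboux hkilling htimelike
  have hloc : IsLocallyConstant c := by
    rw [IsLocallyConstant.iff_eventually_eq]
    intro p
    filter_upwards [(φ p).open_source.mem_nhds (hp p)] with q hq
    obtain ⟨L, κ, h, hs⟩ := hinv p q hq
    -- The point q lies both in the chart around p and in its own chart, so its scale equals c p as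
    -- well as c q.
    obtain ⟨L', κ', h', hs'⟩ := hinv q q (hp q)
    obtain ⟨rfl, rfl⟩ := h.unique h'
    exact hs'.symm.trans hs
  obtain ⟨p₀⟩ : Nonempty M := inferInstance
  refine ⟨c p₀, hc p₀, fun p => ⟨φ p, hφ p, hp p, ?_⟩⟩
  rw [hloc.apply_eq_of_preconnectedSpace p₀ p]
  exact hform p
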